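/- Let $N\ge 1$ and let $\Gamma=\Gamma_0^*(N)$ be the group generated by $\Gamma_0(N)$ and all Atkin–Lehner involutions $W_e$, $e\|N$ (where $e\|N$ means that $e\mid N$ and $\gcd(e,N/e)=1$). For an integer $m\ge 1$ and $z$ in the upper half plane let $$\mathcal F_m(z,s)=\sum_{M\in\Gamma_\infty\backslash\Gamma}e(-m\,\mathrm{Re}\,Mz)\,(\mathrm{Im}\,Mz)^{1/2}\,I_{s-1/2}(2\pi m\,\mathrm{Im}\,Mz),\qquad e(w)=e^{2\pi i w},$$ where $\Gamma_\infty\subset\Gamma$ is the subgroup of translations (matrices being taken up to sign) and $I_\nu$ is the modified Bessel function of the first kind. The series converges absolutely for $\mathrm{Re}\,s>1$ and, for each $z$, continues analytically in $s$ to a neighbourhood of $s=1$, which defines $\mathcal F_m(z,1)$. Let $-c_m$ be the constant term of $2\pi\sqrt m\,\mathcal F_m(z,1)$, that is, its zeroth Fourier coefficient $\int_0^1 2\pi\sqrt m\,\mathcal F_m(x+iy,1)\,dx$. It exists, is independent of $y>0$, and is given by $$-c_m=24\,\frac{m}{m_N}\,\sigma(m_N)\prod_{p\mid N}(1-p^{-2})^{-1}\sum_{e\|N}\frac1e\prod_{p\mid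 \frac Ne}\delta_e(p)\,p^{1-\beta_{e,p}}\Bigl((1-p^{\beta_{e,p}-\alpha_p-2})(1+p^{-1})-1\Bigr).$$ Here $p$ runs over primes, $\sigma(n)$ is the sum of the positive divisors of $n$, $\alpha_p=\mathrm{ord}_p(m)$, $\beta_{e,p}=\mathrm{ord}_p(N/e)$, $m_N$ is the largest exact divisor of $m$ with $(m_N,N)=1$, and $\delta_e(p)=1$ if $\beta_{e,p}\le\alpha_p+1$ and $\delta_e(p)=0$ otherwise. In particular, $c_m=\sigma(m)\,c_1$ whenever $(m,N)=1$. -/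

import Mathlib

open scoped UpperHalfPlane MatrixGroups

noncomputable section

namespace NieburPoincare

/-- The exact divisors `e ‖ n` of `n`: those divisors `e` with `gcd(e, n / e) = 1`. -/
def exactDivisors (n : ℕ) : Finset ℕ :=
  n.divisors.filter fun e => Nat.Coprime e (n / e)

/-- The matrices of determinant one of all Atkin-Lehner involutions `W_e`, `e ‖ N`, of level `N`:
`e ^ (-1/2) * (e a, b; N c, e d)` with integers `a, b, c, d`. The condition on the determinant,
`e a d - (N / e) b c = 1`, is part of the membership in `SL(2, ℝ)`. -/
def atkinLehner (N : ℕ) : Set SL(2, ℝ) :=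
  {g | ∃ e ∈ exactDivisors N, ∃ a b c d : ℤ,
    g 0 0 = √(e : ℝ) * a ∧ g 0 1 = b / √(e : ℝ) ∧
    g 1 0 = N * c / √(e : ℝ) ∧ g 1 1 = √(e : ℝ) * d}

/-- The group `Γ_0^*(N)` generated by `Γ_0(N)` and all Atkin-Lehner involutions of level `N`,
as a subgroup of `SL(2, ℝ)`; it contains `-1`. -/
def Gamma0Star (N : ℕ) : Subgroup SL(2, ℝ) :=
  Subgroup.closure
    (((CongruenceSubgroup.Gamma0 N).map
      (Matrix.SpecialLinearGroup.map (Int.castRingHom ℝ)) : Set SL(2, ℝ)) ∪ atkinLehner N)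

/-- The subgroup `Γ_∞` of those elements of `Γ` that act on the upper half plane as translations.
It contains `-1` if `Γ` does, so that `Γ_∞ \ Γ` is the same for `Γ` and its image
in `PSL(2, ℝ)`. -/
def translations (Γ : Subgroup SL(2, ℝ)) : Subgroup Γ where
  carrier := {γ | ∃ t : ℝ, ∀ z : ℍ, (γ : SL(2, ℝ)) • z = t +ᵥ z}
  one_mem' := ⟨0, fun z => by simp⟩
  mul_mem' := by
    rintro γ₁ γ₂ ⟨t₁, h₁⟩ ⟨t₂, h₂⟩
    refine ⟨t₁ + t₂, fun z => ?_⟩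
    rw [Subgroup.coe_mul, mul_smul, h₂, h₁, add_vadd]
  inv_mem' := by
    rintro γ ⟨t, h⟩
    refine ⟨-t, fun z => ?_⟩
    rw [Subgroup.coe_inv, inv_smul_eq_iff, h, vadd_vadd, add_neg_cancel, zero_vadd]

/-- The coset space `Γ_∞ \ Γ`. -/
abbrev Cosets (Γ : Subgroup SL(2, ℝ)) : Type :=
  Quotient (QuotientGroup.rightRel (translations Γ))

/-- The modified Bessel function of the first kind `I_ν(x)`, for complex order `ν`
and real `x > 0`. -/
def besselI (ν : ℂ) (x : ℝ) : ℂ :=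
  ∑' k : ℕ, ((x / 2 : ℝ) : ℂ) ^ (ν + 2 * k) / (k.factorial * Complex.Gamma (ν + k + 1))

/-- The function `e(-m Re w) (Im w)^(1/2) I_{s-1/2}(2 π m Im w)` of `w` in the upper half plane. -/
def seed (m : ℕ) (s : ℂ) (w : ℍ) : ℂ :=
  Complex.exp (2 * Real.pi * Complex.I * (-(m : ℂ) * (w.re : ℂ))) * ((√w.im : ℝ) : ℂ) *
    besselI (s - 1 / 2) (2 * Real.pi * m * w.im)

/-- `F z s` is the Niebur-Poincaré series
`F_m(z, s) = ∑_{M ∈ Γ_∞ \ Γ} e(-m Re Mz) (Im Mz)^(1/2) I_{s-1/2}(2 π m Im Mz)`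
on `Γ = Γ_0^*(N)`: it is given by the absolutely convergent series for `Re s > 1`,
and at `s = 1` by analytic continuation in `s`. (Translations in `Γ_0^*(N)` are by integers,
so the summand does not depend on the representative of the coset. Since `F z` is analytic in a
neighbourhood of `1`, the value `F z 1` is determined by the series.) -/
structure IsNieburPoincare (N m : ℕ) (F : ℍ → ℂ → ℂ) : Prop where
  hasSum : ∀ (z : ℍ) (s : ℂ), 1 < s.re →
    HasSum (fun M : Cosets (Gamma0Star N) => seed m s ((M.out : SL(2, ℝ)) • z)) (F z s)
  analyticAt : ∀ z : ℍ, AnalyticAt ℂ (F z) 1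

/-- The number `a` is the constant term of the function `f` on the upper half plane: for every
`y > 0` the zeroth Fourier coefficient of the function `x ↦ f (x + i y)` of period one
exists and equals `a`. -/
def HasConstantTerm (f : ℍ → ℂ) (a : ℂ) : Prop :=
  ∀ (y : ℝ) (hy : 0 < y),
    IntervalIntegrable (fun x : ℝ => f ⟨⟨x, y⟩, hy⟩) MeasureTheory.volume 0 1 ∧
      ∫ x in (0 : ℝ)..1, f ⟨⟨x, y⟩, hy⟩ = a

/-- The largest exact divisor `m_N` of `m` that is coprime to `N`. -/
def coprimePart (m N : ℕ) : ℕ :=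
  ((exactDivisors m).filter fun d => Nat.Coprime d N).sup id

/-- The order `α_p` of `m` at `p`. -/
def alpha (m p : ℕ) : ℕ := m.factorization p

/-- The order `β_{e,p}` of `N / e` at `p`. -/
def beta (N e p : ℕ) : ℕ := (N / e).factorization p

/-- The indicator `δ_e(p)` of the condition `β_{e,p} ≤ α_p + 1`. -/
def delta (N m e p : ℕ) : ℝ := if beta N e p ≤ alpha m p + 1 then 1 else 0

end NieburPoincare

end

/-! ### The divisor function and Euler's totient. -/

noncomputable section
namespace NieburPoincare

/-! Two elements of Γ lie in the same coset of Γ_∞ exactly when their bottom rows agree up to sign.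
Γ is the union of the sets W_e (`mem_Gamma0Star`), so the nontrivial cosets are indexed by pairs (e,
C) with e ‖ N, N/e ∣ C and (C, e) = 1, a unit u modulo C and an integer n (`cosetRep_bijective`).
The representative sends z to a/C - 1/(eC²(z + u/C + n)) with a ≡ (eu)⁻¹ modulo C. For Re s > 1 the
series is therefore the seed at z plus, for each (e, C), lattice sums over n weighted by additive
characters in u.

Continuation to s = 1. Up to a relative error O(1/(eC²)), each term is a constant times (eC²)^(-s)
|z + u/C + n|^(-2s). Poisson summation in n turns the weighted sum over u into Kloosterman sums
modulo C. Without cancellation the pair (e, C) contributes O(C^(1-2 Re s)), which just fails to be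
summable at s = 1, so any power saving is enough. The bound C^(15/16) comes from Kloosterman's own
method: the fourth moment over all frequencies counts the solutions of u₁ + u₂ = u₃ + u₄, 1/u₁ +
1/u₂ = 1/u₃ + 1/u₄, and each sum recurs along its orbit under (a, b) ↦ (av, b/v). Hence the series
grouped by (e, C) converges locally uniformly to the left of s = 1 (`exists_bound_levelSum`).

Constant term. At s = 1 the Bessel function is elementary, and the seed at -1/(qz) becomes a
difference of exp(κ/z) and exp(κ/z̄), κ = 2πim/q (`invSeed_one`). The trivial coset integrates to
zero over a period. Unfolding the sum over n leaves full line integrals, where only the linear term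
of the exponentials survives; after the factor 2π√m this is 4π²m/(eC²) (`integral_invSeed`). The
characters sum to the Ramanujan sum c_C(m) (`sum_weight`).

Arithmetic. There remains, for each e, the sum of c_C(m)/C² over the multiples C of N/e prime to e.
Multiplied by ζ(2) = π²/6, its Euler factor (`tsum_levelTerm`) is 1 + p⁻¹ + ... + p^(-α_p) at p ∤ N,
which yields σ(m_N)/m_N; it is (1 - p⁻²)⁻¹ at p ∣ e; at p ∣ N/e it is (1 - p⁻²)⁻¹ times the tail
from p^β on of a telescoping series that ends at p^(α+1), and this tail is the local factor of the
formula, with δ_e(p) recording when it is empty (`localTail_beta`). -/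

theorem succ_pow_four_le (k : ℕ) : (k + 1) ^ 4 ≤ 256 * 2 ^ k := by
  rcases lt_or_ge k 6 with h | h
  · interval_cases k <;> norm_num
  · induction k, h using Nat.le_induction with
    | base => norm_num
    | succ k hk ih =>
      have h1 : (k + 1 + 1) ^ 4 ≤ 2 * (k + 1) ^ 4 := by
        obtain ⟨j, rfl⟩ := Nat.exists_eq_add_of_le hk
        ring_nf
        nlinarith [sq_nonneg j, Nat.zero_le (j ^ 3), Nat.zero_le (j ^ 4)]
      calc _ ≤ 2 * (k + 1) ^ 4 := h1
        _ ≤ 2 * (256 * 2 ^ k) := by omega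
        _ = _ := by ring

/-- The divisor bound `τ(n) ≪ n ^ (1 / 4)`. -/
theorem card_divisors_pow_four_le {n : ℕ} (hn : n ≠ 0) :
    n.divisors.card ^ 4 ≤ 256 ^ 16 * n := by
  -- For p ≥ 16, (k + 1)^4 ≤ 16^k ≤ p^k costs no constant; the fewer than 16 smaller primes cost a
  -- factor 256 each.
  have key : ∀ p ∈ n.primeFactors, (n.factorization p + 1) ^ 4 ≤
      (if p < 16 then 256 else 1) * p ^ n.factorization p := by
    intro p hp
    have hp2 := (Nat.prime_of_mem_primeFactors hp).two_le
    split_ifs with h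
    · exact (succ_pow_four_le _).trans (by gcongr)
    · rw [one_mul]
      calc (n.factorization p + 1) ^ 4 ≤ (2 ^ n.factorization p) ^ 4 := by
            gcongr; exact Nat.lt_two_pow_self
        _ = 16 ^ n.factorization p := by rw [← pow_mul, mul_comm, pow_mul]; norm_num
        _ ≤ _ := by gcongr; omega
  rw [Nat.card_divisors hn, ← Finset.prod_pow]
  refine (Finset.prod_le_prod' key).trans ?_
  rw [Finset.prod_mul_distrib]
  have h2 : ∏ p ∈ n.primeFactors, p ^ n.factorization p = n :=
    Nat.prod_factorization_pow_eq_self hn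
  rw [h2]
  gcongr
  rw [Finset.prod_ite, Finset.prod_const, Finset.prod_const_one, mul_one]
  refine Nat.pow_le_pow_right (by norm_num) ?_
  calc _ ≤ (Finset.range 16).card := Finset.card_le_card fun p hp => by
        simpa using (Finset.mem_filter.mp hp).2
    _ = 16 := by simp

/-- In n = ∑ φ(d) over d ∣ n every term is at most φ(n). This bounds from below the length of the
orbits used for Kloosterman sums. -/
theorem le_card_divisors_mul_totient (n : ℕ) : n ≤ n.divisors.card * n.totient := by
  rcases Nat.eq_zero_or_pos n with rfl | hn
  · simp
  calc n = ∑ d ∈ n.divisors, d.totient := (Nat.sum_totient n).symm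
    _ ≤ ∑ _d ∈ n.divisors, n.totient := Finset.sum_le_sum fun d hd =>
        Nat.le_of_dvd (Nat.totient_pos.2 hn) (Nat.totient_dvd_of_dvd (Nat.dvd_of_mem_divisors hd))
    _ = _ := by simp

/-! ### A power saving for Kloosterman sums by the fourth moment. -/

section Kloosterman

variable {n : ℕ} [NeZero n]

open ZMod

/-- The number of elements of `ZMod n` annihilated by `t`. -/
def annihilatorCard (t : ZMod n) : ℕ := (Finset.univ.filter fun x : ZMod n => t * x = 0).card

theorem card_nsmul_eq_zero_le (g : ℕ) (hg : 0 < g) :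
    (Finset.univ.filter fun x : ZMod n => g • x = 0).card ≤ g := by
  convert IsAddCyclic.card_nsmul_eq_zero_le (α := ZMod n) hg

theorem annihilatorCard_natCast_le {m : ℕ} (hm : 0 < m) : annihilatorCard (m : ZMod n) ≤ m := by
  simpa [annihilatorCard] using card_nsmul_eq_zero_le (n := n) m hm

theorem annihilatorCard_le_gcd (t : ZMod n) : annihilatorCard t ≤ t.val.gcd n := by
  refine le_trans (Finset.card_le_card fun x hx => ?_)
    (card_nsmul_eq_zero_le (n := n) _ (Nat.gcd_pos_of_pos_right _ (NeZero.pos n)))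
  simp only [Finset.mem_filter, Finset.mem_univ, true_and] at hx ⊢
  exact gcd_nsmul_eq_zero.2 ⟨by simpa using hx, by simp⟩

/-- The solution set is empty or a translate of the annihilator of `t`. -/
theorem card_mul_eq_le (t c : ZMod n) :
    (Finset.univ.filter fun x : ZMod n => t * x = c).card ≤ annihilatorCard t := by
  rcases (Finset.univ.filter fun x : ZMod n => t * x = c).eq_empty_or_nonempty with h | ⟨x₀, h₀⟩
  · simp [h]
  · refine Finset.card_le_card_of_injOn (fun x => x - x₀) (fun x hx => ?_)
      (fun _ _ _ _ h => sub_left_injective h)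
    simp only [Finset.mem_filter, Finset.mem_univ, true_and, Finset.coe_filter,
      Set.mem_ofPred_eq] at *
    rw [mul_sub, hx, h₀, sub_self]

/-- Multiplication by `t` maps the annihilator of `s * t` into that of `s`, and its fibres are no
larger than the annihilator of `t`. -/
theorem annihilatorCard_mul_le (s t : ZMod n) :
    annihilatorCard (s * t) ≤ annihilatorCard s * annihilatorCard t := by
  refine (Finset.card_le_mul_card_image_of_maps_to
    (t := Finset.univ.filter fun x : ZMod n => s * x = 0) (f := fun x => t * x) ?_
    (annihilatorCard t) ?_).trans (mul_comm _ _).le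
  · intro x hx
    simpa [mul_assoc] using hx
  · intro c _
    refine (Finset.card_le_card ?_).trans (card_mul_eq_le t c)
    intro x
    simp +contextual

/-- Write gcd(x, n) as the sum of φ(d) over its divisors d and exchange the sums: each d ∣ n
contributes at most (n/d) φ(d) ≤ n. -/
theorem sum_gcd_range_le (n : ℕ) : ∑ x ∈ Finset.range n, x.gcd n ≤ n * n.divisors.card := by
  calc ∑ x ∈ Finset.range n, x.gcd n
      = ∑ x ∈ Finset.range n, ∑ d ∈ n.divisors, if d ∣ x then d.totient else 0 := by
        refine Finset.sum_congr rfl fun x hx => ?_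
        have hn : n ≠ 0 := by have := Finset.mem_range.mp hx; omega
        rw [← Finset.sum_filter]
        conv_lhs => rw [← Nat.sum_totient (x.gcd n)]
        refine Finset.sum_congr ?_ fun _ _ => rfl
        ext d
        simp [Nat.dvd_gcd_iff, hn]; tauto
    _ = ∑ d ∈ n.divisors, ∑ x ∈ Finset.range n, if d ∣ x then d.totient else 0 :=
        Finset.sum_comm
    _ ≤ ∑ d ∈ n.divisors, n := by
        refine Finset.sum_le_sum fun d hd => ?_
        rw [← Finset.sum_filter, Finset.sum_const, smul_eq_mul]
        obtain ⟨k, rfl⟩ := Nat.dvd_of_mem_divisors hd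
        have hd0 : 0 < d := Nat.pos_of_mem_divisors hd
        have : ((Finset.range (d * k)).filter fun x => d ∣ x).card ≤ k := by
          refine (Finset.card_le_card (t := (Finset.range k).image (d * ·)) ?_).trans
            (Finset.card_image_le.trans (by simp))
          intro x hx
          simp only [Finset.mem_filter, Finset.mem_range, Finset.mem_image] at hx ⊢
          obtain ⟨hx, j, rfl⟩ := hx
          exact ⟨j, lt_of_mul_lt_mul_left hx (Nat.zero_le _), rfl⟩
        calc _ ≤ k * d := Nat.mul_le_mul this (Nat.totient_le d)
          _ = _ := mul_comm _ _
    _ = _ := by simp [mul_comm]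

theorem sum_annihilatorCard_le :
    ∑ t : ZMod n, annihilatorCard t ≤ n * n.divisors.card := by
  refine (Finset.sum_le_sum fun t _ => annihilatorCard_le_gcd t).trans
    (le_trans (le_of_eq ?_) (sum_gcd_range_le n))
  refine Finset.sum_nbij (fun t => t.val) (fun t _ => by simpa using ZMod.val_lt t)
    (fun a _ b _ h => ZMod.val_injective n h) (fun x hx => ⟨(x : ZMod n), by simp, ?_⟩)
    fun _ _ => rfl
  exact ZMod.val_cast_of_lt (by simpa using hx)

/-- Orthogonality: the second moment of a two-parameter family of exponential sums counts
coincidences. -/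
theorem sum_norm_sq_expSum {ι : Type*} [Fintype ι] (f g : ι → ZMod n) :
    ∑ a : ZMod n, ∑ b : ZMod n, ‖∑ i, stdAddChar (a * f i + b * g i)‖ ^ 2 =
      (n : ℝ) ^ 2 *
        (Finset.univ.filter fun ij : ι × ι => f ij.1 = f ij.2 ∧ g ij.1 = g ij.2).card := by
  have hsum : ∀ t : ZMod n, ∑ x : ZMod n, stdAddChar (x * t) = if t = 0 then (n : ℂ) else 0 := by
    intro t
    have := AddChar.sum_mulShift t (ZMod.isPrimitive_stdAddChar n)
    rw [this]; simp
  have h : ∀ a b : ZMod n, ((‖∑ i, stdAddChar (a * f i + b * g i)‖ ^ 2 : ℝ) : ℂ) =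
      ∑ ij : ι × ι, stdAddChar (a * (f ij.1 - f ij.2)) * stdAddChar (b * (g ij.1 - g ij.2)) := by
    intro a b
    rw [← Complex.normSq_eq_norm_sq, Complex.normSq_eq_conj_mul_self, mul_comm, map_sum,
      Finset.sum_mul_sum, ← Finset.sum_product', ← Finset.univ_product_univ]
    refine Finset.sum_congr rfl fun ij _ => ?_
    rw [← AddChar.map_neg_eq_conj, ← AddChar.map_add_eq_mul, ← AddChar.map_add_eq_mul]
    congr 1; ring
  apply Complex.ofReal_injective
  push_cast
  have h' : ∀ a b : ZMod n, (‖∑ i, stdAddChar (a * f i + b * g i)‖ : ℂ) ^ 2 =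
      ∑ ij : ι × ι, stdAddChar (a * (f ij.1 - f ij.2)) * stdAddChar (b * (g ij.1 - g ij.2)) := by
    intro a b; rw [← h]; push_cast; rfl
  simp_rw [h']
  have : ∀ a : ZMod n, ∑ b : ZMod n, ∑ ij : ι × ι,
      stdAddChar (a * (f ij.1 - f ij.2)) * stdAddChar (b * (g ij.1 - g ij.2)) =
      ∑ ij : ι × ι, stdAddChar (a * (f ij.1 - f ij.2)) *
        if g ij.1 - g ij.2 = 0 then (n : ℂ) else 0 := by
    intro a
    rw [Finset.sum_comm]
    simp only [← Finset.mul_sum, hsum]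
  simp_rw [this]
  rw [Finset.sum_comm]
  simp_rw [← Finset.sum_mul, hsum, sub_eq_zero, ite_zero_mul_ite_zero]
  rw [← Finset.sum_filter, Finset.sum_const, nsmul_eq_mul]
  ring

/-- The Kloosterman sum to the modulus `n`. -/
def kloosterman (a b : ZMod n) : ℂ :=
  ∑ u : (ZMod n)ˣ, stdAddChar (a * ((u⁻¹ : (ZMod n)ˣ) : ZMod n) + b * (u : ZMod n))

/-- Substitute u ↦ u v⁻¹ in the sum. -/
theorem kloosterman_mul_unit (a b : ZMod n) (v : (ZMod n)ˣ) :
    kloosterman (a * (v : ZMod n)) (b * ((v⁻¹ : (ZMod n)ˣ) : ZMod n)) = kloosterman a b := by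
  unfold kloosterman
  refine Fintype.sum_equiv (Equiv.mulRight v⁻¹) _ _ fun u => ?_
  simp only [Equiv.coe_mulRight, mul_inv_rev, inv_inv, Units.val_mul]
  congr 1; ring

/-- The number of solutions of `u₁ + u₂ = u₃ + u₄`, `1 / u₁ + 1 / u₂ = 1 / u₃ + 1 / u₄` in units. -/
theorem card_kloosterman_coincidences_le :
    (Finset.univ.filter fun w : ((ZMod n)ˣ × (ZMod n)ˣ) × ((ZMod n)ˣ × (ZMod n)ˣ) =>
      ((w.1.1⁻¹ : (ZMod n)ˣ) : ZMod n) + ((w.1.2⁻¹ : (ZMod n)ˣ) : ZMod n) =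
        ((w.2.1⁻¹ : (ZMod n)ˣ) : ZMod n) + ((w.2.2⁻¹ : (ZMod n)ˣ) : ZMod n) ∧
      (w.1.1 : ZMod n) + w.1.2 = (w.2.1 : ZMod n) + w.2.2).card ≤
      2 * (n * n.divisors.card) ^ 2 := by
  -- With a + b = c + d, eliminating d from the other equation leaves (a + b)(c - a)(c - b) = 0. In
  -- the variables X = c - a, Y = c - b and a this reads XY(2a + X - Y) = 0, which is linear in a
  -- once X and Y are fixed.
  have h1 : (Finset.univ.filter fun w : ((ZMod n)ˣ × (ZMod n)ˣ) × ((ZMod n)ˣ × (ZMod n)ˣ) =>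
      ((w.1.1⁻¹ : (ZMod n)ˣ) : ZMod n) + ((w.1.2⁻¹ : (ZMod n)ˣ) : ZMod n) =
        ((w.2.1⁻¹ : (ZMod n)ˣ) : ZMod n) + ((w.2.2⁻¹ : (ZMod n)ˣ) : ZMod n) ∧
      (w.1.1 : ZMod n) + w.1.2 = (w.2.1 : ZMod n) + w.2.2).card ≤
      (Finset.univ.filter fun v : (ZMod n × ZMod n) × ZMod n =>
        v.1.1 * v.1.2 * (2 * v.2 + v.1.1 - v.1.2) = 0).card := by
    refine Finset.card_le_card_of_injOn (fun w => (((w.2.1 : ZMod n) - w.1.1,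
      (w.2.1 : ZMod n) - w.1.2), (w.1.1 : ZMod n))) ?_ ?_
    · rintro ⟨⟨a, b⟩, ⟨c, d⟩⟩ hw
      simp only [Finset.coe_filter, Finset.mem_univ, true_and, Set.mem_ofPred_eq] at hw ⊢
      obtain ⟨hi, hs⟩ := hw
      have ha : (a : ZMod n) * ((a⁻¹ : (ZMod n)ˣ) : ZMod n) = 1 := Units.mul_inv a
      have hb : (b : ZMod n) * ((b⁻¹ : (ZMod n)ˣ) : ZMod n) = 1 := Units.mul_inv b
      have hc : (c : ZMod n) * ((c⁻¹ : (ZMod n)ˣ) : ZMod n) = 1 := Units.mul_inv c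
      have hd : (d : ZMod n) * ((d⁻¹ : (ZMod n)ˣ) : ZMod n) = 1 := Units.mul_inv d
      generalize ((a⁻¹ : (ZMod n)ˣ) : ZMod n) = a' at *
      generalize ((b⁻¹ : (ZMod n)ˣ) : ZMod n) = b' at *
      generalize ((c⁻¹ : (ZMod n)ˣ) : ZMod n) = c' at *
      generalize ((d⁻¹ : (ZMod n)ˣ) : ZMod n) = d' at *
      generalize (a : ZMod n) = a at *
      generalize (b : ZMod n) = b at *
      generalize (c : ZMod n) = c at *
      generalize (d : ZMod n) = d at *
      have e1 : (a + b) * (c * d) = (c + d) * (a * b) := by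
        have : (a' + b') * (a * b * c * d) = (c' + d') * (a * b * c * d) := by rw [hi]
        linear_combination this - b * c * d * ha - a * c * d * hb + a * b * d * hc +
          a * b * c * hd
      have hd' : d = a + b - c := by rw [hs]; ring
      subst hd'
      linear_combination -e1
    · rintro ⟨⟨a, b⟩, ⟨c, d⟩⟩ hw ⟨⟨a', b'⟩, ⟨c', d'⟩⟩ hw' h
      simp only [Finset.coe_filter, Finset.mem_univ, true_and, Set.mem_ofPred_eq,
        Prod.mk.injEq] at hw hw' h
      obtain ⟨⟨h1, h2⟩, h3⟩ := h
      have e1 : a = a' := Units.ext h3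
      subst e1
      have e2 : c = c' := Units.ext (by simpa using h1)
      subst e2
      have e3 : b = b' := Units.ext (by simpa using h2)
      subst e3
      have e4 : d = d' := Units.ext (by
        have := hw.2.symm.trans hw'.2
        simpa using this)
      rw [e4]
  refine h1.trans ?_
  rw [Finset.card_filter, ← Finset.univ_product_univ, Finset.sum_product]
  simp_rw [← Finset.card_filter]
  calc _ ≤ ∑ v : ZMod n × ZMod n,
        2 * (annihilatorCard v.1 * annihilatorCard v.2) := by
        refine Finset.sum_le_sum fun v _ => ?_
        refine le_trans (le_trans (Finset.card_le_card (t := Finset.univ.filter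
          fun x : ZMod n => ((2 : ℕ) * (v.1 * v.2)) * x = -(v.1 * v.2 * (v.1 - v.2))) ?_)
          (card_mul_eq_le _ _)) ?_
        · intro x hx
          simp only [Finset.mem_filter, Finset.mem_univ, true_and] at hx ⊢
          push_cast
          linear_combination hx
        · exact (annihilatorCard_mul_le _ _).trans (Nat.mul_le_mul
            (annihilatorCard_natCast_le two_pos) (annihilatorCard_mul_le _ _))
    _ = 2 * (∑ t : ZMod n, annihilatorCard t) ^ 2 := by
        rw [← Finset.mul_sum, sq, Finset.sum_mul_sum, ← Finset.univ_product_univ,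
          Finset.sum_product]
    _ ≤ _ := by gcongr; exact sum_annihilatorCard_le

/-- The square of a Kloosterman sum is an exponential sum over pairs of units, so orthogonality
applied to it counts the coincidences bounded above. -/
theorem sum_norm_kloosterman_pow_four_le :
    ∑ a : ZMod n, ∑ b : ZMod n, ‖kloosterman a b‖ ^ 4 ≤
      (n : ℝ) ^ 2 * (2 * (n * n.divisors.card) ^ 2) := by
  have h := sum_norm_sq_expSum (n := n) (ι := (ZMod n)ˣ × (ZMod n)ˣ)
    (fun i => ((i.1⁻¹ : (ZMod n)ˣ) : ZMod n) + ((i.2⁻¹ : (ZMod n)ˣ) : ZMod n))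
    (fun i => (i.1 : ZMod n) + (i.2 : ZMod n))
  have h2 : ∀ a b : ZMod n, ‖kloosterman a b‖ ^ 4 =
      ‖∑ i : (ZMod n)ˣ × (ZMod n)ˣ, stdAddChar
        (a * (((i.1⁻¹ : (ZMod n)ˣ) : ZMod n) + ((i.2⁻¹ : (ZMod n)ˣ) : ZMod n)) +
          b * ((i.1 : ZMod n) + (i.2 : ZMod n)))‖ ^ 2 := by
    intro a b
    rw [show (4 : ℕ) = 2 * 2 by norm_num, pow_mul, ← norm_pow]
    congr 2
    rw [sq, kloosterman, Finset.sum_mul_sum, ← Finset.sum_product', ← Finset.univ_product_univ]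
    refine Finset.sum_congr rfl fun i _ => ?_
    rw [← AddChar.map_add_eq_mul]
    congr 1; ring
  simp_rw [h2]
  rw [h]
  gcongr
  exact_mod_cast card_kloosterman_coincidences_le (n := n)

/-- The same value occurs at all (av, b/v), v a unit. Letting the second frequency run freely can
only increase the sum, and a given first frequency is av for at most `annihilatorCard a` units v, so
the orbit is dominated by the full fourth moment. -/
theorem totient_mul_norm_kloosterman_pow_four_le (a b : ZMod n) :
    (n.totient : ℝ) * ‖kloosterman a b‖ ^ 4 ≤
      annihilatorCard a * ((n : ℝ) ^ 2 * (2 * (n * n.divisors.card) ^ 2)) := by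
  have h1 : (n.totient : ℝ) * ‖kloosterman a b‖ ^ 4 =
      ∑ v : (ZMod n)ˣ, ‖kloosterman (a * (v : ZMod n)) (b * ((v⁻¹ : (ZMod n)ˣ) : ZMod n))‖ ^ 4 := by
    simp_rw [kloosterman_mul_unit]
    simp [ZMod.card_units_eq_totient]
  rw [h1]
  calc _ ≤ ∑ v : (ZMod n)ˣ, ∑ b' : ZMod n, ‖kloosterman (a * (v : ZMod n)) b'‖ ^ 4 := by
        refine Finset.sum_le_sum fun v _ => ?_
        exact Finset.single_le_sum (f := fun b' => ‖kloosterman (a * (v : ZMod n)) b'‖ ^ 4)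
          (fun _ _ => by positivity) (Finset.mem_univ _)
    _ = ∑ a' : ZMod n, ∑ v ∈ Finset.univ.filter (fun v : (ZMod n)ˣ => a * (v : ZMod n) = a'),
          ∑ b' : ZMod n, ‖kloosterman a' b'‖ ^ 4 := by
        rw [← Finset.sum_fiberwise_of_maps_to (g := fun v : (ZMod n)ˣ => a * (v : ZMod n))
          (t := Finset.univ) (fun _ _ => Finset.mem_univ _)]
        refine Finset.sum_congr rfl fun a' _ => Finset.sum_congr rfl fun v hv => ?_
        rw [(Finset.mem_filter.mp hv).2]
    _ ≤ ∑ a' : ZMod n, annihilatorCard a * ∑ b' : ZMod n, ‖kloosterman a' b'‖ ^ 4 := by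
        refine Finset.sum_le_sum fun a' _ => ?_
        rw [Finset.sum_const, nsmul_eq_mul]
        gcongr
        refine le_trans ?_ (card_mul_eq_le a a')
        refine Finset.card_le_card_of_injOn (fun v : (ZMod n)ˣ => (v : ZMod n)) (fun v hv => ?_)
          (fun _ _ _ _ h => Units.ext h)
        simpa using hv
    _ ≤ _ := by
        rw [← Finset.mul_sum]
        gcongr
        exact sum_norm_kloosterman_pow_four_le

/-- A bound for Kloosterman sums with a power saving. -/
theorem norm_kloosterman_le {k : ℕ} (a b : ZMod n) (ha : annihilatorCard a ≤ k) :
    ‖kloosterman a b‖ ≤ (2 * k * 256 ^ 12 : ℝ) ^ (1 / 4 : ℝ) * (n : ℝ) ^ (15 / 16 : ℝ) := by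
  have hn : 0 < n := NeZero.pos n
  have hn' : (0 : ℝ) < n := by exact_mod_cast hn
  have hφ : (0 : ℝ) < n.totient := by exact_mod_cast Nat.totient_pos.2 hn
  have h1 := totient_mul_norm_kloosterman_pow_four_le a b
  have h2 : (n : ℝ) ≤ n.divisors.card * n.totient := by
    exact_mod_cast le_card_divisors_mul_totient n
  have h3 : ((n.divisors.card : ℝ)) ^ 4 ≤ 256 ^ 16 * n := by
    exact_mod_cast card_divisors_pow_four_le hn.ne'
  set τ : ℝ := (n.divisors.card : ℝ) with hτ
  have hτ0 : 0 ≤ τ := by positivity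
  have hτ1 : τ ≤ 256 ^ 4 * (n : ℝ) ^ (1 / 4 : ℝ) := by
    refine le_of_pow_le_pow_left₀ (n := 4) (by norm_num) (by positivity) ?_
    rw [mul_pow, ← Real.rpow_natCast ((n : ℝ) ^ (1 / 4 : ℝ)), ← Real.rpow_mul hn'.le]
    refine h3.trans (le_of_eq ?_)
    norm_num
  -- One factor n is traded for τ(n) φ(n) and φ(n) is cancelled. Then τ(n) ≪ n^(1/4) gives n^(3 +
  -- 3/4), whose fourth root is n^(15/16).
  have hS : ‖kloosterman a b‖ ^ 4 ≤ 2 * k * n ^ 3 * τ ^ 3 := by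
    have hk : (annihilatorCard a : ℝ) ≤ k := by exact_mod_cast ha
    have h4 : (n.totient : ℝ) * ‖kloosterman a b‖ ^ 4 ≤
        n.totient * (2 * k * n ^ 3 * τ ^ 3) := by
      calc _ ≤ (k : ℝ) * ((n : ℝ) ^ 2 * (2 * (n * τ) ^ 2)) := h1.trans (by gcongr)
        _ = 2 * k * n ^ 3 * τ ^ 2 * n := by ring
        _ ≤ 2 * k * n ^ 3 * τ ^ 2 * (τ * n.totient) := by gcongr
        _ = _ := by ring
    exact le_of_mul_le_mul_left h4 hφ
  refine le_of_pow_le_pow_left₀ (n := 4) (by norm_num) (by positivity) ?_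
  rw [mul_pow, ← Real.rpow_natCast (_ ^ (1 / 4 : ℝ)), ← Real.rpow_natCast (_ ^ (15 / 16 : ℝ)),
    ← Real.rpow_mul (by positivity), ← Real.rpow_mul (by positivity)]
  refine hS.trans ?_
  have : (n : ℝ) ^ (15 / 16 * ((4 : ℕ) : ℝ) : ℝ) = n ^ 3 * (n ^ (1 / 4 : ℝ)) ^ 3 := by
    rw [← Real.rpow_natCast (n : ℝ) 3, ← Real.rpow_natCast ((n : ℝ) ^ (1 / 4 : ℝ)) 3,
      ← Real.rpow_mul hn'.le, ← Real.rpow_add hn']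
    norm_num
  rw [this]
  calc 2 * (k : ℝ) * (n : ℝ) ^ 3 * τ ^ 3 ≤ 2 * (k : ℝ) * (n : ℝ) ^ 3 * (256 ^ 4 * (n : ℝ) ^ (1 / 4 : ℝ)) ^ 3 := by gcongr
    _ = 2 * (k : ℝ) * 256 ^ 12 * ((n : ℝ) ^ 3 * ((n : ℝ) ^ (1 / 4 : ℝ)) ^ 3) := by ring
    _ = _ := by norm_num

end Kloosterman

end NieburPoincare
end

/-! ### The group Γ_0^*(N) as the union of the Atkin–Lehner sets. -/

noncomputable section
namespace NieburPoincare

theorem sl_det (g : SL(2, ℝ)) : g 0 0 * g 1 1 - g 0 1 * g 1 0 = 1 := by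
  have := g.det_coe
  rwa [Matrix.det_fin_two] at this

theorem pos_of_mem_exactDivisors {n e : ℕ} (h : e ∈ exactDivisors n) : 0 < e :=
  Nat.pos_of_mem_divisors (Finset.mem_filter.mp h).1

theorem dvd_of_mem_exactDivisors {n e : ℕ} (h : e ∈ exactDivisors n) : e ∣ n :=
  Nat.dvd_of_mem_divisors (Finset.mem_filter.mp h).1

/-- The integral form of the determinant condition for matrices of Atkin-Lehner shape. -/
theorem atkinLehner_det {N e : ℕ} (he : 0 < e) (heN : e ∣ N) {g : SL(2, ℝ)} {a b c d : ℤ}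
    (h00 : g 0 0 = √(e : ℝ) * a) (h01 : g 0 1 = b / √(e : ℝ))
    (h10 : g 1 0 = N * c / √(e : ℝ)) (h11 : g 1 1 = √(e : ℝ) * d) :
    (e : ℤ) * a * d - (N / e : ℕ) * b * c = 1 := by
  obtain ⟨M, rfl⟩ := heN
  rw [Nat.mul_div_cancel_left _ he]
  have h := sl_det g
  rw [h00, h01, h10, h11] at h
  have he' : (0 : ℝ) < e := by exact_mod_cast he
  have hs : √(e : ℝ) ^ 2 = e := Real.sq_sqrt he'.le
  have hs0 : √(e : ℝ) ≠ 0 := (Real.sqrt_pos.2 he').ne'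
  have hs4 : √(e : ℝ) ^ 4 = (e : ℝ) ^ 2 := by
    calc √(e : ℝ) ^ 4 = (√(e : ℝ) ^ 2) ^ 2 := by ring
      _ = _ := by rw [hs]
  have h2 : (e : ℝ) * a * d - M * b * c = 1 := by
    rw [← h]
    push_cast
    field_simp
    rw [hs]
    field_simp
    linear_combination (-(a : ℝ) * d) * hs4
  exact_mod_cast h2

/-- Only e ∣ N has to be checked: the determinant is a Bézout relation between e and N/e, so
exactness is automatic. -/
theorem mem_atkinLehner_of_shape {N e : ℕ} (hN : 0 < N) (he : e ∣ N) {g : SL(2, ℝ)} {a b c d : ℤ}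
    (h00 : g 0 0 = √(e : ℝ) * a) (h01 : g 0 1 = b / √(e : ℝ))
    (h10 : g 1 0 = N * c / √(e : ℝ)) (h11 : g 1 1 = √(e : ℝ) * d) :
    g ∈ atkinLehner N := by
  have he0 : 0 < e := Nat.pos_of_dvd_of_pos he hN
  refine ⟨e, ?_, a, b, c, d, h00, h01, h10, h11⟩
  have hdet := atkinLehner_det he0 he h00 h01 h10 h11
  refine Finset.mem_filter.mpr ⟨Nat.mem_divisors.mpr ⟨he, hN.ne'⟩, ?_⟩
  rw [← Nat.isCoprime_iff_coprime]
  exact ⟨a * d, -(b * c), by linear_combination hdet⟩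

theorem sl_inv_apply (g : SL(2, ℝ)) :
    g⁻¹ 0 0 = g 1 1 ∧ g⁻¹ 0 1 = -g 0 1 ∧ g⁻¹ 1 0 = -g 1 0 ∧ g⁻¹ 1 1 = g 0 0 := by
  simp [Matrix.SpecialLinearGroup.coe_inv, Matrix.adjugate_fin_two]

theorem sl_mul_apply (g h : SL(2, ℝ)) (i j : Fin 2) :
    (g * h) i j = g i 0 * h 0 j + g i 1 * h 1 j := by
  simp [Matrix.SpecialLinearGroup.coe_mul, Matrix.mul_apply]

theorem atkinLehner_inv_mem {N : ℕ} (hN : 0 < N) {g : SL(2, ℝ)} (hg : g ∈ atkinLehner N) :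
    g⁻¹ ∈ atkinLehner N := by
  obtain ⟨e, he, a, b, c, d, h00, h01, h10, h11⟩ := hg
  obtain ⟨i00, i01, i10, i11⟩ := sl_inv_apply g
  refine mem_atkinLehner_of_shape hN (dvd_of_mem_exactDivisors he)
    (a := d) (b := -b) (c := -c) (d := a) ?_ ?_ ?_ ?_
  · rw [i00, h11]
  · rw [i01, h01]; push_cast; ring
  · rw [i10, h10]; push_cast; ring
  · rw [i11, h00]

/-- With e = G e₁ and f = G f₁, G = gcd(e, f), the product of elements of W_e and W_f has type e₁
f₁: the factor √G² is absorbed into the integral entries, and N is divisible by lcm(e, f) = G e₁ f₁.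
-/
theorem atkinLehner_mul_mem {N : ℕ} (hN : 0 < N) {g h : SL(2, ℝ)} (hg : g ∈ atkinLehner N)
    (hh : h ∈ atkinLehner N) : g * h ∈ atkinLehner N := by
  obtain ⟨e, he, a, b, c, d, h00, h01, h10, h11⟩ := hg
  obtain ⟨f, hf, a', b', c', d', k00, k01, k10, k11⟩ := hh
  have he0 := pos_of_mem_exactDivisors he
  have hf0 := pos_of_mem_exactDivisors hf
  have hl : e.lcm f ∣ N :=
    Nat.lcm_dvd (dvd_of_mem_exactDivisors he) (dvd_of_mem_exactDivisors hf)
  have hG : 0 < e.gcd f := Nat.gcd_pos_of_pos_left _ he0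
  obtain ⟨e₁, f₁, -, h₁, h₂⟩ := Nat.exists_coprime e f
  have hgl := Nat.gcd_mul_lcm e f
  generalize e.gcd f = G at *
  have hlcm : e.lcm f = G * e₁ * f₁ := by
    apply Nat.eq_of_mul_eq_mul_left hG
    rw [hgl, h₁, h₂]
    ring
  rw [hlcm] at hl
  subst h₁ h₂
  obtain ⟨K, rfl⟩ := hl
  have he₁ : (0 : ℝ) < e₁ := by exact_mod_cast Nat.pos_of_mul_pos_right he0
  have hf₁ : (0 : ℝ) < f₁ := by exact_mod_cast Nat.pos_of_mul_pos_right hf0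
  have hG' : (0 : ℝ) < G := by exact_mod_cast hG
  have sG := Real.sq_sqrt hG'.le
  have se := Real.sq_sqrt he₁.le
  have sf := Real.sq_sqrt hf₁.le
  have pG := Real.sqrt_pos.2 hG'
  have pe := Real.sqrt_pos.2 he₁
  have pf := Real.sqrt_pos.2 hf₁
  push_cast at h00 h01 h10 h11 k00 k01 k10 k11
  rw [Real.sqrt_mul he₁.le] at h00 h01 h10 h11
  rw [Real.sqrt_mul hf₁.le] at k00 k01 k10 k11
  refine mem_atkinLehner_of_shape hN (e := e₁ * f₁) ⟨G * K, by ring⟩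
    (a := G * a * a' + b * c' * K) (b := e₁ * a * b' + f₁ * b * d')
    (c := f₁ * c * a' + e₁ * d * c') (d := K * c * b' + G * d * d') ?_ ?_ ?_ ?_ <;>
  · rw [sl_mul_apply]
    simp only [h00, h01, h10, h11, k00, k01, k10, k11]
    push_cast
    rw [Real.sqrt_mul he₁.le]
    generalize √(G : ℝ) = α at *
    generalize √(e₁ : ℝ) = β at *
    generalize √(f₁ : ℝ) = γ at *
    try simp only [← sG, ← se, ← sf]
    field_simp

/-- The set of all W_e is closed under products and inverses and contains Γ_0(N) as the case e = 1,
so the generated group adds nothing to it. -/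
theorem mem_Gamma0Star {N : ℕ} (hN : 0 < N) {g : SL(2, ℝ)} :
    g ∈ Gamma0Star N ↔ g ∈ atkinLehner N := by
  refine ⟨fun h => ?_, fun h => Subgroup.subset_closure (Or.inr h)⟩
  have h1 : (1 : ℕ) ∣ N := one_dvd N
  refine Subgroup.closure_induction (fun x hx => ?_) ?_
    (fun x y _ _ hx hy => atkinLehner_mul_mem hN hx hy)
    (fun x _ hx => atkinLehner_inv_mem hN hx) h
  · rcases hx with hx | hx
    · obtain ⟨γ, hγ, rfl⟩ := hx
      have hc := CongruenceSubgroup.Gamma0_mem.mp hγ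
      rw [ZMod.intCast_zmod_eq_zero_iff_dvd] at hc
      obtain ⟨c, hc⟩ := hc
      refine mem_atkinLehner_of_shape hN h1 (a := γ 0 0) (b := γ 0 1) (c := c) (d := γ 1 1)
        ?_ ?_ ?_ ?_ <;> simp [hc]
    · exact hx
  · refine mem_atkinLehner_of_shape hN h1 (a := 1) (b := 0) (c := 0) (d := 1) ?_ ?_ ?_ ?_ <;> simp

theorem coe_sl_smul (g : SL(2, ℝ)) (z : ℍ) :
    ((g • z : ℍ) : ℂ) = (g 0 0 * z + g 0 1) / (g 1 0 * z + g 1 1) := by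
  rw [UpperHalfPlane.coe_specialLinearGroup_apply]; simp

theorem sl_denom_ne_zero (g : SL(2, ℝ)) (z : ℍ) : (g 1 0 * z + g 1 1 : ℂ) ≠ 0 := by
  have := UpperHalfPlane.denom_ne_zero (g : GL (Fin 2) ℝ) z
  simpa [UpperHalfPlane.denom] using this

theorem entries_of_translation {g : SL(2, ℝ)} {t : ℝ} (h : ∀ z : ℍ, g • z = t +ᵥ z) :
    g 1 0 = 0 ∧ (g 1 1 = 1 ∨ g 1 1 = -1) := by
  -- Real and imaginary parts of the translation identity at z = iy; the values y = 1 and y = 2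
  -- already determine the entries needed.
  have key : ∀ y : ℝ, 0 < y → -(y ^ 2 * g 1 0) + t * g 1 1 = g 0 1 ∧
      y * g 1 1 + t * y * g 1 0 = y * g 0 0 := by
    intro y hy
    have h1 := congrArg ((↑) : ℍ → ℂ) (h ⟨⟨0, y⟩, hy⟩)
    rw [coe_sl_smul, div_eq_iff (sl_denom_ne_zero g _), UpperHalfPlane.coe_vadd] at h1
    have hr := congrArg Complex.re h1
    have hi := congrArg Complex.im h1
    simp at hr hi
    constructor <;> linarith
  have h1 := key 1 one_pos
  have h2 := key 2 two_pos
  have h10 : g 1 0 = 0 := by linarith [h1.1, h2.1]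
  refine ⟨h10, ?_⟩
  have hd := sl_det g
  have : g 0 0 = g 1 1 := by have := h1.2; rw [h10] at this; linarith
  rw [h10, this] at hd
  have : (g 1 1 - 1) * (g 1 1 + 1) = 0 := by linear_combination hd
  rcases mul_eq_zero.mp this with h | h
  · left; linarith
  · right; linarith

/-- For c = 0 the determinant becomes e a d = 1, which forces e = 1 and a = d = ±1; the translation
is by the integer ab. -/
theorem translation_of_mem {N : ℕ} (hN : 0 < N) {g : SL(2, ℝ)} (hg : g ∈ Gamma0Star N)
    (h : g 1 0 = 0) : ∃ k : ℤ, ∀ z : ℍ, g • z = (k : ℝ) +ᵥ z := by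
  obtain ⟨e, he, a, b, c, d, h00, h01, h10, h11⟩ := (mem_Gamma0Star hN).mp hg
  have he0 := pos_of_mem_exactDivisors he
  have hdet := atkinLehner_det he0 (dvd_of_mem_exactDivisors he) h00 h01 h10 h11
  have he' : (0 : ℝ) < e := by exact_mod_cast he0
  have hN' : (0 : ℝ) < N := by exact_mod_cast hN
  have hc : c = 0 := by
    rw [h10, div_eq_zero_iff, mul_eq_zero] at h
    rcases h with (h | h) | h
    · exact absurd h hN'.ne'
    · exact_mod_cast h
    · exact absurd h (Real.sqrt_pos.2 he').ne'
  subst hc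
  have hdet' : (e : ℤ) * (a * d) = 1 := by linarith
  have he1 : e = 1 := by
    have : IsUnit (e : ℤ) := IsUnit.of_mul_eq_one _ hdet'
    exact_mod_cast Int.eq_one_of_dvd_one (by positivity) this.dvd
  subst he1
  have had : a * d = 1 := by simpa using hdet'
  have h00' : g 0 0 = a := by simpa using h00
  have h01' : g 0 1 = b := by simpa using h01
  have h11' : g 1 1 = d := by simpa using h11
  refine ⟨b * a, fun z => UpperHalfPlane.ext ?_⟩
  have hadC : (a : ℂ) * d = 1 := by exact_mod_cast had
  have hdd : (a : ℂ) * a = 1 := by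
    rcases Int.eq_one_or_neg_one_of_mul_eq_one had with h | h <;> rw [h] <;> norm_num
  rw [coe_sl_smul, div_eq_iff (sl_denom_ne_zero g _), UpperHalfPlane.coe_vadd, h, h00', h01', h11']
  push_cast
  linear_combination (-(b : ℂ)) * hadC + ((z : ℂ) * d) * hdd - (z : ℂ) * hadC * a
end NieburPoincare
end

/-! ### Coset representatives and the series as an explicit sum. -/

noncomputable section
namespace NieburPoincare

/-- The pairs `(e, C)`, where `√e * C > 0` is the lower left entry of an element
of `Γ_0^*(N)` in `W_e`. -/
abbrev LevelPair (N : ℕ) : Type :=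
  {p : ℕ × ℕ // p.1 ∈ exactDivisors N ∧ 0 < p.2 ∧ N / p.1 ∣ p.2 ∧ p.2.Coprime p.1}

namespace LevelPair

variable {N : ℕ} (p : LevelPair N)

instance : NeZero p.1.2 := ⟨p.2.2.1.ne'⟩

theorem e_pos : 0 < p.1.1 := pos_of_mem_exactDivisors p.2.1

/-- The residue class of `e` modulo `C`, as a unit. -/
def unit : (ZMod p.1.2)ˣ := ZMod.unitOfCoprime p.1.1 p.2.2.2.2.symm

theorem coe_unit : (p.unit : ZMod p.1.2) = (p.1.1 : ℕ) := ZMod.coe_unitOfCoprime _ _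

/-- The integer `d` with residue class `u` modulo `C` and quotient `n`. -/
def lowerRight (u : (ZMod p.1.2)ˣ) (n : ℤ) : ℤ := (u : ZMod p.1.2).val + p.1.2 * n

/-- An integer inverse of `e * u` modulo `C`. -/
def upperLeft (u : (ZMod p.1.2)ˣ) : ℤ :=
  (((p.unit⁻¹ * u⁻¹ : (ZMod p.1.2)ˣ) : ZMod p.1.2).val : ℤ)

theorem intCast_lowerRight (u : (ZMod p.1.2)ˣ) (n : ℤ) :
    ((p.lowerRight u n : ℤ) : ZMod p.1.2) = u := by
  simp [lowerRight]

theorem intCast_upperLeft (u : (ZMod p.1.2)ˣ) :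
    ((p.upperLeft u : ℤ) : ZMod p.1.2) = ((p.unit⁻¹ * u⁻¹ : (ZMod p.1.2)ˣ) : ZMod p.1.2) := by
  rw [upperLeft, Int.cast_natCast, ZMod.natCast_zmod_val]

theorem dvd_det_sub_one (u : (ZMod p.1.2)ˣ) (n : ℤ) :
    (p.1.2 : ℤ) ∣ p.1.1 * p.upperLeft u * p.lowerRight u n - 1 := by
  rw [← ZMod.intCast_zmod_eq_zero_iff_dvd]
  push_cast
  rw [intCast_lowerRight, intCast_upperLeft, ← coe_unit, ← Units.val_mul, ← Units.val_mul]
  simp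

/-- The upper right entry (up to `√e`) of the representative of a coset. -/
def upperRight (u : (ZMod p.1.2)ˣ) (n : ℤ) : ℤ :=
  (p.1.1 * p.upperLeft u * p.lowerRight u n - 1) / p.1.2

theorem mul_upperRight (u : (ZMod p.1.2)ˣ) (n : ℤ) :
    (p.1.2 : ℤ) * p.upperRight u n = p.1.1 * p.upperLeft u * p.lowerRight u n - 1 :=
  Int.mul_ediv_cancel' (p.dvd_det_sub_one u n)

theorem sqrt_pos : 0 < √(p.1.1 : ℝ) := Real.sqrt_pos.2 (by exact_mod_cast p.e_pos)

/-- The representative of a non-trivial coset. -/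
def mat (u : (ZMod p.1.2)ˣ) (n : ℤ) : SL(2, ℝ) :=
  ⟨!![√(p.1.1 : ℝ) * p.upperLeft u, p.upperRight u n / √(p.1.1 : ℝ);
      √(p.1.1 : ℝ) * p.1.2, √(p.1.1 : ℝ) * p.lowerRight u n], by
    have hs : √(p.1.1 : ℝ) ^ 2 = p.1.1 := Real.sq_sqrt (by positivity)
    have h0 := p.sqrt_pos.ne'
    have h : (p.1.2 : ℝ) * p.upperRight u n = p.1.1 * p.upperLeft u * p.lowerRight u n - 1 := by
      exact_mod_cast p.mul_upperRight u n
    rw [Matrix.det_fin_two_of]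
    field_simp
    rw [hs]
    linear_combination -h⟩

theorem mat_apply (u : (ZMod p.1.2)ˣ) (n : ℤ) :
    p.mat u n 0 0 = √(p.1.1 : ℝ) * p.upperLeft u ∧
    p.mat u n 0 1 = p.upperRight u n / √(p.1.1 : ℝ) ∧
    p.mat u n 1 0 = √(p.1.1 : ℝ) * p.1.2 ∧ p.mat u n 1 1 = √(p.1.1 : ℝ) * p.lowerRight u n := by
  simp [mat]

theorem mat_mem (hN : 0 < N) (u : (ZMod p.1.2)ˣ) (n : ℤ) : p.mat u n ∈ Gamma0Star N := by
  rw [mem_Gamma0Star hN]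
  obtain ⟨h00, h01, h10, h11⟩ := p.mat_apply u n
  obtain ⟨k, hk⟩ := p.2.2.2.1
  refine mem_atkinLehner_of_shape hN (dvd_of_mem_exactDivisors p.2.1) (c := k) h00 h01 ?_ h11
  rw [h10, eq_div_iff p.sqrt_pos.ne']
  have h1 : (N : ℝ) = p.1.1 * (N / p.1.1 : ℕ) := by
    exact_mod_cast (Nat.mul_div_cancel' (dvd_of_mem_exactDivisors p.2.1)).symm
  have h2 : (p.1.2 : ℝ) = (N / p.1.1 : ℕ) * k := by exact_mod_cast hk
  have hs : √(p.1.1 : ℝ) ^ 2 = p.1.1 := Real.sq_sqrt (by positivity)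
  rw [h1, h2]
  push_cast
  linear_combination ((N / p.1.1 : ℕ) : ℝ) * k * hs

/-- C and d are coprime by the determinant. The squared entries of the bottom row therefore
determine e, which is what separates the cosets of different Atkin–Lehner type. -/
theorem gcd_eq (u : (ZMod p.1.2)ˣ) (n : ℤ) :
    Int.gcd (p.1.1 * p.1.2 ^ 2) (p.1.1 * p.lowerRight u n ^ 2) = p.1.1 := by
  have h : IsCoprime ((p.1.2 : ℤ)) (p.lowerRight u n) :=
    ⟨-p.upperRight u n, p.1.1 * p.upperLeft u, by
      linear_combination -p.mul_upperRight u n⟩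
  rw [Int.gcd_mul_left, Int.isCoprime_iff_gcd_eq_one.mp h.pow]
  simp

/-- The translate `z + d / C`, in terms of which the representative of a coset acts by
`z ↦ a / C - 1 / (e * C ^ 2 * (z + d / C))`. -/
theorem coe_mat_smul (u : (ZMod p.1.2)ˣ) (n : ℤ) (z : ℍ) :
    ((p.mat u n • z : ℍ) : ℂ) = p.upperLeft u / p.1.2 -
      1 / (p.1.1 * p.1.2 ^ 2 * (z + (u : ZMod p.1.2).val / p.1.2 + n)) := by
  obtain ⟨h00, h01, h10, h11⟩ := p.mat_apply u n
  have hs : (√(p.1.1 : ℝ) : ℂ) ^ 2 = p.1.1 := by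
    exact_mod_cast Real.sq_sqrt (by positivity : (0 : ℝ) ≤ p.1.1)
  have hs0 : (√(p.1.1 : ℝ) : ℂ) ≠ 0 := by exact_mod_cast p.sqrt_pos.ne'
  have hC : (p.1.2 : ℂ) ≠ 0 := by exact_mod_cast NeZero.ne p.1.2
  have he : (p.1.1 : ℂ) ≠ 0 := by exact_mod_cast p.e_pos.ne'
  have hd := sl_denom_ne_zero (p.mat u n) z
  rw [coe_sl_smul]
  rw [h10, h11] at hd ⊢
  rw [h00, h01]
  push_cast at hd ⊢
  have hd2 : (p.1.2 : ℂ) * z + p.lowerRight u n ≠ 0 := by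
    intro h0; apply hd; linear_combination (√(p.1.1 : ℝ) : ℂ) * h0
  have hw : (p.1.2 : ℂ) * (z + (u : ZMod p.1.2).val / p.1.2 + n) =
      p.1.2 * z + p.lowerRight u n := by
    rw [lowerRight]; push_cast; field_simp; ring
  have h : (p.1.2 : ℂ) * p.upperRight u n = p.1.1 * p.upperLeft u * p.lowerRight u n - 1 := by
    exact_mod_cast p.mul_upperRight u n
  have hr : (p.1.1 : ℂ) * p.1.2 ^ 2 * (z + (u : ZMod p.1.2).val / p.1.2 + n) =
      p.1.1 * p.1.2 * (p.1.2 * z + p.lowerRight u n) := by rw [← hw]; ring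
  rw [hr, show (√(p.1.1 : ℝ) : ℂ) * p.1.2 * z + √(p.1.1 : ℝ) * p.lowerRight u n =
    √(p.1.1 : ℝ) * (p.1.2 * z + p.lowerRight u n) by ring]
  generalize (√(p.1.1 : ℝ) : ℂ) = α at *
  rw [← hs]
  rw [← hs] at h
  obtain ⟨D, hD⟩ : ∃ D : ℂ, D = p.1.2 * z + p.lowerRight u n := ⟨_, rfl⟩
  rw [← hD] at hd2 ⊢
  field_simp
  linear_combination h - α ^ 2 * p.upperLeft u * hD

end LevelPair

/-- An index set for the cosets in `Γ_∞ \ Γ_0^*(N)`. -/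
abbrev CosetIndex (N : ℕ) : Type :=
  Option (Σ p : LevelPair N, (ZMod p.1.2)ˣ × ℤ)

/-- Coset representatives. -/
def cosetRep (N : ℕ) (hN : 0 < N) : CosetIndex N → Gamma0Star N
  | none => 1
  | some i => ⟨i.1.mat i.2.1 i.2.2, i.1.mat_mem hN _ _⟩

/-- A coset is a bottom row up to sign. For injectivity, squaring the row removes √e and `gcd_eq`
returns e, hence C and d, and d determines its residue u and quotient n. For surjectivity, the sign
is chosen to make the lower left entry positive and d is divided by C with remainder. -/
theorem cosetRep_bijective (N : ℕ) (hN : 0 < N) :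
    Function.Bijective fun i => (Quotient.mk'' (cosetRep N hN i) : Cosets (Gamma0Star N)) := by
  have hsq : ∀ (p : LevelPair N), √(p.1.1 : ℝ) ^ 2 = p.1.1 := fun p => Real.sq_sqrt (by positivity)
  have hrel : ∀ x y : Gamma0Star N, (Quotient.mk'' x : Cosets (Gamma0Star N)) = Quotient.mk'' y ↔
      y * x⁻¹ ∈ translations (Gamma0Star N) := by
    intro x y
    rw [Quotient.eq'', QuotientGroup.rightRel_apply]
  constructor
  · intro i j hij
    obtain ⟨t, ht⟩ := (hrel _ _).mp hij
    obtain ⟨h10, h11⟩ := entries_of_translation ht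
    set T : SL(2, ℝ) := ((cosetRep N hN j * (cosetRep N hN i)⁻¹ : Gamma0Star N) : SL(2, ℝ)) with hT
    have hj : (cosetRep N hN j : SL(2, ℝ)) = T * (cosetRep N hN i : SL(2, ℝ)) := by
      simp [hT]
    have b0 := sl_mul_apply T (cosetRep N hN i : SL(2, ℝ)) 1 0
    have b1 := sl_mul_apply T (cosetRep N hN i : SL(2, ℝ)) 1 1
    rw [← hj, h10, zero_mul, zero_add] at b0 b1
    clear_value T
    rcases i with _ | ⟨p, u, n⟩ <;> rcases j with _ | ⟨q, v, k⟩
    · rfl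
    · exfalso
      obtain ⟨-, -, m10, -⟩ := q.mat_apply v k
      simp only [cosetRep, m10] at b0
      have : (0 : ℝ) < √(q.1.1 : ℝ) * q.1.2 :=
        mul_pos q.sqrt_pos (by exact_mod_cast q.2.2.1)
      simp at b0
      rcases b0 with b0 | b0
      · exact this.ne' (by simp [b0])
      · exact this.ne' (by simp [b0])
    · exfalso
      obtain ⟨-, -, m10, -⟩ := p.mat_apply u n
      simp only [cosetRep, m10] at b0
      have : (0 : ℝ) < √(p.1.1 : ℝ) * p.1.2 :=
        mul_pos p.sqrt_pos (by exact_mod_cast p.2.2.1)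
      rcases h11 with h | h <;> rw [h] at b0 <;> simp at b0 <;> rcases b0 with b0 | b0 <;>
        exact this.ne' (by simp [b0])
    · obtain ⟨-, -, m10, m11⟩ := p.mat_apply u n
      obtain ⟨-, -, l10, l11⟩ := q.mat_apply v k
      simp only [cosetRep, m10, m11, l10, l11] at b0 b1
      have hp : (0 : ℝ) < √(p.1.1 : ℝ) * p.1.2 :=
        mul_pos p.sqrt_pos (by exact_mod_cast p.2.2.1)
      have hq : (0 : ℝ) < √(q.1.1 : ℝ) * q.1.2 :=
        mul_pos q.sqrt_pos (by exact_mod_cast q.2.2.1)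
      -- Both lower left entries are positive, which excludes the sign -1.
      have h1 : T 1 1 = 1 := by
        rcases h11 with h | h
        · exact h
        · rw [h] at b0; linarith
      rw [h1, one_mul] at b0 b1
      have e0 : (q.1.1 * q.1.2 ^ 2 : ℤ) = p.1.1 * p.1.2 ^ 2 := by
        have : (q.1.1 * q.1.2 ^ 2 : ℝ) = p.1.1 * p.1.2 ^ 2 := by
          rw [← hsq q, ← hsq p, ← mul_pow, ← mul_pow, b0]
        exact_mod_cast this
      have e1 : (q.1.1 * q.lowerRight v k ^ 2 : ℤ) = p.1.1 * p.lowerRight u n ^ 2 := by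
        have : (q.1.1 * q.lowerRight v k ^ 2 : ℝ) = p.1.1 * p.lowerRight u n ^ 2 := by
          rw [← hsq q, ← hsq p, ← mul_pow, ← mul_pow, b1]
        exact_mod_cast this
      have he : q.1.1 = p.1.1 := by rw [← q.gcd_eq v k, e0, e1, p.gcd_eq]
      rw [he] at b0 b1
      have hC : q.1.2 = p.1.2 := by
        have := mul_left_cancel₀ p.sqrt_pos.ne' b0
        exact_mod_cast this
      have hd : q.lowerRight v k = p.lowerRight u n := by
        have := mul_left_cancel₀ p.sqrt_pos.ne' b1
        exact_mod_cast this
      obtain rfl : q = p := Subtype.ext (Prod.ext he hC)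
      have hu : v = u := Units.ext (by
        rw [← q.intCast_lowerRight v k, ← q.intCast_lowerRight u n, hd])
      subst hu
      have hn : k = n := by
        simp only [LevelPair.lowerRight, add_right_inj] at hd
        exact mul_left_cancel₀ (by exact_mod_cast NeZero.ne q.1.2) hd
      rw [hn]
  · intro x
    induction x using Quotient.inductionOn' with
    | h g =>
    obtain ⟨g, hg⟩ := g
    -- it suffices to find an index with the same bottom row up to sign
    have main : ∀ i : CosetIndex N, ∀ ε : ℝ,
        (cosetRep N hN i : SL(2, ℝ)) 1 0 * ε = g 1 0 →
        (cosetRep N hN i : SL(2, ℝ)) 1 1 * ε = g 1 1 →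
        (Quotient.mk'' (cosetRep N hN i) : Cosets (Gamma0Star N)) = Quotient.mk'' ⟨g, hg⟩ := by
      intro i ε h0 h1
      rw [hrel]
      have hmem : g * (cosetRep N hN i : SL(2, ℝ))⁻¹ ∈ Gamma0Star N :=
        mul_mem hg (inv_mem (cosetRep N hN i).2)
      obtain ⟨k, hk⟩ := translation_of_mem hN hmem (by
        obtain ⟨i00, i01, i10, i11⟩ := sl_inv_apply (cosetRep N hN i : SL(2, ℝ))
        rw [sl_mul_apply, i00, i10, ← h0, ← h1]; ring)
      exact ⟨k, hk⟩
    obtain ⟨e, he, a, b, c, d, h00, h01, h10, h11⟩ := (mem_Gamma0Star hN).mp hg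
    have he0 := pos_of_mem_exactDivisors he
    have hdet := atkinLehner_det he0 (dvd_of_mem_exactDivisors he) h00 h01 h10 h11
    have he' : (0 : ℝ) < e := by exact_mod_cast he0
    have hs : √(e : ℝ) ^ 2 = e := Real.sq_sqrt he'.le
    have hs0 := (Real.sqrt_pos.2 he').ne'
    have hNe : (N : ℝ) = e * (N / e : ℕ) := by
      exact_mod_cast (Nat.mul_div_cancel' (dvd_of_mem_exactDivisors he)).symm
    have hNe0 : 0 < N / e := Nat.div_pos (Nat.le_of_dvd hN (dvd_of_mem_exactDivisors he)) he0
    have h10' : g 1 0 = √(e : ℝ) * ((N / e : ℕ) * c) := by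
      rw [h10, hNe, div_eq_iff hs0]
      linear_combination (-((N / e : ℕ) : ℝ) * c) * hs
    by_cases hc : c = 0
    · refine ⟨none, main none (g 1 1) ?_ ?_⟩
      · simp [cosetRep, h10, hc]
      · simp [cosetRep]
    · set ε : ℤ := c.sign with hε
      have hcε : c.natAbs * ε = c := by rw [mul_comm]; exact Int.sign_mul_natAbs c
      have hεε : ε * ε = 1 := by
        rcases lt_trichotomy c 0 with h | h | h
        · rw [hε, Int.sign_eq_neg_one_of_neg h]; norm_num
        · exact absurd h hc
        · rw [hε, Int.sign_eq_one_of_pos h]; norm_num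
      -- The determinant, rewritten after the change of sign, gives both that C is prime to e and
      -- that the new d is a unit modulo C.
      have hcop : IsCoprime (((N / e * c.natAbs : ℕ)) : ℤ) (e * (d * ε)) :=
        ⟨-(b * ε), a * ε, by
          rw [Nat.cast_mul]
          linear_combination (-((N / e : ℕ) : ℤ) * b) * hcε + (e * a * d : ℤ) * hεε + hdet⟩
      have hcop1 : IsCoprime (((N / e * c.natAbs : ℕ)) : ℤ) (e : ℤ) := hcop.of_mul_right_left
      obtain ⟨p, hp1, hp2⟩ : ∃ p : LevelPair N, p.1.1 = e ∧ p.1.2 = N / e * c.natAbs :=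
        ⟨⟨(e, N / e * c.natAbs), he,
        Nat.mul_pos hNe0 (Int.natAbs_pos.2 hc), dvd_mul_right _ _,
        Nat.isCoprime_iff_coprime.mp hcop1⟩, rfl, rfl⟩
      have hcop2 : IsCoprime (p.1.2 : ℤ) (d * ε) := hp2 ▸ hcop.of_mul_right_right
      have hunit : IsUnit ((d * ε : ℤ) : ZMod p.1.2) := by
        obtain ⟨x, y, hxy⟩ := hcop2
        refine IsUnit.of_mul_eq_one ((y : ℤ) : ZMod p.1.2) ?_
        have := congrArg (Int.cast : ℤ → ZMod p.1.2) hxy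
        rw [Int.cast_add, Int.cast_mul, Int.cast_mul] at this
        simpa [mul_comm] using this
      obtain ⟨u, hu⟩ := hunit
      have hval : ((u : ZMod p.1.2).val : ℤ) = (d * ε) % p.1.2 := by
        rw [hu, ZMod.val_intCast]
      have hlr : p.lowerRight u ((d * ε) / p.1.2) = d * ε := by
        rw [LevelPair.lowerRight, hval]; exact Int.emod_add_mul_ediv _ _
      refine ⟨some ⟨p, u, (d * ε) / p.1.2⟩, main _ ε ?_ ?_⟩
      · obtain ⟨-, -, m10, -⟩ := p.mat_apply u ((d * ε) / p.1.2)
        simp only [cosetRep, m10]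
        have := congrArg (Int.cast : ℤ → ℝ) hcε
        rw [Int.cast_mul, Int.cast_natCast] at this
        rw [h10', hp1, hp2, Nat.cast_mul]
        linear_combination (√(e : ℝ) * (N / e : ℕ)) * this
      · obtain ⟨-, -, -, m11⟩ := p.mat_apply u ((d * ε) / p.1.2)
        simp only [cosetRep, m11]
        rw [hlr, h11, hp1]
        have : (ε : ℝ) * ε = 1 := by exact_mod_cast hεε
        push_cast
        linear_combination (√(e : ℝ) * d) * this

/-- The seed function at `-1 / (q * (x + i y))`, up to sign of the real part of its argument. -/
def invSeed (m : ℕ) (s : ℂ) (q y x : ℝ) : ℂ :=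
  Complex.exp (2 * Real.pi * Complex.I * (m * (x / (q * (x ^ 2 + y ^ 2)) : ℝ))) *
    ((√(y / (q * (x ^ 2 + y ^ 2))) : ℝ) : ℂ) *
    besselI (s - 1 / 2) (2 * Real.pi * m * (y / (q * (x ^ 2 + y ^ 2))))

theorem seed_vadd_intCast (m : ℕ) (s : ℂ) (k : ℤ) (z : ℍ) :
    seed m s ((k : ℝ) +ᵥ z) = seed m s z := by
  have hre : ((k : ℝ) +ᵥ z).re = k + z.re := by simp
  have him : ((k : ℝ) +ᵥ z).im = z.im := by simp
  rw [seed, seed, hre, him]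
  congr 2
  rw [Complex.exp_eq_exp_iff_exists_int]
  exact ⟨-(m * k), by push_cast; ring⟩

namespace LevelPair

variable {N : ℕ} (p : LevelPair N)

/-- The parameter `-m / e` modulo `C` of the Kloosterman sums attached to `(e, C)`. -/
def twist (m : ℕ) : ZMod p.1.2 := -(m : ZMod p.1.2) * ((p.unit⁻¹ : (ZMod p.1.2)ˣ) : ZMod p.1.2)

/-- The real part of the image is a/C minus that of 1/(q(z + u/C + n)). The first summand gives the
additive character, as a inverts eu modulo C; the second, with the imaginary part, gives `invSeed`.
-/
theorem seed_mat_smul (m : ℕ) (s : ℂ) (u : (ZMod p.1.2)ˣ) (n : ℤ) (z : ℍ) :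
    seed m s (p.mat u n • z) =
      ZMod.stdAddChar (p.twist m * ((u⁻¹ : (ZMod p.1.2)ˣ) : ZMod p.1.2)) *
      invSeed m s (p.1.1 * p.1.2 ^ 2) z.im (z.re + (u : ZMod p.1.2).val / p.1.2 + n) := by
  have hcoe := p.coe_mat_smul u n z
  set q : ℝ := p.1.1 * p.1.2 ^ 2 with hq
  set x : ℝ := z.re + (u : ZMod p.1.2).val / p.1.2 + n with hx
  have hC : (0 : ℝ) < p.1.2 := by exact_mod_cast p.2.2.1
  have he : (0 : ℝ) < p.1.1 := by exact_mod_cast p.e_pos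
  have hq0 : 0 < q := by positivity
  have hz : (z : ℂ) + (u : ZMod p.1.2).val / p.1.2 + n = ⟨x, z.im⟩ := by
    rw [hx]
    generalize (u : ZMod p.1.2).val = w
    rw [show (z : ℂ) + w / p.1.2 + n = z + ((w / p.1.2 + n : ℝ) : ℂ) by push_cast; ring]
    apply Complex.ext <;> simp [add_assoc]
  have hy := z.im_pos
  have hxy : (0 : ℝ) < x ^ 2 + z.im ^ 2 := by positivity
  have hinv : (1 : ℂ) / (p.1.1 * p.1.2 ^ 2 * (z + (u : ZMod p.1.2).val / p.1.2 + n)) =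
      ⟨x / (q * (x ^ 2 + z.im ^ 2)), -(z.im / (q * (x ^ 2 + z.im ^ 2)))⟩ := by
    rw [hz, show (p.1.1 : ℂ) * p.1.2 ^ 2 = (q : ℂ) by rw [hq]; push_cast; ring]
    have hne : (⟨x, z.im⟩ : ℂ) ≠ 0 := fun h => hy.ne' (congrArg Complex.im h)
    have hqC : (q : ℂ) ≠ 0 := by exact_mod_cast hq0.ne'
    rw [div_eq_iff (mul_ne_zero hqC hne)]
    apply Complex.ext
    · simp; field_simp
    · simp; field_simp; ring
  rw [hinv, show (p.upperLeft u : ℂ) / p.1.2 = ((p.upperLeft u / p.1.2 : ℝ) : ℂ) by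
    push_cast; ring] at hcoe
  have hre : (p.mat u n • z).re = p.upperLeft u / p.1.2 - x / (q * (x ^ 2 + z.im ^ 2)) := by
    rw [← UpperHalfPlane.coe_re, hcoe]; simp
  have him : (p.mat u n • z).im = z.im / (q * (x ^ 2 + z.im ^ 2)) := by
    rw [← UpperHalfPlane.coe_im, hcoe]; simp
  have hchar : p.twist m * ((u⁻¹ : (ZMod p.1.2)ˣ) : ZMod p.1.2) =
      ((-(m * p.upperLeft u) : ℤ) : ZMod p.1.2) := by
    push_cast
    rw [intCast_upperLeft, Units.val_mul, twist]; ring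
  rw [hchar, ZMod.stdAddChar_coe, seed, invSeed, hre, him]
  simp only [← mul_assoc]
  rw [← Complex.exp_add]
  congr 3
  push_cast
  ring

end LevelPair

theorem seed_smul_out {N : ℕ} (hN : 0 < N) (m : ℕ) (s : ℂ) (z : ℍ) (g : Gamma0Star N) :
    seed m s (((Quotient.mk'' g : Cosets (Gamma0Star N)).out : SL(2, ℝ)) • z) =
      seed m s ((g : SL(2, ℝ)) • z) := by
  have h : (Quotient.mk'' (Quotient.mk'' g : Cosets (Gamma0Star N)).out : Cosets (Gamma0Star N)) =
    Quotient.mk'' g := Quotient.out_eq' _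
  rw [Quotient.eq'', QuotientGroup.rightRel_apply] at h
  set g' := (Quotient.mk'' g : Cosets (Gamma0Star N)).out
  obtain ⟨t, ht⟩ := h
  obtain ⟨k, hk⟩ := translation_of_mem hN (g * g'⁻¹).2 (entries_of_translation ht).1
  have : (g : SL(2, ℝ)) • z = (k : ℝ) +ᵥ ((g' : SL(2, ℝ)) • z) := by
    rw [← hk, ← mul_smul]; simp
  rw [this, seed_vadd_intCast]

/-- The Niebur-Poincaré series, in terms of explicit coset representatives. -/
theorem hasSum_cosets_iff {N : ℕ} (hN : 0 < N) (m : ℕ) (s : ℂ) (z : ℍ) (a : ℂ) :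
    HasSum (fun M : Cosets (Gamma0Star N) => seed m s ((M.out : SL(2, ℝ)) • z)) a ↔
      HasSum (fun i : Σ p : LevelPair N, (ZMod p.1.2)ˣ × ℤ =>
        ZMod.stdAddChar (i.1.twist m * ((i.2.1⁻¹ : (ZMod i.1.1.2)ˣ) : ZMod i.1.1.2)) *
        invSeed m s (i.1.1.1 * i.1.1.2 ^ 2) z.im
          (z.re + (i.2.1 : ZMod i.1.1.2).val / i.1.1.2 + i.2.2)) (a - seed m s z) := by
  rw [← (Equiv.ofBijective _ (cosetRep_bijective N hN)).hasSum_iff]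
  set f : CosetIndex N → ℂ := (fun M : Cosets (Gamma0Star N) =>
    seed m s ((M.out : SL(2, ℝ)) • z)) ∘ (Equiv.ofBijective _ (cosetRep_bijective N hN)) with hf
  have hnone : f none = seed m s z := by
    simp only [hf, Function.comp_apply, Equiv.ofBijective_apply]
    rw [seed_smul_out hN]
    simp [cosetRep]
  -- The trivial coset `none` carries the term `seed m s z`; it is set to zero so that the sum is
  -- supported on the nontrivial cosets.
  have hsome : ∀ i, Function.update f none 0 (some i) =
      ZMod.stdAddChar (i.1.twist m * ((i.2.1⁻¹ : (ZMod i.1.1.2)ˣ) : ZMod i.1.1.2)) *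
        invSeed m s (i.1.1.1 * i.1.1.2 ^ 2) z.im
          (z.re + (i.2.1 : ZMod i.1.1.2).val / i.1.1.2 + i.2.2) := by
    intro i
    rw [Function.update_of_ne (by simp)]
    simp only [hf, Function.comp_apply, Equiv.ofBijective_apply]
    rw [seed_smul_out hN, ← LevelPair.seed_mat_smul]
    rfl
  have hopt : ∀ b, HasSum (Function.update f none 0) b ↔
      HasSum (fun i => Function.update f none 0 (some i)) b := fun b =>
    ((Option.some_injective _).hasSum_iff (by
      rintro (_ | i) hi
      · simp
      · simp at hi)).symm
  simp_rw [← hsome]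
  rw [← hopt]
  constructor
  · intro h
    have := h.update none 0
    rwa [hnone, show 0 - seed m s z + a = a - seed m s z by ring] at this
  · intro h
    have := h.update none (f none)
    rw [Function.update_idem, Function.update_eq_self, Function.update_self, hnone,
      show seed m s z - 0 + (a - seed m s z) = a by ring] at this
    exact this
end NieburPoincare
end

/-! ### Estimates for the Bessel function and for lattice sums. -/

noncomputable section
namespace NieburPoincare

/-- In Γ(w + 1) = w Γ(w) the factor satisfies |w| ≥ Re w ≥ 1, so the reciprocals do not grow in k.
-/
theorem norm_inv_Gamma_le {s : ℂ} (hs : 1 / 2 ≤ s.re) (k : ℕ) :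
    ‖(Complex.Gamma (s - 1 / 2 + k + 1))⁻¹‖ ≤ ‖(Complex.Gamma (s + 1 / 2))⁻¹‖ := by
  induction k with
  | zero => apply le_of_eq; congr 3; push_cast; ring
  | succ k ih =>
    have hre : (1 : ℝ) ≤ (s - 1 / 2 + k + 1).re := by
      simp; linarith [Nat.cast_nonneg (α := ℝ) k]
    have h1 : 1 ≤ ‖s - 1 / 2 + k + 1‖ := hre.trans (Complex.re_le_norm _)
    have h0 : s - 1 / 2 + k + 1 ≠ 0 := fun h => by rw [h] at h1; norm_num at h1
    rw [show s - 1 / 2 + (k + 1 : ℕ) + 1 = (s - 1 / 2 + k + 1) + 1 by push_cast; ring,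
      Complex.Gamma_add_one _ h0, mul_inv, norm_mul]
    calc _ ≤ 1 * ‖(Complex.Gamma (s - 1 / 2 + k + 1))⁻¹‖ := by
          gcongr
          rw [norm_inv]
          exact inv_le_one_of_one_le₀ h1
      _ ≤ _ := by rw [one_mul]; exact ih

/-- The terms of the power series for `I_{s-1/2}(x)`. -/
def besselTerm (s : ℂ) (x : ℝ) (k : ℕ) : ℂ :=
  ((x / 2 : ℝ) : ℂ) ^ (s - 1 / 2 + 2 * k) / (k.factorial * Complex.Gamma (s - 1 / 2 + k + 1))

theorem besselI_eq_tsum (s : ℂ) (x : ℝ) : besselI (s - 1 / 2) x = ∑' k, besselTerm s x k := rfl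

theorem norm_besselTerm_le {s : ℂ} (hs : 1 / 2 ≤ s.re) {x : ℝ} (hx : 0 < x) (k : ℕ) :
    ‖besselTerm s x k‖ ≤ ‖(Complex.Gamma (s + 1 / 2))⁻¹‖ * (x / 2) ^ (s.re - 1 / 2) *
      (((x / 2) ^ 2) ^ k / k.factorial) := by
  have hx2 : 0 < x / 2 := by positivity
  rw [besselTerm, div_eq_mul_inv, mul_inv, norm_mul, norm_mul,
    Complex.norm_cpow_eq_rpow_re_of_pos hx2]
  have h1 : (x / 2) ^ (s - 1 / 2 + 2 * (k : ℂ)).re =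
      (x / 2) ^ (s.re - 1 / 2) * ((x / 2) ^ 2) ^ k := by
    rw [← pow_mul, ← Real.rpow_natCast, ← Real.rpow_add hx2]
    congr 1
    simp
  have h2 : ‖((k.factorial : ℂ))⁻¹‖ = ((k.factorial : ℝ))⁻¹ := by simp
  rw [h1, h2]
  calc _ ≤ (x / 2) ^ (s.re - 1 / 2) * ((x / 2) ^ 2) ^ k * (((k.factorial : ℝ))⁻¹ *
        ‖(Complex.Gamma (s + 1 / 2))⁻¹‖) := by
        gcongr
        exact norm_inv_Gamma_le hs k
    _ = _ := by ring

theorem summable_besselTerm {s : ℂ} (hs : 1 / 2 ≤ s.re) {x : ℝ} (hx : 0 < x) :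
    Summable (besselTerm s x) :=
  Summable.of_norm_bounded ((Real.summable_pow_div_factorial _).mul_left _)
    (norm_besselTerm_le hs hx)

theorem tsum_pow_div_factorial (x : ℝ) : ∑' k : ℕ, x ^ k / k.factorial = Real.exp x := by
  rw [Real.exp_eq_exp_ℝ, NormedSpace.exp_eq_tsum_div]

theorem norm_besselI_le {s : ℂ} (hs : 1 / 2 ≤ s.re) {x : ℝ} (hx : 0 < x) :
    ‖besselI (s - 1 / 2) x‖ ≤ ‖(Complex.Gamma (s + 1 / 2))⁻¹‖ * (x / 2) ^ (s.re - 1 / 2) *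
      Real.exp ((x / 2) ^ 2) := by
  rw [besselI_eq_tsum, ← tsum_pow_div_factorial, ← tsum_mul_left]
  exact tsum_of_norm_bounded
    ((Real.summable_pow_div_factorial _).mul_left _).hasSum (norm_besselTerm_le hs hx)

/-- Without its first term the power series starts one step later; (k + 1)! ≥ k! leaves the earlier
majorant with an extra factor (x/2)². -/
theorem norm_besselI_sub_le {s : ℂ} (hs : 1 / 2 ≤ s.re) {x : ℝ} (hx : 0 < x) :
    ‖besselI (s - 1 / 2) x -
        ((x / 2 : ℝ) : ℂ) ^ (s - 1 / 2) * (Complex.Gamma (s + 1 / 2))⁻¹‖ ≤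
      ‖(Complex.Gamma (s + 1 / 2))⁻¹‖ * (x / 2) ^ (s.re - 1 / 2) *
      ((x / 2) ^ 2 * Real.exp ((x / 2) ^ 2)) := by
  rw [besselI_eq_tsum, (summable_besselTerm hs hx).tsum_eq_zero_add]
  have h0 : besselTerm s x 0 =
      ((x / 2 : ℝ) : ℂ) ^ (s - 1 / 2) * (Complex.Gamma (s + 1 / 2))⁻¹ := by
    rw [besselTerm, div_eq_mul_inv]
    congr 2
    · simp
    · rw [Nat.factorial_zero, Nat.cast_one, one_mul]; congr 1; push_cast; ring
  rw [h0, add_sub_cancel_left, ← tsum_pow_div_factorial, ← tsum_mul_left, ← tsum_mul_left]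
  refine tsum_of_norm_bounded
    (((Real.summable_pow_div_factorial _).mul_left _).mul_left _).hasSum fun k => ?_
  refine (norm_besselTerm_le hs hx (k + 1)).trans ?_
  gcongr
  rw [pow_succ, mul_comm, mul_div_assoc]
  gcongr
  omega

/-- The terms are entire because 1/Γ is, and the exponential majorant is uniform for s near `s₀`. -/
theorem differentiableAt_besselI {x : ℝ} (hx : 0 < x) {s₀ : ℂ} (hs : 1 / 2 < s₀.re) :
    DifferentiableAt ℂ (fun s => besselI (s - 1 / 2) x) s₀ := by
  have hx2 : 0 < x / 2 := by positivity
  have hxC : ((x / 2 : ℝ) : ℂ) ≠ 0 := by exact_mod_cast hx2.ne'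
  have hG : Continuous fun s : ℂ => ‖(Complex.Gamma (s + 1 / 2))⁻¹‖ * (x / 2) ^ (s.re - 1 / 2) := by
    refine Continuous.mul ?_ ?_
    · exact (Complex.differentiable_one_div_Gamma.continuous.comp
        (continuous_id.add continuous_const)).norm
    · exact Continuous.rpow continuous_const (by fun_prop) fun _ => Or.inl hx2.ne'
  obtain ⟨K, hK⟩ := (isCompact_closedBall s₀ 1).exists_bound_of_continuousOn hG.continuousOn
  set U : Set ℂ := Metric.ball s₀ 1 ∩ {s | 1 / 2 < s.re} with hU
  have hUo : IsOpen U := Metric.isOpen_ball.inter (isOpen_lt continuous_const Complex.continuous_re)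
  have hd : DifferentiableOn ℂ (fun s => ∑' k, besselTerm s x k) U := by
    refine Complex.differentiableOn_tsum_of_summable_norm
      (u := fun k => K * (((x / 2) ^ 2) ^ k / k.factorial))
      ((Real.summable_pow_div_factorial _).mul_left _) (fun k => ?_) hUo fun k s hs => ?_
    · refine Differentiable.differentiableOn ?_
      have : (fun s => besselTerm s x k) = fun s : ℂ => ((x / 2 : ℝ) : ℂ) ^ (s - 1 / 2 + 2 * (k : ℂ)) *
          (((k.factorial : ℂ))⁻¹ * (Complex.Gamma (s - 1 / 2 + k + 1))⁻¹) := by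
        funext s
        rw [besselTerm, div_eq_mul_inv, mul_inv]
      rw [this]
      refine Differentiable.mul ?_ (Differentiable.const_mul ?_ _)
      · exact Differentiable.const_cpow (by fun_prop) (Or.inl hxC)
      · exact Complex.differentiable_one_div_Gamma.comp (by fun_prop)
    · refine (norm_besselTerm_le hs.2.le hx k).trans ?_
      gcongr
      exact (le_abs_self _).trans (hK s (Metric.ball_subset_closedBall hs.1))
  exact hd.differentiableAt (hUo.mem_nhds ⟨Metric.mem_ball_self one_pos, hs⟩)

theorem differentiableAt_invSeed {m : ℕ} (hm : 0 < m) {q y : ℝ} (hq : 0 < q) (hy : 0 < y) (x : ℝ)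
    {s₀ : ℂ} (hs : 1 / 2 < s₀.re) : DifferentiableAt ℂ (fun s => invSeed m s q y x) s₀ := by
  have hv : 0 < y / (q * (x ^ 2 + y ^ 2)) := by positivity
  have hm' : (0 : ℝ) < m := by exact_mod_cast hm
  exact (differentiableAt_besselI (by positivity) hs).const_mul _

/-- The coefficient of the leading term of the seed function. -/
def leadCoeff (m : ℕ) (y : ℝ) (s : ℂ) : ℂ :=
  ((Real.pi * m : ℝ) : ℂ) ^ (s - 1 / 2) * (Complex.Gamma (s + 1 / 2))⁻¹ * (y : ℂ) ^ s

theorem differentiable_leadCoeff {m : ℕ} (hm : 0 < m) {y : ℝ} (hy : 0 < y) :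
    Differentiable ℂ (leadCoeff m y) := by
  have h1 : ((Real.pi * m : ℝ) : ℂ) ≠ 0 := by
    have : (0 : ℝ) < Real.pi * m := mul_pos Real.pi_pos (by exact_mod_cast hm)
    exact_mod_cast this.ne'
  have h2 : (y : ℂ) ≠ 0 := by exact_mod_cast hy.ne'
  refine Differentiable.mul (Differentiable.mul ?_ ?_) ?_
  · exact Differentiable.const_cpow (by fun_prop) (Or.inl h1)
  · exact Complex.differentiable_one_div_Gamma.comp (by fun_prop)
  · exact Differentiable.const_cpow (by fun_prop) (Or.inl h2)

theorem exists_bound_leadCoeff {m : ℕ} (hm : 0 < m) {y : ℝ} (hy : 0 < y) (A : ℝ) :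
    ∃ K : ℝ, 0 < K ∧ ∀ s : ℂ, ‖s‖ ≤ A → ‖leadCoeff m y s‖ ≤ K := by
  obtain ⟨K, hK⟩ := (isCompact_closedBall (0 : ℂ) A).exists_bound_of_continuousOn
    (differentiable_leadCoeff hm hy).continuous.continuousOn
  exact ⟨max K 1, by positivity, fun s hs => (hK s (by simpa using hs)).trans (le_max_left _ _)⟩

theorem norm_leadCoeff {m : ℕ} (hm : 0 < m) {y : ℝ} (hy : 0 < y) (s : ℂ) :
    ‖leadCoeff m y s‖ =
      (Real.pi * m) ^ (s.re - 1 / 2) * ‖(Complex.Gamma (s + 1 / 2))⁻¹‖ * y ^ s.re := by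
  have h1 : (0 : ℝ) < Real.pi * m := mul_pos Real.pi_pos (by exact_mod_cast hm)
  rw [leadCoeff, norm_mul, norm_mul, Complex.norm_cpow_eq_rpow_re_of_pos h1,
    Complex.norm_cpow_eq_rpow_re_of_pos hy]
  simp

theorem sqrt_mul_rpow {v : ℝ} (hv : 0 < v) (σ : ℝ) : √v * v ^ (σ - 1 / 2) = v ^ σ := by
  rw [Real.sqrt_eq_rpow, ← Real.rpow_add hv]; congr 1; ring

theorem inv_div_rpow {q y r : ℝ} (hq : 0 < q) (hy : 0 < y) (hr : 0 < r) (σ : ℝ) :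
    (y / (q * r)) ^ σ = y ^ σ * (q ^ (-σ) * r ^ (-σ)) := by
  rw [Real.div_rpow hy.le (by positivity), Real.mul_rpow hq.le hr.le, Real.rpow_neg hq.le,
    Real.rpow_neg hr.le]
  field_simp

/-- The surplus exponent σ - 3/4 acts on a base at least y², so it is bounded on the compact range
of σ. The fixed exponent 3/4 exceeds 1/2, as needed for convergence over a lattice and along a line.
-/
theorem rpow_neg_le_of_bounded {y : ℝ} (hy : 0 < y) (A : ℝ) :
    ∃ K : ℝ, 0 < K ∧ ∀ σ : ℝ, 3 / 4 ≤ σ → σ ≤ A → ∀ x : ℝ,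
      (x ^ 2 + y ^ 2) ^ (-σ) ≤ K * (x ^ 2 + y ^ 2) ^ (-(3 / 4) : ℝ) := by
  obtain ⟨K, hK⟩ := (isCompact_Icc (a := (3 / 4 : ℝ)) (b := A)).exists_bound_of_continuousOn
    (f := fun σ : ℝ => (y ^ 2) ^ (-(σ - 3 / 4)))
    (Continuous.continuousOn (Continuous.rpow continuous_const (by fun_prop)
      fun _ => Or.inl (by positivity)))
  refine ⟨max K 1, by positivity, fun σ h1 h2 x => ?_⟩
  have hr : 0 < x ^ 2 + y ^ 2 := by positivity
  rw [show -σ = -(σ - 3 / 4) + -(3 / 4) by ring, Real.rpow_add hr]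
  gcongr
  calc (x ^ 2 + y ^ 2) ^ (-(σ - 3 / 4)) ≤ (y ^ 2) ^ (-(σ - 3 / 4)) :=
        Real.rpow_le_rpow_of_nonpos (by positivity) (by nlinarith [sq_nonneg x]) (by linarith)
    _ ≤ K := (le_abs_self _).trans (hK σ ⟨h1, h2⟩)
    _ ≤ _ := le_max_left _ _

/-- Uniform bounds for the seed function at `-1 / (q * z)`, and its approximation by
the leading term. -/
theorem exists_bound_invSeed {m : ℕ} (hm : 0 < m) {y : ℝ} (hy : 0 < y) (A : ℝ) :
    ∃ K : ℝ, 0 < K ∧ ∀ s : ℂ, 3 / 4 ≤ s.re → ‖s‖ ≤ A → ∀ q : ℝ, 1 ≤ q → ∀ x : ℝ,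
      ‖invSeed m s q y x‖ ≤ K * q ^ (-s.re) * (x ^ 2 + y ^ 2) ^ (-(3 / 4) : ℝ) ∧
      ‖invSeed m s q y x - leadCoeff m y s *
        ((q : ℂ) ^ (-s) * ((x ^ 2 + y ^ 2 : ℝ) : ℂ) ^ (-s))‖ ≤
          K * q ^ (-s.re - 1) * (x ^ 2 + y ^ 2) ^ (-(3 / 4) : ℝ) := by
  obtain ⟨K₁, hK₁, hlead⟩ := exists_bound_leadCoeff hm hy A
  obtain ⟨K₂, hK₂, hpow⟩ := rpow_neg_le_of_bounded hy A
  have hm' : (0 : ℝ) < m := by exact_mod_cast hm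
  have hr0 : (0 : ℝ) < Real.pi * m := mul_pos Real.pi_pos hm'
  set E : ℝ := Real.exp ((Real.pi * m / y) ^ 2) with hE
  -- `E` bounds the exponential in the Bessel majorant. In the inner sum, the first `E` serves the
  -- size estimate, 2πm/y the deviation of the phase from 1, and the last term the Bessel series
  -- beyond its first term.
  set L : ℝ := K₁ * K₂ * (E + (2 * (Real.pi * m) / y + (Real.pi * m) ^ 2 / y ^ 2 * E)) with hL
  have hE0 : 0 < E := Real.exp_pos _
  refine ⟨L, by positivity, fun s hs1 hsA q hq x => ?_⟩
  have hs : 1 / 2 ≤ s.re := by linarith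
  have hq0 : 0 < q := by linarith
  have hσA : s.re ≤ A := (Complex.re_le_norm s).trans hsA
  have hR : 0 < x ^ 2 + y ^ 2 := by positivity
  set R : ℝ := x ^ 2 + y ^ 2 with hRdef
  set v : ℝ := y / (q * R) with hv
  have hv0 : 0 < v := by positivity
  have hvq : v ≤ 1 / (q * y) := by
    rw [hv, div_le_div_iff₀ (by positivity) (by positivity)]
    nlinarith [sq_nonneg x]
  have hvy : v ≤ 1 / y := hvq.trans (by gcongr; nlinarith)
  have hx2 : 2 * Real.pi * m * v / 2 = Real.pi * m * v := by ring
  have hX : 0 < 2 * Real.pi * m * v := by positivity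
  have hexp : Real.exp ((Real.pi * m * v) ^ 2) ≤ E := by
    rw [hE]; gcongr
    rw [div_eq_mul_one_div]; gcongr
  -- the size of the leading term
  have hsize : √v * (‖(Complex.Gamma (s + 1 / 2))⁻¹‖ * (Real.pi * m * v) ^ (s.re - 1 / 2)) =
      ‖leadCoeff m y s‖ * (q ^ (-s.re) * R ^ (-s.re)) := by
    rw [norm_leadCoeff hm hy, Real.mul_rpow hr0.le hv0.le]
    have h1 := sqrt_mul_rpow hv0 s.re
    have h2 := inv_div_rpow hq0 hy hR s.re
    rw [← hv] at h2
    rw [h2] at h1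
    linear_combination (‖(Complex.Gamma (s + 1 / 2))⁻¹‖ * (Real.pi * m) ^ (s.re - 1 / 2)) * h1
  have hsize' : ‖leadCoeff m y s‖ * (q ^ (-s.re) * R ^ (-s.re)) ≤
      K₁ * K₂ * (q ^ (-s.re) * R ^ (-(3 / 4) : ℝ)) := by
    calc _ ≤ K₁ * (q ^ (-s.re) * (K₂ * R ^ (-(3 / 4) : ℝ))) := by
          gcongr
          · exact hlead s hsA
          · exact hpow _ hs1 hσA x
      _ = _ := by ring
  have hB := norm_besselI_le hs hX
  have hB' := norm_besselI_sub_le hs hX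
  rw [hx2] at hB hB'
  set θ : ℝ := x / (q * R) with hθ
  have hphase : ‖Complex.exp (2 * Real.pi * Complex.I * (m * (θ : ℝ)))‖ = 1 := by
    rw [show 2 * Real.pi * Complex.I * (m * (θ : ℝ)) = ((2 * Real.pi * (m * θ) : ℝ) : ℂ) * Complex.I
      by push_cast; ring, Complex.norm_exp_ofReal_mul_I]
  have hθ' : |θ| ≤ 1 / (q * y) := by
    rw [hθ, abs_div, abs_of_pos (by positivity : 0 < q * R), div_le_div_iff₀ (by positivity)
      (by positivity)]
    have : |x| * y ≤ R := by rw [hRdef]; nlinarith [sq_nonneg (|x| - y), sq_abs x, abs_nonneg x]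
    calc |x| * (q * y) = q * (|x| * y) := by ring
      _ ≤ q * R := by gcongr
      _ = _ := by ring
  have hphase' : ‖Complex.exp (2 * Real.pi * Complex.I * (m * (θ : ℝ))) - 1‖ ≤
      2 * (Real.pi * m) / y * q⁻¹ := by
    have := Real.norm_exp_I_mul_ofReal_sub_one_le (x := 2 * Real.pi * (m * θ))
    rw [show 2 * Real.pi * Complex.I * (m * (θ : ℝ)) = Complex.I * ((2 * Real.pi * (m * θ) : ℝ) : ℂ)
      by push_cast; ring]
    refine this.trans ?_
    rw [Real.norm_eq_abs, abs_mul (2 * Real.pi), abs_mul (m : ℝ), abs_of_pos (by positivity : 0 < 2 * Real.pi),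
      abs_of_pos hm']
    calc 2 * Real.pi * (m * |θ|) ≤ 2 * Real.pi * (m * (1 / (q * y))) := by gcongr
      _ = _ := by field_simp
  have hsq : ‖((√v : ℝ) : ℂ)‖ = √v := by
    rw [Complex.norm_real, Real.norm_of_nonneg (Real.sqrt_nonneg _)]
  have hdef : invSeed m s q y x = Complex.exp (2 * Real.pi * Complex.I * (m * (θ : ℝ))) *
      ((√v : ℝ) : ℂ) * besselI (s - 1 / 2) (2 * Real.pi * m * v) := rfl
  have hQ : q ^ (-s.re - 1) = q ^ (-s.re) * q⁻¹ := by
    rw [sub_eq_add_neg, Real.rpow_add hq0, Real.rpow_neg_one]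
  have hposqR : 0 ≤ q ^ (-s.re) * R ^ (-(3 / 4) : ℝ) := by positivity
  constructor
  · rw [hdef, norm_mul, norm_mul, hphase, one_mul, hsq]
    calc _ ≤ √v * (‖(Complex.Gamma (s + 1 / 2))⁻¹‖ * (Real.pi * m * v) ^ (s.re - 1 / 2) *
          Real.exp ((Real.pi * m * v) ^ 2)) := by gcongr
      _ = √v * (‖(Complex.Gamma (s + 1 / 2))⁻¹‖ * (Real.pi * m * v) ^ (s.re - 1 / 2)) *
          Real.exp ((Real.pi * m * v) ^ 2) := by ring
      _ ≤ K₁ * K₂ * (q ^ (-s.re) * R ^ (-(3 / 4) : ℝ)) * E := by rw [hsize]; gcongr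
      _ = K₁ * K₂ * E * (q ^ (-s.re) * R ^ (-(3 / 4) : ℝ)) := by ring
      _ ≤ L * (q ^ (-s.re) * R ^ (-(3 / 4) : ℝ)) := by
          refine mul_le_mul_of_nonneg_right ?_ hposqR
          rw [hL]; gcongr
          exact le_add_of_nonneg_right (by positivity)
      _ = _ := by ring
  · set lead : ℂ := ((Real.pi * m * v : ℝ) : ℂ) ^ (s - 1 / 2) * (Complex.Gamma (s + 1 / 2))⁻¹
      with hleaddef
    have hmain : leadCoeff m y s * ((q : ℂ) ^ (-s) * ((R : ℝ) : ℂ) ^ (-s)) =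
        ((√v : ℝ) : ℂ) * lead := by
      have hvs : ((√v : ℝ) : ℂ) * ((v : ℝ) : ℂ) ^ (s - 1 / 2) = (v : ℂ) ^ s := by
        rw [Real.sqrt_eq_rpow, Complex.ofReal_cpow hv0.le,
          ← Complex.cpow_add _ _ (by exact_mod_cast hv0.ne')]
        congr 1; push_cast; ring
      have hvs' : (v : ℂ) ^ s = (y : ℂ) ^ s * ((q : ℂ) ^ (-s) * ((R : ℝ) : ℂ) ^ (-s)) := by
        have : (v : ℂ) = (y : ℂ) * ((q⁻¹ : ℝ) : ℂ) * ((R⁻¹ : ℝ) : ℂ) := by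
          rw [hv]; push_cast; field_simp
        rw [this, ← Complex.ofReal_mul,
          Complex.mul_cpow_ofReal_nonneg (by positivity) (by positivity), Complex.ofReal_mul,
          Complex.mul_cpow_ofReal_nonneg (by positivity) (by positivity),
          Complex.ofReal_inv, Complex.ofReal_inv, Complex.inv_cpow, Complex.inv_cpow,
          Complex.cpow_neg, Complex.cpow_neg]
        · ring
        · rw [Complex.arg_ofReal_of_nonneg hR.le]; exact Real.pi_pos.ne
        · rw [Complex.arg_ofReal_of_nonneg hq0.le]; exact Real.pi_pos.ne
      rw [hleaddef, Complex.ofReal_mul (Real.pi * m) v,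
        Complex.mul_cpow_ofReal_nonneg hr0.le hv0.le, leadCoeff]
      rw [hvs'] at hvs
      linear_combination (-(((Real.pi * m : ℝ) : ℂ) ^ (s - 1 / 2) *
        (Complex.Gamma (s + 1 / 2))⁻¹)) * hvs
    have hnlead : ‖((√v : ℝ) : ℂ) * lead‖ ≤ K₁ * K₂ * (q ^ (-s.re) * R ^ (-(3 / 4) : ℝ)) := by
      rw [← hmain, norm_mul, norm_mul, Complex.norm_cpow_eq_rpow_re_of_pos hq0,
        Complex.norm_cpow_eq_rpow_re_of_pos hR]
      exact hsize'
    -- The error is (phase - 1) · lead plus phase · (Bessel - lead). Both gain q⁻¹: |θ| ≤ 1/(qy) for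
    -- the phase, and v² ≤ 1/(qy) · 1/y for the Bessel remainder.
    rw [hmain, hdef, show Complex.exp (2 * Real.pi * Complex.I * (m * (θ : ℝ))) *
      ((√v : ℝ) : ℂ) * besselI (s - 1 / 2) (2 * Real.pi * m * v) - ((√v : ℝ) : ℂ) * lead =
      (Complex.exp (2 * Real.pi * Complex.I * (m * (θ : ℝ))) - 1) * (((√v : ℝ) : ℂ) * lead) +
      Complex.exp (2 * Real.pi * Complex.I * (m * (θ : ℝ))) * (((√v : ℝ) : ℂ) *
        (besselI (s - 1 / 2) (2 * Real.pi * m * v) - lead)) by ring]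
    refine (norm_add_le _ _).trans ?_
    rw [norm_mul, norm_mul (Complex.exp _), hphase, one_mul, norm_mul _ (_ - lead), hsq]
    have hvv : (Real.pi * m * v) ^ 2 ≤ (Real.pi * m) ^ 2 / y ^ 2 * q⁻¹ := by
      calc (Real.pi * m * v) ^ 2 = (Real.pi * m) ^ 2 * (v * v) := by ring
        _ ≤ (Real.pi * m) ^ 2 * (1 / (q * y) * (1 / y)) := by gcongr
        _ = _ := by field_simp
    have t1 : ‖Complex.exp (2 * Real.pi * Complex.I * (m * (θ : ℝ))) - 1‖ *
        ‖((√v : ℝ) : ℂ) * lead‖ ≤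
        (2 * (Real.pi * m) / y * q⁻¹) * (K₁ * K₂ * (q ^ (-s.re) * R ^ (-(3 / 4) : ℝ))) := by
      gcongr
    have t2 : √v * ‖besselI (s - 1 / 2) (2 * Real.pi * m * v) - lead‖ ≤
        K₁ * K₂ * (q ^ (-s.re) * R ^ (-(3 / 4) : ℝ)) *
          ((Real.pi * m) ^ 2 / y ^ 2 * q⁻¹ * E) := by
      calc _ ≤ √v * (‖(Complex.Gamma (s + 1 / 2))⁻¹‖ * (Real.pi * m * v) ^ (s.re - 1 / 2) *
            ((Real.pi * m * v) ^ 2 * Real.exp ((Real.pi * m * v) ^ 2))) := by gcongr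
        _ = √v * (‖(Complex.Gamma (s + 1 / 2))⁻¹‖ * (Real.pi * m * v) ^ (s.re - 1 / 2)) *
            ((Real.pi * m * v) ^ 2 * Real.exp ((Real.pi * m * v) ^ 2)) := by ring
        _ ≤ _ := by rw [hsize]; gcongr
    refine (add_le_add t1 t2).trans ?_
    calc _ = K₁ * K₂ * (2 * (Real.pi * m) / y + (Real.pi * m) ^ 2 / y ^ 2 * E) *
          (q ^ (-s.re - 1) * R ^ (-(3 / 4) : ℝ)) := by rw [hQ]; ring
      _ ≤ L * (q ^ (-s.re - 1) * R ^ (-(3 / 4) : ℝ)) := by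
          refine mul_le_mul_of_nonneg_right ?_ (by positivity)
          rw [hL]
          refine mul_le_mul_of_nonneg_left ?_ (by positivity)
          exact le_add_of_nonneg_left hE0.le
      _ = _ := by ring

/-- Lattice sums are bounded uniformly in the translation. -/
theorem exists_bound_lattice_sum {y : ℝ} (hy : 0 < y) :
    ∃ K : ℝ, 0 < K ∧ ∀ x : ℝ,
      Summable (fun n : ℤ => ((x + n) ^ 2 + y ^ 2) ^ (-(3 / 4) : ℝ)) ∧
      ∑' n : ℤ, ((x + n) ^ 2 + y ^ 2) ^ (-(3 / 4) : ℝ) ≤ K := by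
  -- κ is chosen so that 1 + n² ≤ κ((x + n)² + y²) for 0 ≤ x ≤ 1; this follows from 1 + n² ≤ 3 + 2(x
  -- + n)². A general x is then reduced to its fractional part by shifting n.
  set κ : ℝ := 3 / y ^ 2 + 2 with hκ
  have hκ0 : 0 < κ := by positivity
  have hsum : Summable fun n : ℤ => (1 + (n : ℝ) ^ 2) ^ (-(3 / 4) : ℝ) := by
    have h1 : Summable fun n : ℤ => |(n : ℝ)| ^ (-(3 / 2) : ℝ) :=
      Real.summable_abs_int_rpow (by norm_num)
    refine Summable.of_norm_bounded_eventually h1 ?_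
    rw [Filter.eventually_cofinite]
    refine (Set.finite_singleton (0 : ℤ)).subset fun n hn => ?_
    by_contra h0
    apply hn
    have hn0 : (0 : ℝ) < |(n : ℝ)| := by simpa using h0
    rw [Real.norm_of_nonneg (by positivity)]
    calc (1 + (n : ℝ) ^ 2) ^ (-(3 / 4) : ℝ) ≤ (|(n : ℝ)| ^ 2) ^ (-(3 / 4) : ℝ) :=
          Real.rpow_le_rpow_of_nonpos (by positivity) (by rw [sq_abs]; linarith) (by norm_num)
      _ = _ := by
          rw [← Real.rpow_natCast, ← Real.rpow_mul hn0.le]; norm_num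
  have hle : ∀ x : ℝ, 0 ≤ x → x ≤ 1 → ∀ n : ℤ, ((x + n) ^ 2 + y ^ 2) ^ (-(3 / 4) : ℝ) ≤
      κ ^ (3 / 4 : ℝ) * (1 + (n : ℝ) ^ 2) ^ (-(3 / 4) : ℝ) := by
    intro x h0 h1 n
    have h2 : (1 + (n : ℝ) ^ 2) / κ ≤ (x + n) ^ 2 + y ^ 2 := by
      rw [div_le_iff₀ hκ0, hκ]
      have e1 : ((x + n) ^ 2 + y ^ 2) * (3 / y ^ 2 + 2) =
          3 + 2 * (x + n) ^ 2 + (x + n) ^ 2 * (3 / y ^ 2) + 2 * y ^ 2 := by field_simp; ring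
      rw [e1]
      have e2 : 0 ≤ (x + n) ^ 2 * (3 / y ^ 2) := by positivity
      nlinarith [sq_nonneg (2 * x + n), sq_nonneg y]
    calc _ ≤ ((1 + (n : ℝ) ^ 2) / κ) ^ (-(3 / 4) : ℝ) :=
          Real.rpow_le_rpow_of_nonpos (by positivity) h2 (by norm_num)
      _ = _ := by
          rw [Real.div_rpow (by positivity) hκ0.le, Real.rpow_neg hκ0.le]
          field_simp
  have hunit : ∀ x : ℝ, 0 ≤ x → x ≤ 1 →
      Summable (fun n : ℤ => ((x + n) ^ 2 + y ^ 2) ^ (-(3 / 4) : ℝ)) ∧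
      ∑' n : ℤ, ((x + n) ^ 2 + y ^ 2) ^ (-(3 / 4) : ℝ) ≤
        κ ^ (3 / 4 : ℝ) * ∑' n : ℤ, (1 + (n : ℝ) ^ 2) ^ (-(3 / 4) : ℝ) := by
    intro x h0 h1
    have hs := Summable.of_nonneg_of_le (fun n => by positivity) (hle x h0 h1) (hsum.mul_left _)
    refine ⟨hs, ?_⟩
    rw [← tsum_mul_left]
    exact hs.tsum_le_tsum (hle x h0 h1) (hsum.mul_left _)
  refine ⟨κ ^ (3 / 4 : ℝ) * ∑' n : ℤ, (1 + (n : ℝ) ^ 2) ^ (-(3 / 4) : ℝ), ?_, fun x => ?_⟩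
  · refine mul_pos (by positivity) (hsum.tsum_pos (fun n => by positivity) 0 (by norm_num))
  · obtain ⟨h1, h2⟩ := hunit (Int.fract x) (Int.fract_nonneg x) (Int.fract_lt_one x).le
    have he : (fun n : ℤ => ((x + n) ^ 2 + y ^ 2) ^ (-(3 / 4) : ℝ)) =
        (fun n : ℤ => ((Int.fract x + n) ^ 2 + y ^ 2) ^ (-(3 / 4) : ℝ)) ∘
          (Equiv.addRight ⌊x⌋) := by
      funext n
      simp only [Function.comp_apply, Equiv.coe_addRight, Int.cast_add]
      congr 3
      linarith [Int.fract_add_floor x]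
    rw [he]
    refine ⟨(Equiv.summable_iff _).2 h1, ?_⟩
    rw [← Equiv.tsum_eq (Equiv.addRight ⌊x⌋)] at h2
    exact h2
end NieburPoincare
end

/-! ### Poisson summation and reduction to complete exponential sums. -/

noncomputable section
namespace NieburPoincare

open FourierTransform MeasureTheory

theorem integrable_sq_add_sq_rpow {y : ℝ} (hy : 0 < y) :
    Integrable fun t : ℝ => (t ^ 2 + y ^ 2) ^ (-(3 / 4) : ℝ) := by
  have h1 : Integrable fun t : ℝ => (1 + ‖t‖ ^ 2) ^ (-(3 / 2 : ℝ) / 2) :=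
    integrable_rpow_neg_one_add_norm_sq (by simp; norm_num)
  have hκ : 0 < 1 + 1 / y ^ 2 := by positivity
  refine (h1.const_mul ((1 + 1 / y ^ 2) ^ (3 / 4 : ℝ))).mono' ?_ (Filter.Eventually.of_forall ?_)
  · refine Continuous.aestronglyMeasurable ?_
    exact Continuous.rpow_const (by fun_prop) fun t => Or.inl (by positivity)
  · intro t
    rw [Real.norm_of_nonneg (by positivity)]
    have h2 : (1 + t ^ 2) / (1 + 1 / y ^ 2) ≤ t ^ 2 + y ^ 2 := by
      rw [div_le_iff₀ hκ]
      have : (t ^ 2 + y ^ 2) * (1 + 1 / y ^ 2) = t ^ 2 + y ^ 2 + t ^ 2 * (1 / y ^ 2) + 1 := by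
        field_simp
        ring
      rw [this]
      have : 0 ≤ t ^ 2 * (1 / y ^ 2) := by positivity
      nlinarith [sq_nonneg y]
    calc _ ≤ ((1 + t ^ 2) / (1 + 1 / y ^ 2)) ^ (-(3 / 4) : ℝ) :=
          Real.rpow_le_rpow_of_nonpos (by positivity) h2 (by norm_num)
      _ = (1 + 1 / y ^ 2) ^ (3 / 4 : ℝ) * (1 + t ^ 2) ^ (-(3 / 4) : ℝ) := by
          rw [Real.div_rpow (by positivity) hκ.le, Real.rpow_neg hκ.le]
          field_simp
      _ = _ := by
          rw [Real.norm_eq_abs, sq_abs]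
          norm_num

/-- Two derivatives give quadratic decay of the Fourier transform. -/
theorem norm_fourier_le_of_deriv {f f' f'' : ℝ → ℂ} {G : ℝ → ℝ} (hG : Integrable G)
    (hf : ∀ t, HasDerivAt f (f' t) t) (hf' : ∀ t, HasDerivAt f' (f'' t) t)
    (hc : Continuous f'') (h0 : ∀ t, ‖f t‖ ≤ G t) (h1 : ∀ t, ‖f' t‖ ≤ G t)
    (h2 : ∀ t, ‖f'' t‖ ≤ G t) (k : ℤ) :
    ‖𝓕 f (k : ℝ)‖ ≤ (∫ t, G t) * (if k = 0 then 1 else 1 / (k : ℝ) ^ 2) := by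
  have hd : Differentiable ℝ f := fun t => (hf t).differentiableAt
  have hd' : Differentiable ℝ f' := fun t => (hf' t).differentiableAt
  have e1 : deriv f = f' := funext fun t => (hf t).deriv
  have e2 : deriv f' = f'' := funext fun t => (hf' t).deriv
  have i0 : Integrable f :=
    hG.mono' hd.continuous.aestronglyMeasurable (Filter.Eventually.of_forall h0)
  have i1 : Integrable f' :=
    hG.mono' hd'.continuous.aestronglyMeasurable (Filter.Eventually.of_forall h1)
  have i2 : Integrable f'' :=
    hG.mono' hc.aestronglyMeasurable (Filter.Eventually.of_forall h2)
  have F1 := Real.fourier_deriv i0 hd (by rwa [e1])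
  have F2 := Real.fourier_deriv i1 hd' (by rwa [e2])
  rw [e1] at F1
  rw [e2] at F2
  have hle : ∀ g : ℝ → ℂ, (∀ t, ‖g t‖ ≤ G t) → ∀ w : ℝ, ‖𝓕 g w‖ ≤ ∫ t, G t := by
    intro g hg w
    rw [Real.fourier_eq]
    refine norm_integral_le_of_norm_le hG (Filter.Eventually.of_forall fun t => ?_)
    rw [Circle.norm_smul]
    exact hg t
  split_ifs with hk
  · rw [mul_one]; exact hle f h0 _
  · have hkR : (k : ℝ) ≠ 0 := by exact_mod_cast hk
    have hk2 : (0 : ℝ) < (k : ℝ) ^ 2 := by positivity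
    have h3 := hle f'' h2 k
    rw [F2] at h3
    simp only [] at h3
    rw [F1] at h3
    simp only [smul_eq_mul, norm_mul] at h3
    have hn : ‖(2 : ℂ)‖ * ‖(Real.pi : ℂ)‖ * ‖Complex.I‖ * ‖((k : ℝ) : ℂ)‖ =
        2 * Real.pi * |(k : ℝ)| := by
      rw [Complex.norm_real, Complex.norm_real, Complex.norm_I, Real.norm_eq_abs, Real.norm_eq_abs,
        abs_of_pos Real.pi_pos]
      simp
    rw [hn] at h3
    rw [mul_one_div, le_div_iff₀ hk2]
    refine le_trans ?_ h3
    have hpi : 1 ≤ (2 * Real.pi) ^ 2 := by nlinarith [Real.pi_gt_three]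
    calc ‖𝓕 f (k : ℝ)‖ * (k : ℝ) ^ 2 = 1 * (‖𝓕 f (k : ℝ)‖ * |(k : ℝ)| ^ 2) := by
          rw [sq_abs, one_mul]
      _ ≤ (2 * Real.pi) ^ 2 * (‖𝓕 f (k : ℝ)‖ * |(k : ℝ)| ^ 2) := by gcongr
      _ = _ := by ring

theorem hasDerivAt_sq_add_sq_cpow {y : ℝ} (hy : 0 < y) (s : ℂ) (t : ℝ) :
    HasDerivAt (fun t : ℝ => ((t ^ 2 + y ^ 2 : ℝ) : ℂ) ^ s)
      (s * ((t ^ 2 + y ^ 2 : ℝ) : ℂ) ^ (s - 1) * (2 * t : ℝ)) t := by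
  have h1 : HasDerivAt (fun t : ℝ => ((t ^ 2 + y ^ 2 : ℝ) : ℂ)) ((2 * t : ℝ) : ℂ) t := by
    have : HasDerivAt (fun t : ℝ => t ^ 2 + y ^ 2) (2 * t) t := by
      simpa using (hasDerivAt_pow 2 t).add_const (y ^ 2)
    exact this.ofReal_comp
  have h2 : HasDerivAt (fun z : ℂ => z ^ s) (s * ((t ^ 2 + y ^ 2 : ℝ) : ℂ) ^ (s - 1))
      ((t ^ 2 + y ^ 2 : ℝ) : ℂ) := by
    have hmem : ((t ^ 2 + y ^ 2 : ℝ) : ℂ) ∈ Complex.slitPlane :=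
      Or.inl (by rw [Complex.ofReal_re]; positivity)
    generalize ((t ^ 2 + y ^ 2 : ℝ) : ℂ) = w at hmem ⊢
    simpa using (hasDerivAt_id w).cpow_const (c := s) hmem
  exact h2.comp t h1

theorem summable_ite_one_div_sq :
    Summable fun k : ℤ => if k = 0 then (1 : ℝ) else 1 / (k : ℝ) ^ 2 := by
  have h := (Real.summable_one_div_int_pow (p := 2)).2 (by norm_num)
  refine (h.add (hasSum_ite_eq (0 : ℤ) (1 : ℝ)).summable).congr fun k => ?_
  split_ifs with hk <;> simp [hk]

/-- Poisson summation for `(t ^ 2 + y ^ 2) ^ (-s)`, with Fourier coefficients that are summable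
uniformly in `s`. -/
theorem exists_fourier_coeffs {y : ℝ} (hy : 0 < y) (A : ℝ) :
    ∃ K : ℝ, 0 < K ∧ ∀ s : ℂ, 3 / 4 ≤ s.re → ‖s‖ ≤ A → ∃ a : ℤ → ℂ,
      Summable (fun k => ‖a k‖) ∧ ∑' k, ‖a k‖ ≤ K ∧ ∀ x : ℝ,
        ∑' n : ℤ, (((x + n) ^ 2 + y ^ 2 : ℝ) : ℂ) ^ (-s) =
          ∑' k : ℤ, a k * fourier k (x : UnitAddCircle) := by
  obtain ⟨K, hK, hpow⟩ := rpow_neg_le_of_bounded hy A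
  have hA : ∀ s : ℂ, 3 / 4 ≤ s.re → ‖s‖ ≤ A → 0 < A := fun s h h' =>
    lt_of_lt_of_le (by linarith) ((Complex.re_le_norm s).trans h')
  have hB := summable_ite_one_div_sq
  -- The three summands bound f, f' and f'' relative to K(t² + y²)^(-3/4), by |2t|/(t² + y²) ≤ 1/y
  -- and 1/(t² + y²) ≤ 1/y². The absolute value keeps M positive before any s shows that A > 0.
  set M : ℝ := K * (1 + |A| / y + (2 * |A| + |A| * (|A| + 1)) / y ^ 2) with hM
  have hM0 : 0 < M := by positivity
  set G : ℝ → ℝ := fun t => M * (t ^ 2 + y ^ 2) ^ (-(3 / 4) : ℝ) with hGdef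
  have hG : Integrable G := (integrable_sq_add_sq_rpow hy).const_mul M
  have hGpos : 0 ≤ ∫ t, G t := integral_nonneg fun t => by positivity
  set T : ℝ := ∑' k : ℤ, (if k = 0 then (1 : ℝ) else 1 / (k : ℝ) ^ 2) with hT
  have hT0 : 0 ≤ T := tsum_nonneg fun k => by split_ifs <;> positivity
  refine ⟨(∫ t, G t) * T + 1, by positivity, fun s hs hsA => ?_⟩
  have hA0 := hA s hs hsA
  have hσA : s.re ≤ A := (Complex.re_le_norm s).trans hsA
  set f : ℝ → ℂ := fun t => ((t ^ 2 + y ^ 2 : ℝ) : ℂ) ^ (-s) with hf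
  set f' : ℝ → ℂ := fun t => -s * ((t ^ 2 + y ^ 2 : ℝ) : ℂ) ^ (-s - 1) * (2 * t : ℝ) with hf'
  set f'' : ℝ → ℂ := fun t => -s * ((-s - 1) * ((t ^ 2 + y ^ 2 : ℝ) : ℂ) ^ (-s - 1 - 1) *
    (2 * t : ℝ)) * (2 * t : ℝ) + -s * ((t ^ 2 + y ^ 2 : ℝ) : ℂ) ^ (-s - 1) * (2 : ℝ) with hf''
  have hpos : ∀ t : ℝ, 0 < t ^ 2 + y ^ 2 := fun t => by positivity
  have d1 : ∀ t, HasDerivAt f (f' t) t := fun t => hasDerivAt_sq_add_sq_cpow hy (-s) t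
  have d2 : ∀ t, HasDerivAt f' (f'' t) t := by
    intro t
    have h2t : HasDerivAt (fun t : ℝ => ((2 * t : ℝ) : ℂ)) ((2 : ℝ) : ℂ) t := by
      have : HasDerivAt (fun t : ℝ => 2 * t) 2 t := by simpa using (hasDerivAt_id t).const_mul 2
      exact this.ofReal_comp
    exact ((hasDerivAt_sq_add_sq_cpow hy (-s - 1) t).const_mul (-s)).mul h2t
  have hcont : ∀ w : ℂ, Continuous fun t : ℝ => ((t ^ 2 + y ^ 2 : ℝ) : ℂ) ^ w := fun w =>
    continuous_iff_continuousAt.2 fun t => (hasDerivAt_sq_add_sq_cpow hy w t).continuousAt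
  have hc2 : Continuous f'' := by
    have := hcont (-s - 1 - 1)
    have := hcont (-s - 1)
    fun_prop
  have hnorm : ∀ (t : ℝ) (w : ℂ), ‖((t ^ 2 + y ^ 2 : ℝ) : ℂ) ^ w‖ = (t ^ 2 + y ^ 2) ^ w.re :=
    fun t w => Complex.norm_cpow_eq_rpow_re_of_pos (hpos t) w
  have hle0 : ∀ t : ℝ, (t ^ 2 + y ^ 2) ^ (-s.re) ≤ K * (t ^ 2 + y ^ 2) ^ (-(3 / 4) : ℝ) :=
    fun t => hpow _ hs hσA t
  have hQ1 : ∀ t : ℝ, (t ^ 2 + y ^ 2) ^ (-s - 1).re =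
      (t ^ 2 + y ^ 2) ^ (-s.re) * (t ^ 2 + y ^ 2)⁻¹ := by
    intro t
    rw [← Real.rpow_neg_one (t ^ 2 + y ^ 2), ← Real.rpow_add (hpos t)]
    congr 1
  have hQ2 : ∀ t : ℝ, (t ^ 2 + y ^ 2) ^ (-s - 1 - 1).re =
      (t ^ 2 + y ^ 2) ^ (-s.re) * ((t ^ 2 + y ^ 2)⁻¹ * (t ^ 2 + y ^ 2)⁻¹) := by
    intro t
    rw [← Real.rpow_neg_one (t ^ 2 + y ^ 2), ← Real.rpow_add (hpos t), ← Real.rpow_add (hpos t)]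
    congr 1; simp; ring
  have ht1 : ∀ t : ℝ, |2 * t| * (t ^ 2 + y ^ 2)⁻¹ ≤ 1 / y := by
    intro t
    rw [← div_eq_mul_inv, div_le_div_iff₀ (hpos t) hy, abs_mul, abs_two]
    nlinarith [sq_nonneg (|t| - y), sq_abs t]
  have hi1 : ∀ t : ℝ, (t ^ 2 + y ^ 2)⁻¹ ≤ 1 / y ^ 2 := by
    intro t
    rw [inv_eq_one_div]
    gcongr
    nlinarith [sq_nonneg t]
  have hAabs : |A| = A := abs_of_pos hA0
  have b0 : ∀ t, ‖f t‖ ≤ G t := by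
    intro t
    simp only [hf, hGdef, hnorm]
    refine (hle0 t).trans ?_
    gcongr
    rw [hM]
    refine le_mul_of_one_le_right hK.le ?_
    rw [add_assoc]
    exact le_add_of_nonneg_right (by positivity)
  have b1 : ∀ t, ‖f' t‖ ≤ G t := by
    intro t
    simp only [hf', hGdef, norm_mul, hnorm, norm_neg, Complex.norm_real, Real.norm_eq_abs, hQ1,
      ← abs_mul]
    calc ‖s‖ * ((t ^ 2 + y ^ 2) ^ (-s.re) * (t ^ 2 + y ^ 2)⁻¹) * |2 * t|
        = ‖s‖ * (t ^ 2 + y ^ 2) ^ (-s.re) * (|2 * t| * (t ^ 2 + y ^ 2)⁻¹) := by ring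
      _ ≤ A * (K * (t ^ 2 + y ^ 2) ^ (-(3 / 4) : ℝ)) * (1 / y) := by
          gcongr
          · exact hle0 t
          · exact ht1 t
      _ = K * (|A| / y) * (t ^ 2 + y ^ 2) ^ (-(3 / 4) : ℝ) := by rw [hAabs]; ring
      _ ≤ _ := by
          refine mul_le_mul_of_nonneg_right ?_ (by positivity)
          rw [hM]
          refine mul_le_mul_of_nonneg_left ?_ hK.le
          have : 0 ≤ (2 * |A| + |A| * (|A| + 1)) / y ^ 2 := by positivity
          linarith
  have b2 : ∀ t, ‖f'' t‖ ≤ G t := by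
    intro t
    have hs1 : ‖-s - 1‖ ≤ A + 1 := by
      rw [← neg_add', norm_neg]; exact (norm_add_le _ _).trans (by simpa using hsA)
    refine (norm_add_le _ _).trans ?_
    simp only [hGdef, norm_mul, hnorm, norm_neg, Complex.norm_real, Real.norm_eq_abs, hQ1, hQ2,
      ← abs_mul]
    have p1 : ‖s‖ * (‖-s - 1‖ * ((t ^ 2 + y ^ 2) ^ (-s.re) *
        ((t ^ 2 + y ^ 2)⁻¹ * (t ^ 2 + y ^ 2)⁻¹)) * |2 * t|) * |2 * t| ≤
        A * (A + 1) * (K * (t ^ 2 + y ^ 2) ^ (-(3 / 4) : ℝ)) * (1 / y * (1 / y)) := by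
      calc _ = ‖s‖ * ‖-s - 1‖ * (t ^ 2 + y ^ 2) ^ (-s.re) *
            ((|2 * t| * (t ^ 2 + y ^ 2)⁻¹) * (|2 * t| * (t ^ 2 + y ^ 2)⁻¹)) := by ring
        _ ≤ _ := by
          gcongr
          · exact hle0 t
          · exact ht1 t
          · exact ht1 t
    have p2 : ‖s‖ * ((t ^ 2 + y ^ 2) ^ (-s.re) * (t ^ 2 + y ^ 2)⁻¹) * |(2 : ℝ)| ≤
        A * (K * (t ^ 2 + y ^ 2) ^ (-(3 / 4) : ℝ) * (1 / y ^ 2)) * 2 := by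
      rw [abs_two]
      gcongr
      · exact hle0 t
      · exact hi1 t
    refine (add_le_add p1 p2).trans ?_
    calc _ = K * ((2 * |A| + |A| * (|A| + 1)) / y ^ 2) * (t ^ 2 + y ^ 2) ^ (-(3 / 4) : ℝ) := by
          rw [hAabs]; field_simp; ring
      _ ≤ _ := by
          refine mul_le_mul_of_nonneg_right ?_ (by positivity)
          rw [hM]
          refine mul_le_mul_of_nonneg_left ?_ hK.le
          have : 0 ≤ |A| / y := by positivity
          linarith
  have hF : ∀ k : ℤ, ‖𝓕 f (k : ℝ)‖ ≤
      (∫ t, G t) * (if k = 0 then (1 : ℝ) else 1 / (k : ℝ) ^ 2) :=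
    norm_fourier_le_of_deriv hG d1 d2 hc2 b0 b1 b2
  have hFs : Summable fun k : ℤ => ‖𝓕 f (k : ℝ)‖ :=
    Summable.of_nonneg_of_le (fun _ => norm_nonneg _) hF (hB.mul_left _)
  refine ⟨fun k => 𝓕 f (k : ℝ), hFs, ?_, fun x => ?_⟩
  · refine (hFs.tsum_le_tsum hF (hB.mul_left _)).trans ?_
    rw [tsum_mul_left]
    linarith
  · refine Real.tsum_eq_tsum_fourier_of_rpow_decay_of_summable (f := f) (hcont (-s))
      (b := 3 / 2) (by norm_num) ?_ hFs.of_norm x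
    refine Asymptotics.IsBigO.of_bound M ?_
    have : ∀ᶠ t : ℝ in Filter.cocompact ℝ, t ≠ 0 := by
      simpa using (isCompact_singleton (x := (0 : ℝ))).compl_mem_cocompact
    filter_upwards [this] with t ht
    refine (b0 t).trans ?_
    simp only [hGdef]
    gcongr
    have ht0 : 0 < |t| := abs_pos.2 ht
    rw [Real.norm_of_nonneg (by positivity)]
    calc _ ≤ (|t| ^ 2) ^ (-(3 / 4) : ℝ) :=
          Real.rpow_le_rpow_of_nonpos (by positivity) (by rw [sq_abs]; nlinarith [sq_nonneg y])
            (by norm_num)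
      _ = _ := by rw [← Real.rpow_natCast, ← Real.rpow_mul ht0.le]; norm_num

/-- Exponential sums over units weighted by a lattice sum, in terms of complete sums. -/
theorem exists_bound_weighted_lattice_sum {y : ℝ} (hy : 0 < y) (A : ℝ) :
    ∃ K : ℝ, 0 < K ∧ ∀ s : ℂ, 3 / 4 ≤ s.re → ‖s‖ ≤ A → ∀ (C : ℕ) [NeZero C]
      (χ : (ZMod C)ˣ → ℂ) (S : ℝ),
      (∀ k : ZMod C, ‖∑ u, χ u * ZMod.stdAddChar (k * (u : ZMod C))‖ ≤ S) → ∀ x : ℝ,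
      ‖∑ u, χ u * ∑' n : ℤ, (((x + (u : ZMod C).val / C + n) ^ 2 + y ^ 2 : ℝ) : ℂ) ^ (-s)‖ ≤
        K * S := by
  obtain ⟨K, hK, h⟩ := exists_fourier_coeffs hy A
  refine ⟨K, hK, fun s hs hsA C _ χ S hS x => ?_⟩
  obtain ⟨a, ha, haK, hP⟩ := h s hs hsA
  have hS0 : 0 ≤ S := (norm_nonneg _).trans (hS 0)
  -- At x + u/C the k-th harmonic splits into e(kx) e(ku/C), so the sum over u becomes an
  -- exponential sum of frequency k modulo C, bounded by S uniformly in k.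
  have hf : ∀ (k : ℤ) (u : (ZMod C)ˣ), fourier k ((x + (u : ZMod C).val / C : ℝ) : UnitAddCircle) =
      fourier k (x : UnitAddCircle) * ZMod.stdAddChar ((k : ZMod C) * (u : ZMod C)) := by
    intro k u
    have hC : (C : ℂ) ≠ 0 := by exact_mod_cast NeZero.ne C
    have : (k : ZMod C) * (u : ZMod C) = ((k * ((u : ZMod C).val : ℤ) : ℤ) : ZMod C) := by
      simp
    rw [this, ZMod.stdAddChar_coe, fourier_coe_apply, fourier_coe_apply, ← Complex.exp_add]
    congr 1
    push_cast
    generalize (((u : ZMod C).val : ℕ) : ℂ) = w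
    field_simp
  have hfn : ∀ k : ℤ, ‖fourier k (x : UnitAddCircle)‖ = 1 := fun k => Circle.norm_coe _
  have hterm : ∀ u : (ZMod C)ˣ, Summable fun k : ℤ =>
      χ u * (a k * fourier k ((x + (u : ZMod C).val / C : ℝ) : UnitAddCircle)) := by
    intro u
    refine Summable.mul_left _ (Summable.of_norm ?_)
    refine ha.congr fun k => ?_
    rw [norm_mul]
    have : ‖fourier k ((x + (u : ZMod C).val / C : ℝ) : UnitAddCircle)‖ = 1 := Circle.norm_coe _
    rw [this, mul_one]
  have : ∑ u, χ u * ∑' n : ℤ, (((x + (u : ZMod C).val / C + n) ^ 2 + y ^ 2 : ℝ) : ℂ) ^ (-s) =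
      ∑' k : ℤ, a k * fourier k (x : UnitAddCircle) *
        ∑ u, χ u * ZMod.stdAddChar ((k : ZMod C) * (u : ZMod C)) := by
    calc _ = ∑ u, ∑' k : ℤ,
          χ u * (a k * fourier k ((x + (u : ZMod C).val / C : ℝ) : UnitAddCircle)) := by
          refine Finset.sum_congr rfl fun u _ => ?_
          rw [hP, tsum_mul_left]
      _ = ∑' k : ℤ, ∑ u,
          χ u * (a k * fourier k ((x + (u : ZMod C).val / C : ℝ) : UnitAddCircle)) :=
          (Summable.tsum_finsetSum fun u _ => hterm u).symm
      _ = _ := by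
          refine tsum_congr fun k => ?_
          rw [Finset.mul_sum]
          refine Finset.sum_congr rfl fun u _ => ?_
          rw [hf]; ring
  rw [this]
  refine (tsum_of_norm_bounded (ha.mul_right S).hasSum fun k => ?_).trans ?_
  · rw [norm_mul, norm_mul, hfn, mul_one]
    gcongr
    exact hS _
  · rw [tsum_mul_right]
    gcongr
end NieburPoincare
end

/-! ### Analytic continuation to a neighbourhood of s = 1. -/

noncomputable section
namespace NieburPoincare

open MeasureTheory

namespace LevelPair

variable {N : ℕ} (p : LevelPair N)

/-- The character sum weights attached to `(e, C)`. -/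
def weight (m : ℕ) (u : (ZMod p.1.2)ˣ) : ℂ :=
  ZMod.stdAddChar (p.twist m * ((u⁻¹ : (ZMod p.1.2)ˣ) : ZMod p.1.2))

theorem norm_weight (m : ℕ) (u : (ZMod p.1.2)ˣ) : ‖p.weight m u‖ = 1 := by
  rw [weight]; exact Circle.norm_coe _

/-- The factor `e * C ^ 2`. -/
def conductor : ℝ := p.1.1 * p.1.2 ^ 2

theorem C_ge_one : (1 : ℝ) ≤ p.1.2 := by exact_mod_cast p.2.2.1

theorem sq_le_conductor : (p.1.2 : ℝ) ^ 2 ≤ p.conductor := by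
  have : (1 : ℝ) ≤ p.1.1 := by exact_mod_cast p.e_pos
  exact le_mul_of_one_le_left (by positivity) this

theorem one_le_conductor : 1 ≤ p.conductor :=
  le_trans (by nlinarith [p.C_ge_one]) p.sq_le_conductor

theorem conductor_rpow_le {σ : ℝ} (hσ : 0 ≤ σ) : p.conductor ^ (-σ) ≤ (p.1.2 : ℝ) ^ (-2 * σ) := by
  have hC := p.C_ge_one
  calc p.conductor ^ (-σ) ≤ ((p.1.2 : ℝ) ^ 2) ^ (-σ) :=
        Real.rpow_le_rpow_of_nonpos (by positivity) p.sq_le_conductor (by linarith)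
    _ = _ := by
        rw [← Real.rpow_natCast, ← Real.rpow_mul (by positivity)]
        congr 1; push_cast; ring

/-- The contribution of `(e, C)` to the Niebur-Poincaré series. -/
def levelSum (m : ℕ) (s : ℂ) (y x : ℝ) : ℂ :=
  ∑ u : (ZMod p.1.2)ˣ, p.weight m u *
    ∑' n : ℤ, invSeed m s p.conductor y (x + (u : ZMod p.1.2).val / p.1.2 + n)

/-- The twist is -m times a unit, so its annihilator is that of m; the constant in the Kloosterman
bound is thereby independent of C. -/
theorem annihilatorCard_twist_le {m : ℕ} (hm : 0 < m) : annihilatorCard (p.twist m) ≤ m := by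
  refine le_trans (le_of_eq ?_) (annihilatorCard_natCast_le (n := p.1.2) hm)
  unfold annihilatorCard
  congr 1
  refine Finset.filter_congr fun x _ => ?_
  rw [twist, mul_right_comm, Units.mul_left_eq_zero, neg_mul, neg_eq_zero]

theorem sum_weight_mul_stdAddChar (m : ℕ) (k : ZMod p.1.2) :
    ∑ u, p.weight m u * ZMod.stdAddChar (k * (u : ZMod p.1.2)) = kloosterman (p.twist m) k := by
  refine Finset.sum_congr rfl fun u _ => ?_
  rw [weight, ← AddChar.map_add_eq_mul]

theorem card_units_le : (Fintype.card (ZMod p.1.2)ˣ : ℝ) ≤ p.1.2 := by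
  rw [ZMod.card_units_eq_totient]
  exact_mod_cast Nat.totient_le _

end LevelPair

/-- The estimate without cancellation, sufficient for absolute convergence when Re s > 1 and for a
single pair (e, C) at s = 1. -/
theorem exists_bound_tsum_invSeed {m : ℕ} (hm : 0 < m) {y : ℝ} (hy : 0 < y) (A : ℝ) :
    ∃ K : ℝ, 0 < K ∧ ∀ s : ℂ, 3 / 4 ≤ s.re → ‖s‖ ≤ A → ∀ q : ℝ, 1 ≤ q → ∀ x : ℝ,
      Summable (fun n : ℤ => ‖invSeed m s q y (x + n)‖) ∧
      ∑' n : ℤ, ‖invSeed m s q y (x + n)‖ ≤ K * q ^ (-s.re) := by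
  obtain ⟨K₁, hK₁, h₁⟩ := exists_bound_invSeed hm hy A
  obtain ⟨K₂, hK₂, h₂⟩ := exists_bound_lattice_sum hy
  refine ⟨K₁ * K₂, by positivity, fun s hs hsA q hq x => ?_⟩
  have hb := fun n : ℤ => (h₁ s hs hsA q hq (x + n)).1
  have hS := (h₂ x).1.mul_left (K₁ * q ^ (-s.re))
  have hsum := Summable.of_nonneg_of_le (fun _ => norm_nonneg _) hb hS
  refine ⟨hsum, (hsum.tsum_le_tsum hb hS).trans ?_⟩
  rw [tsum_mul_left]
  have hq0 : 0 < q := by linarith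
  calc _ ≤ K₁ * q ^ (-s.re) * K₂ := by gcongr; exact (h₂ x).2
    _ = _ := by ring

/-- The leading terms give C^(-2 Re s) times a Kloosterman bound C^(15/16), and -2 · 63/64 + 15/16 =
-33/32 < -1. The remainder is estimated trivially: C units times C^(-2(Re s + 1)), which is smaller
still. Since 63/64 < 1, the region contains a neighbourhood of s = 1 once ‖s‖ ≤ A is arranged with A
> 1. -/
theorem exists_bound_levelSum {N m : ℕ} (hm : 0 < m) {y : ℝ} (hy : 0 < y) (A : ℝ) :
    ∃ K : ℝ, 0 < K ∧ ∀ s : ℂ, 63 / 64 ≤ s.re → ‖s‖ ≤ A → ∀ (p : LevelPair N) (x : ℝ),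
      ‖p.levelSum m s y x‖ ≤ K * (p.1.2 : ℝ) ^ (-(33 / 32) : ℝ) := by
  obtain ⟨K₁, hK₁, h₁⟩ := exists_bound_invSeed hm hy A
  obtain ⟨K₂, hK₂, h₂⟩ := exists_bound_lattice_sum hy
  obtain ⟨K₃, hK₃, h₃⟩ := exists_bound_weighted_lattice_sum hy A
  obtain ⟨K₄, hK₄, h₄⟩ := exists_bound_leadCoeff hm hy A
  set K₅ : ℝ := (2 * m * 256 ^ 12 : ℝ) ^ (1 / 4 : ℝ) with hK₅
  have hm' : (0 : ℝ) < m := by exact_mod_cast hm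
  have hK₅0 : 0 < K₅ := by positivity
  refine ⟨K₄ * (K₃ * K₅) + K₁ * K₂, by positivity, fun s hs hsA p x => ?_⟩
  have hs' : 3 / 4 ≤ s.re := by linarith
  have hq := p.one_le_conductor
  have hq0 : 0 < p.conductor := by linarith
  have hC1 := p.C_ge_one
  have hC0 : (0 : ℝ) < p.1.2 := by linarith
  set h : ℝ → ℂ := fun t => ((t ^ 2 + y ^ 2 : ℝ) : ℂ) ^ (-s) with hh
  set lead : ℂ := leadCoeff m y s * (p.conductor : ℂ) ^ (-s) with hlead
  have hdiff : ∀ (x' : ℝ), ‖invSeed m s p.conductor y x' - lead * h x'‖ ≤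
      K₁ * p.conductor ^ (-s.re - 1) * (x' ^ 2 + y ^ 2) ^ (-(3 / 4) : ℝ) := by
    intro x'
    have := (h₁ s hs' hsA p.conductor hq x').2
    rwa [← mul_assoc] at this
  have hsumdiff : ∀ x' : ℝ, Summable fun n : ℤ =>
      invSeed m s p.conductor y (x' + n) - lead * h (x' + n) := fun x' =>
    Summable.of_norm_bounded ((h₂ x').1.mul_left _) fun n => hdiff _
  have hsumS : ∀ x' : ℝ, Summable fun n : ℤ => invSeed m s p.conductor y (x' + n) := fun x' =>
    Summable.of_norm_bounded ((h₂ x').1.mul_left _)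
      fun n => (h₁ s hs' hsA p.conductor hq (x' + n)).1
  have hsplit : p.levelSum m s y x =
      lead * (∑ u, p.weight m u *
        ∑' n : ℤ, h (x + (u : ZMod p.1.2).val / p.1.2 + n)) +
      ∑ u, p.weight m u * ∑' n : ℤ, (invSeed m s p.conductor y
        (x + (u : ZMod p.1.2).val / p.1.2 + n) -
          lead * h (x + (u : ZMod p.1.2).val / p.1.2 + n)) := by
    rw [LevelPair.levelSum, Finset.mul_sum, ← Finset.sum_add_distrib]
    refine Finset.sum_congr rfl fun u _ => ?_
    set x' := x + (u : ZMod p.1.2).val / p.1.2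
    have hl : Summable fun n : ℤ => lead * h (x' + n) :=
      ((hsumS x').sub (hsumdiff x')).congr fun n => by simp
    rw [(hsumS x').tsum_sub hl, tsum_mul_left]
    ring
  have hlead' : ‖lead‖ ≤ K₄ * (p.1.2 : ℝ) ^ (-2 * s.re) := by
    rw [hlead, norm_mul, Complex.norm_cpow_eq_rpow_re_of_pos hq0]
    gcongr
    · exact h₄ s hsA
    · exact p.conductor_rpow_le (by linarith)
  have hmain := h₃ s hs' hsA p.1.2 (p.weight m) (K₅ * (p.1.2 : ℝ) ^ (15 / 16 : ℝ)) (fun k => by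
    rw [p.sum_weight_mul_stdAddChar]
    exact norm_kloosterman_le _ _ (p.annihilatorCard_twist_le hm)) x
  have hrest : ‖∑ u, p.weight m u * ∑' n : ℤ, (invSeed m s p.conductor y
        (x + (u : ZMod p.1.2).val / p.1.2 + n) -
          lead * h (x + (u : ZMod p.1.2).val / p.1.2 + n))‖ ≤
      p.1.2 * (K₁ * p.conductor ^ (-s.re - 1) * K₂) := by
    refine (norm_sum_le _ _).trans ?_
    calc _ ≤ ∑ _u : (ZMod p.1.2)ˣ, K₁ * p.conductor ^ (-s.re - 1) * K₂ := by
          refine Finset.sum_le_sum fun u _ => ?_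
          rw [norm_mul, p.norm_weight, one_mul]
          refine (tsum_of_norm_bounded ((h₂ _).1.mul_left _).hasSum fun n => hdiff _).trans ?_
          rw [tsum_mul_left]
          gcongr
          exact (h₂ _).2
      _ = Fintype.card (ZMod p.1.2)ˣ * (K₁ * p.conductor ^ (-s.re - 1) * K₂) := by simp
      _ ≤ _ := mul_le_mul_of_nonneg_right p.card_units_le (by positivity)
  rw [hsplit]
  refine (norm_add_le _ _).trans ?_
  rw [norm_mul, add_mul]
  refine add_le_add ?_ (hrest.trans ?_)
  · calc _ ≤ K₄ * (p.1.2 : ℝ) ^ (-2 * s.re) * (K₃ * (K₅ * (p.1.2 : ℝ) ^ (15 / 16 : ℝ))) := by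
          gcongr
      _ = K₄ * (K₃ * K₅) * ((p.1.2 : ℝ) ^ (-2 * s.re) * (p.1.2 : ℝ) ^ (15 / 16 : ℝ)) := by ring
      _ = K₄ * (K₃ * K₅) * (p.1.2 : ℝ) ^ (-2 * s.re + 15 / 16) := by rw [Real.rpow_add hC0]
      _ ≤ _ := by gcongr; linarith
  · have hcond : p.conductor ^ (-s.re - 1) ≤ (p.1.2 : ℝ) ^ (-2 * (s.re + 1)) := by
      rw [← neg_add']
      exact p.conductor_rpow_le (by linarith)
    calc _ ≤ p.1.2 * (K₁ * (p.1.2 : ℝ) ^ (-2 * (s.re + 1)) * K₂) := by gcongr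
      _ = K₁ * K₂ * ((p.1.2 : ℝ) ^ (-2 * (s.re + 1)) * (p.1.2 : ℝ) ^ (1 : ℝ)) := by
          rw [Real.rpow_one]; ring
      _ = K₁ * K₂ * (p.1.2 : ℝ) ^ (-2 * (s.re + 1) + 1) := by rw [Real.rpow_add hC0]
      _ ≤ _ := by gcongr; linarith

theorem summable_levelPair (N : ℕ) {r : ℝ} (hr : 1 < r) :
    Summable fun p : LevelPair N => (p.1.2 : ℝ) ^ (-r) := by
  have h1 : Summable fun n : ℕ => (n : ℝ) ^ (-r) := Real.summable_nat_rpow.2 (by linarith)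
  have h2 : Summable fun x : exactDivisors N × ℕ => (x.2 : ℝ) ^ (-r) := by
    rw [summable_prod_of_nonneg (fun x => by positivity)]
    exact ⟨fun _ => h1, Summable.of_finite⟩
  exact h2.comp_injective (i := fun p : LevelPair N => (⟨p.1.1, p.2.1⟩, p.1.2)) fun p q h => by
    simp only [Prod.mk.injEq, Subtype.mk.injEq] at h
    exact Subtype.ext (Prod.ext h.1 h.2)

theorem differentiableAt_levelSum {N m : ℕ} (hm : 0 < m) {y : ℝ} (hy : 0 < y) (p : LevelPair N)
    (x : ℝ) {s₀ : ℂ} (hs₀ : 3 / 4 < s₀.re) :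
    DifferentiableAt ℂ (fun s => p.levelSum m s y x) s₀ := by
  set A : ℝ := ‖s₀‖ + 1 with hA
  obtain ⟨K₁, hK₁, h₁⟩ := exists_bound_invSeed hm hy A
  obtain ⟨K₂, hK₂, h₂⟩ := exists_bound_lattice_sum hy
  have hq := p.one_le_conductor
  set U : Set ℂ := Metric.ball 0 A ∩ {s | 3 / 4 < s.re} with hU
  have hUo : IsOpen U := Metric.isOpen_ball.inter (isOpen_lt continuous_const Complex.continuous_re)
  have hmem : s₀ ∈ U := ⟨by simp [hA], hs₀⟩
  refine DifferentiableAt.fun_sum fun u _ => DifferentiableAt.const_mul ?_ _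
  refine DifferentiableOn.differentiableAt (s := U) ?_ (hUo.mem_nhds hmem)
  refine Complex.differentiableOn_tsum_of_summable_norm
    ((h₂ (x + (u : ZMod p.1.2).val / p.1.2)).1.mul_left K₁) (fun n => ?_) hUo
    fun n s hs => ?_
  · intro s hs
    exact (differentiableAt_invSeed hm (by linarith) hy _
      (by have : 3 / 4 < s.re := hs.2; linarith)).differentiableWithinAt
  · have hs1 : 3 / 4 < s.re := hs.2
    refine (h₁ s hs1.le (by simpa using (mem_ball_zero_iff.1 hs.1).le) p.conductor hq _).1.trans ?_
    gcongr
    refine mul_le_of_le_one_right hK₁.le ?_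
    exact Real.rpow_le_one_of_one_le_of_nonpos hq (by linarith)

/-- The analytic continuation of the Niebur-Poincaré series. -/
def continuation (N m : ℕ) (z : ℍ) (s : ℂ) : ℂ :=
  seed m s z + ∑' p : LevelPair N, p.levelSum m s z.im z.re

/-- Grouping by (e, C) is essential: the cancellation among the u is what makes the majorant
C^(-33/32) available. A uniformly convergent sum of holomorphic functions is holomorphic. -/
theorem analyticAt_continuation (N : ℕ) {m : ℕ} (hm : 0 < m) (z : ℍ) :
    AnalyticAt ℂ (continuation N m z) 1 := by
  have hy := z.im_pos
  obtain ⟨K, hK, hb⟩ := exists_bound_levelSum (N := N) hm hy 2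
  set U : Set ℂ := Metric.ball 0 2 ∩ {s | 63 / 64 < s.re} with hU
  have hUo : IsOpen U := Metric.isOpen_ball.inter (isOpen_lt continuous_const Complex.continuous_re)
  have hmem : (1 : ℂ) ∈ U := ⟨by simp, by simp; norm_num⟩
  have hm' : (0 : ℝ) < m := by exact_mod_cast hm
  refine DifferentiableOn.analyticAt (s := U) ?_ (hUo.mem_nhds hmem)
  refine DifferentiableOn.add ?_ ?_
  · intro s hs
    have hs1 : 63 / 64 < s.re := hs.2
    exact ((differentiableAt_besselI (by positivity) (by linarith)).const_mul
      _).differentiableWithinAt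
  · refine Complex.differentiableOn_tsum_of_summable_norm
      ((summable_levelPair N (r := 33 / 32) (by norm_num)).mul_left K) (fun p => ?_) hUo
      fun p s hs => ?_
    · intro s hs
      exact (differentiableAt_levelSum hm hy p _
        (by have : 63 / 64 < s.re := hs.2; linarith)).differentiableWithinAt
    · exact hb s (le_of_lt hs.2) (by simpa using (mem_ball_zero_iff.1 hs.1).le) p _

/-- Each (e, C) contributes in absolute value at most φ(C) C^(-2 Re s), up to a constant, which is
summable for Re s > 1; the sum may then be taken iteratively. -/
theorem hasSum_continuation {N : ℕ} (hN : 0 < N) {m : ℕ} (hm : 0 < m) (z : ℍ) {s : ℂ}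
    (hs : 1 < s.re) :
    HasSum (fun M : Cosets (Gamma0Star N) => seed m s ((M.out : SL(2, ℝ)) • z))
      (continuation N m z s) := by
  have hy := z.im_pos
  obtain ⟨K, hK, hb⟩ := exists_bound_tsum_invSeed hm hy ‖s‖
  have hs' : 3 / 4 ≤ s.re := by linarith
  rw [hasSum_cosets_iff hN, continuation, add_sub_cancel_left]
  set f : (Σ p : LevelPair N, (ZMod p.1.2)ˣ × ℤ) → ℂ := fun i =>
    i.1.weight m i.2.1 * invSeed m s i.1.conductor z.im
          (z.re + (i.2.1 : ZMod i.1.1.2).val / i.1.1.2 + i.2.2) with hf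
  change HasSum f _
  have hbn := fun (p : LevelPair N) (x : ℝ) => hb s hs' le_rfl p.conductor p.one_le_conductor x
  have hin : ∀ p : LevelPair N, Summable fun i : (ZMod p.1.2)ˣ × ℤ => ‖f ⟨p, i⟩‖ := by
    intro p
    rw [summable_prod_of_nonneg (fun x => norm_nonneg _)]
    refine ⟨fun u => ?_, Summable.of_finite⟩
    refine (hbn p (z.re + (u : ZMod p.1.2).val / p.1.2)).1.congr fun n => ?_
    simp only [hf, norm_mul, p.norm_weight, one_mul]
  have hle : ∀ p : LevelPair N, ∑' i : (ZMod p.1.2)ˣ × ℤ, ‖f ⟨p, i⟩‖ ≤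
      K * (p.1.2 : ℝ) ^ (-(2 * s.re - 1)) := by
    intro p
    have hC0 : (0 : ℝ) < p.1.2 := by linarith [p.C_ge_one]
    have hq0 : 0 < p.conductor := by linarith [p.one_le_conductor]
    rw [(hin p).tsum_prod, tsum_fintype]
    calc _ ≤ ∑ _u : (ZMod p.1.2)ˣ, K * p.conductor ^ (-s.re) := by
          refine Finset.sum_le_sum fun u _ => ?_
          refine le_trans (le_of_eq ?_) (hbn p (z.re + (u : ZMod p.1.2).val / p.1.2)).2
          refine tsum_congr fun n => ?_
          simp only [hf, norm_mul, p.norm_weight, one_mul]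
      _ = Fintype.card (ZMod p.1.2)ˣ * (K * p.conductor ^ (-s.re)) := by simp
      _ ≤ p.1.2 * (K * (p.1.2 : ℝ) ^ (-2 * s.re)) := by
          refine mul_le_mul p.card_units_le ?_ (by positivity) (by positivity)
          gcongr
          exact p.conductor_rpow_le (by linarith)
      _ = K * ((p.1.2 : ℝ) ^ (-2 * s.re) * (p.1.2 : ℝ) ^ (1 : ℝ)) := by rw [Real.rpow_one]; ring
      _ = _ := by rw [← Real.rpow_add hC0]; congr 2; ring
  have hsum : Summable fun i => ‖f i‖ := by
    rw [summable_sigma_of_nonneg (fun _ => norm_nonneg _)]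
    refine ⟨hin, Summable.of_nonneg_of_le (fun p => tsum_nonneg fun _ => norm_nonneg _) hle ?_⟩
    exact (summable_levelPair N (by linarith)).mul_left K
  have hfs : Summable f := hsum.of_norm
  convert hfs.hasSum using 1
  rw [hfs.tsum_sigma]
  refine tsum_congr fun p => ?_
  rw [(hin p).of_norm.tsum_prod, tsum_fintype, LevelPair.levelSum]
  refine Finset.sum_congr rfl fun u _ => ?_
  rw [← tsum_mul_left]

theorem isNieburPoincare_continuation {N : ℕ} (hN : 0 < N) {m : ℕ} (hm : 0 < m) :
    IsNieburPoincare N m (continuation N m) :=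
  ⟨fun z _ hs => hasSum_continuation hN hm z hs, fun z => analyticAt_continuation N hm z⟩

/-- The value at `s = 1` of a Niebur-Poincaré series is determined by the series. -/
theorem IsNieburPoincare.apply_one_eq {N m : ℕ} {F G : ℍ → ℂ → ℂ} (hF : IsNieburPoincare N m F)
    (hG : IsNieburPoincare N m G) (z : ℍ) : F z 1 = G z 1 := by
  -- Both functions are continuous at 1 and agree with the series for real t > 1, so letting t tend
  -- to 1 suffices.
  have hlim : Filter.Tendsto (fun t : ℝ => (t : ℂ)) (nhdsWithin 1 (Set.Ioi 1)) (nhds 1) :=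
    (Complex.continuous_ofReal.tendsto' 1 1 (by simp)).mono_left nhdsWithin_le_nhds
  have h1 := (hF.analyticAt z).continuousAt.tendsto.comp hlim
  have h2 := (hG.analyticAt z).continuousAt.tendsto.comp hlim
  refine tendsto_nhds_unique (h1.congr' ?_) h2
  filter_upwards [self_mem_nhdsWithin] with t ht
  exact (hF.hasSum z t (by simpa using ht)).unique (hG.hasSum z t (by simpa using ht))
end NieburPoincare
end

/-! ### The seed function at s = 1. -/

noncomputable section
namespace NieburPoincare

open MeasureTheory

/-- A case of the duplication formula; it matches the power series of I_{1/2} with that of sinh. -/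
theorem factorial_mul_Gamma_add_three_half (k : ℕ) :
    (k.factorial : ℝ) * Real.Gamma (k + 3 / 2) =
      (2 * k + 1).factorial * √Real.pi / 2 ^ (2 * k + 1) := by
  induction k with
  | zero =>
    have := Real.Gamma_add_one (s := 1 / 2) (by norm_num)
    rw [Real.Gamma_one_half_eq] at this
    norm_num at this ⊢
    rw [this]; ring
  | succ k ih =>
    have h1 : (0 : ℝ) < k + 3 / 2 := by positivity
    have h2 := Real.Gamma_add_one h1.ne'
    rw [show ((k + 1 : ℕ) : ℝ) + 3 / 2 = k + 3 / 2 + 1 by push_cast; ring, h2,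
      show 2 * (k + 1) + 1 = 2 * k + 1 + 1 + 1 by ring]
    rw [Nat.factorial_succ k, Nat.factorial_succ (2 * k + 1 + 1), Nat.factorial_succ (2 * k + 1)]
    push_cast
    have : ((k : ℝ) + 1) * k.factorial * ((k + 3 / 2) * Real.Gamma (k + 3 / 2)) =
      (k + 1) * (k + 3 / 2) * (k.factorial * Real.Gamma (k + 3 / 2)) := by ring
    rw [this, ih]
    field_simp
    ring

/-- The closed form of `I_{1/2}`. -/
theorem besselI_one_half {x : ℝ} (hx : 0 < x) :
    besselI (1 - 1 / 2) x = ((√(2 / (Real.pi * x)) * Real.sinh x : ℝ) : ℂ) := by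
  have hx2 : 0 < x / 2 := by positivity
  have h := (Real.hasSum_sinh x).mul_left (√(2 / (Real.pi * x)))
  rw [besselI_eq_tsum]
  refine HasSum.tsum_eq ?_
  convert (Complex.hasSum_ofReal.2 h) using 1
  funext k
  have hG : Complex.Gamma (1 - 1 / 2 + k + 1) = ((Real.Gamma (k + 3 / 2) : ℝ) : ℂ) := by
    rw [← Complex.Gamma_ofReal]; congr 1; push_cast; ring
  have hp : ((x / 2 : ℝ) : ℂ) ^ ((1 : ℂ) - 1 / 2 + 2 * k) = ((√(x / 2) * (x / 2) ^ (2 * k) : ℝ) : ℂ) := by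
    rw [Real.sqrt_eq_rpow, ← Real.rpow_natCast (x / 2) (2 * k), ← Real.rpow_add hx2,
      Complex.ofReal_cpow hx2.le]
    congr 1; push_cast; ring
  rw [besselTerm, hG, hp, ← Complex.ofReal_natCast, ← Complex.ofReal_mul, ← Complex.ofReal_div,
    factorial_mul_Gamma_add_three_half]
  congr 1
  have hs : √(2 / (Real.pi * x)) = √(x / 2) * (2 / (√Real.pi * x)) := by
    rw [← Real.sqrt_sq (by positivity : 0 ≤ 2 / (√Real.pi * x)), ← Real.sqrt_mul hx2.le]
    congr 1
    have := Real.sq_sqrt Real.pi_pos.le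
    field_simp
    rw [this]
  have hpi : 0 < √Real.pi := Real.sqrt_pos.2 Real.pi_pos
  rw [hs, div_pow]
  field_simp
  ring

/-- The seed function at `s = 1` is an elementary function. -/
theorem seed_one_aux {m : ℕ} (hm : 0 < m) {v : ℝ} (hv : 0 < v) :
    2 * Real.pi * ((√(m : ℝ) : ℝ) : ℂ) * (((√v : ℝ) : ℂ) *
      besselI (1 - 1 / 2) (2 * Real.pi * m * v)) =
      Complex.exp (2 * Real.pi * m * v) - Complex.exp (-(2 * Real.pi * m * v)) := by
  have hm' : (0 : ℝ) < m := by exact_mod_cast hm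
  have hX : 0 < 2 * Real.pi * m * v := by positivity
  have h1 : 2 * Real.pi * √(m : ℝ) * (√v * √(2 / (Real.pi * (2 * Real.pi * m * v)))) = 2 := by
    have : √(2 / (Real.pi * (2 * Real.pi * m * v))) = 1 / (Real.pi * √(m : ℝ) * √v) := by
      rw [← Real.sqrt_sq (by positivity : 0 ≤ 1 / (Real.pi * √(m : ℝ) * √v))]
      congr 1
      have h1 := Real.sq_sqrt hm'.le
      have h2 := Real.sq_sqrt hv.le
      rw [div_pow, mul_pow, mul_pow, h1, h2]
      field_simp
    rw [this]
    have := Real.sqrt_pos.2 hm'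
    have := Real.sqrt_pos.2 hv
    field_simp
  rw [besselI_one_half hX]
  have h2 : 2 * Real.pi * √(m : ℝ) * (√v * (√(2 / (Real.pi * (2 * Real.pi * m * v))) *
      Real.sinh (2 * Real.pi * m * v))) =
      Real.exp (2 * Real.pi * m * v) - Real.exp (-(2 * Real.pi * m * v)) := by
    rw [Real.sinh_eq]
    linear_combination ((Real.exp (2 * Real.pi * m * v) - Real.exp (-(2 * Real.pi * m * v))) / 2)
      * h1
  exact_mod_cast congrArg (Complex.ofReal) h2

/-- The sinh splits into e^{±2πmv}; with the common phase these are exp(κ/z) and exp(κ/z̄) for z = x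
+ iy, κ = 2πim/q. -/
theorem invSeed_one {m : ℕ} (hm : 0 < m) {q y : ℝ} (hq : 0 < q) (hy : 0 < y) (x : ℝ) :
    2 * Real.pi * ((√(m : ℝ) : ℝ) : ℂ) * invSeed m 1 q y x =
      Complex.exp (2 * Real.pi * Complex.I * m / q * ((x : ℂ) + y * Complex.I)⁻¹) -
      Complex.exp (2 * Real.pi * Complex.I * m / q * ((x : ℂ) - y * Complex.I)⁻¹) := by
  have hR : 0 < x ^ 2 + y ^ 2 := by positivity
  have hv : 0 < y / (q * (x ^ 2 + y ^ 2)) := by positivity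
  have h := seed_one_aux hm hv
  set v := y / (q * (x ^ 2 + y ^ 2)) with hvdef
  have hRC : (x : ℂ) ^ 2 + (y : ℂ) ^ 2 ≠ 0 := by exact_mod_cast hR.ne'
  have hqC : (q : ℂ) ≠ 0 := by exact_mod_cast hq.ne'
  have hp : ((x : ℂ) + y * Complex.I) * ((x : ℂ) - y * Complex.I) = (x : ℂ) ^ 2 + (y : ℂ) ^ 2 := by
    ring_nf; rw [Complex.I_sq]; ring
  have hi1 : ((x : ℂ) + y * Complex.I)⁻¹ =
      ((x : ℂ) - y * Complex.I) / ((x : ℂ) ^ 2 + (y : ℂ) ^ 2) := by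
    refine inv_eq_of_mul_eq_one_right ?_
    rw [← mul_div_assoc, hp, div_self hRC]
  have hi2 : ((x : ℂ) - y * Complex.I)⁻¹ =
      ((x : ℂ) + y * Complex.I) / ((x : ℂ) ^ 2 + (y : ℂ) ^ 2) := by
    refine inv_eq_of_mul_eq_one_right ?_
    rw [← mul_div_assoc, mul_comm, hp, div_self hRC]
  rw [invSeed, ← hvdef]
  calc _ = Complex.exp (2 * Real.pi * Complex.I * (m * (x / (q * (x ^ 2 + y ^ 2)) : ℝ))) *
        (2 * Real.pi * ((√(m : ℝ) : ℝ) : ℂ) * (((√v : ℝ) : ℂ) *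
      besselI (1 - 1 / 2) (2 * Real.pi * m * v))) := by ring
    _ = _ := by
      rw [h, mul_sub, ← Complex.exp_add, ← Complex.exp_add, hi1, hi2]
      have hvC : (v : ℂ) = y / (q * ((x : ℂ) ^ 2 + (y : ℂ) ^ 2)) := by rw [hvdef]; push_cast; ring
      rw [hvC]
      push_cast
      congr 2
      · field_simp
        linear_combination ((m : ℂ) * y) * Complex.I_sq
      · field_simp
        linear_combination (-((m : ℂ) * y)) * Complex.I_sq

/-! ### Line integrals of powers of 1/z. -/

section LineIntegral

variable {y : ℝ}

theorem integrable_inv_sq_add_sq (hy : 0 < y) : Integrable fun x : ℝ => (x ^ 2 + y ^ 2)⁻¹ := by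
  have h := (integrable_inv_one_add_sq.comp_div hy.ne').const_mul (1 / y ^ 2)
  refine h.congr (Filter.Eventually.of_forall fun x => ?_)
  simp only
  field_simp
  ring

theorem integral_inv_sq_add_sq (hy : 0 < y) : ∫ x : ℝ, (x ^ 2 + y ^ 2)⁻¹ = Real.pi / y := by
  have h := Measure.integral_comp_div (fun x : ℝ => (1 + x ^ 2)⁻¹) y
  rw [integral_univ_inv_one_add_sq, abs_of_pos hy, smul_eq_mul] at h
  have h2 : (fun x : ℝ => (x ^ 2 + y ^ 2)⁻¹) = fun x => (1 / y ^ 2) * (1 + (x / y) ^ 2)⁻¹ := by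
    funext x; field_simp; ring
  rw [h2, integral_const_mul, h]
  field_simp

/-- The difference of the powers `z ^ (-k)` and its conjugate, for `z = x + i y`. -/
def powDiff (y : ℝ) (k : ℕ) (x : ℝ) : ℂ :=
  (((x : ℂ) + y * Complex.I)⁻¹) ^ k - (((x : ℂ) - y * Complex.I)⁻¹) ^ k

theorem add_mul_I_ne_zero (hy : y ≠ 0) (x : ℝ) : (x : ℂ) + y * Complex.I ≠ 0 := fun h => by
  have := congrArg Complex.im h
  simp at this
  exact hy this

theorem norm_inv_add_mul_I (x y : ℝ) :
    ‖((x : ℂ) + y * Complex.I)⁻¹‖ ^ 2 = (x ^ 2 + y ^ 2)⁻¹ := by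
  rw [norm_inv, inv_pow, ← Complex.normSq_eq_norm_sq, Complex.normSq_add_mul_I]

/-- For k = 1 neither power is integrable, but their difference is a multiple of 1/(x² + y²); for k
≥ 2 two factors 1/|z| give the decay and the others are at most 1/y. The form is uniform in k, so it
can be summed against κ^k/k!. -/
theorem norm_powDiff_le (hy : 0 < y) (k : ℕ) (x : ℝ) :
    ‖powDiff y k x‖ ≤ 2 * y ^ 2 * (1 / y) ^ k * (x ^ 2 + y ^ 2)⁻¹ := by
  have hR : 0 < x ^ 2 + y ^ 2 := by positivity
  have hm : (x : ℂ) - y * Complex.I = (x : ℂ) + ((-y : ℝ) : ℂ) * Complex.I := by push_cast; ring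
  have hn1 := norm_inv_add_mul_I x y
  have hn2 := norm_inv_add_mul_I x (-y)
  rw [← hm, neg_sq] at hn2
  have hbd : ∀ w : ℂ, ‖w‖ ^ 2 = (x ^ 2 + y ^ 2)⁻¹ → ‖w‖ ≤ 1 / y := by
    intro w hw
    refine le_of_pow_le_pow_left₀ (n := 2) (by norm_num) (by positivity) ?_
    rw [hw, one_div, inv_pow]
    exact inv_anti₀ (by positivity) (by nlinarith [sq_nonneg x])
  rcases k with _ | _ | k
  · simp only [powDiff, pow_zero, sub_self, norm_zero]; positivity
  · have : powDiff y 1 x = ((-(2 * y) * (x ^ 2 + y ^ 2)⁻¹ : ℝ) : ℂ) * Complex.I := by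
      have h1 := add_mul_I_ne_zero hy.ne' x
      have h2 := add_mul_I_ne_zero (neg_ne_zero.2 hy.ne') x
      rw [← hm] at h2
      have hRC : (x : ℂ) ^ 2 + (y : ℂ) ^ 2 ≠ 0 := by exact_mod_cast hR.ne'
      have hp : ((x : ℂ) + y * Complex.I) * ((x : ℂ) - y * Complex.I) = (x : ℂ) ^ 2 + (y : ℂ) ^ 2 := by
        ring_nf; rw [Complex.I_sq]; ring
      rw [powDiff, pow_one, pow_one, inv_sub_inv h1 h2, hp]
      push_cast
      field_simp
      ring
    rw [zero_add, this, norm_mul, Complex.norm_I, mul_one, Complex.norm_real, Real.norm_eq_abs,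
      abs_mul, abs_neg, abs_of_pos (by positivity : 0 < 2 * y),
      abs_of_pos (by positivity : 0 < (x ^ 2 + y ^ 2)⁻¹), pow_one]
    apply le_of_eq
    field_simp
  · refine (norm_sub_le _ _).trans ?_
    rw [norm_pow, norm_pow, pow_add, pow_add, pow_add, pow_add]
    have e : ∀ w : ℂ, ‖w‖ ^ 2 = (x ^ 2 + y ^ 2)⁻¹ → ‖w‖ ^ k * ‖w‖ ^ 1 * ‖w‖ ^ 1 ≤
        y ^ 2 * (1 / y) ^ (k + 1 + 1) * (x ^ 2 + y ^ 2)⁻¹ := by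
      intro w hw
      calc ‖w‖ ^ k * ‖w‖ ^ 1 * ‖w‖ ^ 1 = ‖w‖ ^ k * ‖w‖ ^ 2 := by ring
        _ ≤ (1 / y) ^ k * (x ^ 2 + y ^ 2)⁻¹ := by
          rw [hw]; gcongr; exact hbd w hw
        _ = _ := by rw [pow_add, pow_add, pow_one]; field_simp
    calc _ ≤ y ^ 2 * (1 / y) ^ (k + 1 + 1) * (x ^ 2 + y ^ 2)⁻¹ +
          y ^ 2 * (1 / y) ^ (k + 1 + 1) * (x ^ 2 + y ^ 2)⁻¹ := add_le_add (e _ hn1) (e _ hn2)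
      _ = _ := by ring

theorem hasDerivAt_inv_pow (a : ℂ) (x : ℝ) (h : (x : ℂ) + a ≠ 0) (k : ℕ) :
    HasDerivAt (fun x : ℝ => (((x : ℂ) + a)⁻¹) ^ k) (-(k * (((x : ℂ) + a)⁻¹) ^ (k + 1))) x := by
  have h1 : HasDerivAt (fun x : ℝ => (x : ℂ) + a) 1 x := (hasDerivAt_id x).ofReal_comp.add_const a
  have h2 := (h1.fun_inv h).fun_pow k
  refine h2.congr_deriv ?_
  rcases k with _ | k
  · simp
  · rw [Nat.add_sub_cancel, neg_div, one_div, ← inv_pow]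
    ring

theorem powDiff_eq (y : ℝ) (k : ℕ) : powDiff y k = fun x : ℝ =>
    (((x : ℂ) + y * Complex.I)⁻¹) ^ k - (((x : ℂ) + -(y * Complex.I))⁻¹) ^ k := by
  funext x
  rw [powDiff, sub_eq_add_neg (x : ℂ)]

theorem continuous_powDiff (hy : 0 < y) (k : ℕ) : Continuous (powDiff y k) := by
  refine continuous_iff_continuousAt.2 fun x => ?_
  have h1 := add_mul_I_ne_zero hy.ne' x
  have h2 : (x : ℂ) + -(y * Complex.I) ≠ 0 := by
    have := add_mul_I_ne_zero (neg_ne_zero.2 hy.ne') x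
    intro h; apply this; rw [← h]; push_cast; ring
  rw [powDiff_eq]
  exact ((hasDerivAt_inv_pow _ x h1 k).continuousAt).sub
    ((hasDerivAt_inv_pow _ x h2 k).continuousAt)

theorem integrable_powDiff (hy : 0 < y) (k : ℕ) : Integrable (powDiff y k) :=
  ((integrable_inv_sq_add_sq hy).const_mul _).mono' (continuous_powDiff hy k).aestronglyMeasurable
    (Filter.Eventually.of_forall fun x => norm_powDiff_le hy k x)

theorem tendsto_powDiff (hy : 0 < y) (k : ℕ) {l : Filter ℝ}
    (hl : Filter.Tendsto (fun x : ℝ => x ^ 2) l Filter.atTop) :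
    Filter.Tendsto (powDiff y k) l (nhds 0) := by
  refine squeeze_zero_norm (norm_powDiff_le hy k) ?_
  have := (tendsto_inv_atTop_zero.comp (Filter.tendsto_atTop_add_const_right l (y ^ 2) hl)).const_mul
    (2 * y ^ 2 * (1 / y) ^ k)
  simpa using this

/-- For k = 1 the integrand is a multiple of the Poisson kernel. For k ≥ 2 it is the derivative of a
multiple of `powDiff y (k - 1)`, which vanishes at both ends. -/
theorem integral_powDiff (hy : 0 < y) (k : ℕ) :
    ∫ x, powDiff y k x = if k = 1 then -(2 * Real.pi * Complex.I) else 0 := by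
  rcases k with _ | _ | k
  · simp [powDiff]
  · have : powDiff y 1 = fun x => ((x ^ 2 + y ^ 2)⁻¹ : ℝ) * (-(2 * y * Complex.I)) := by
      funext x
      have hR : 0 < x ^ 2 + y ^ 2 := by positivity
      have hRC : (x : ℂ) ^ 2 + (y : ℂ) ^ 2 ≠ 0 := by exact_mod_cast hR.ne'
      have h1 := add_mul_I_ne_zero hy.ne' x
      have h2 : (x : ℂ) - y * Complex.I ≠ 0 := by
        have := add_mul_I_ne_zero (neg_ne_zero.2 hy.ne') x
        intro h; apply this; rw [← h]; push_cast; ring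
      have hp : ((x : ℂ) + y * Complex.I) * ((x : ℂ) - y * Complex.I) = (x : ℂ) ^ 2 + (y : ℂ) ^ 2 := by
        ring_nf; rw [Complex.I_sq]; ring
      rw [powDiff, pow_one, pow_one, inv_sub_inv h1 h2, hp]
      push_cast
      field_simp
      ring
    rw [zero_add, this, integral_mul_const, integral_complex_ofReal, integral_inv_sq_add_sq hy]
    have hyC : (y : ℂ) ≠ 0 := by exact_mod_cast hy.ne'
    simp only [if_true]
    push_cast
    field_simp
  · have hk : ((k : ℂ) + 1) ≠ 0 := by exact_mod_cast (Nat.succ_ne_zero k)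
    have hd : ∀ x, HasDerivAt (fun x => -(1 / ((k : ℂ) + 1)) * powDiff y (k + 1) x)
        (powDiff y (k + 1 + 1) x) x := by
      intro x
      have h1 := add_mul_I_ne_zero hy.ne' x
      have h2 : (x : ℂ) + -(y * Complex.I) ≠ 0 := by
        have := add_mul_I_ne_zero (neg_ne_zero.2 hy.ne') x
        intro h; apply this; rw [← h]; push_cast; ring
      have := ((hasDerivAt_inv_pow _ x h1 (k + 1)).sub
        (hasDerivAt_inv_pow _ x h2 (k + 1))).const_mul (-(1 / ((k : ℂ) + 1)))
      rw [powDiff_eq, powDiff_eq]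
      refine this.congr_deriv ?_
      push_cast
      field_simp
      ring
    have h0 : ∀ l : Filter ℝ, Filter.Tendsto (fun x : ℝ => x ^ 2) l Filter.atTop →
        Filter.Tendsto (fun x => -(1 / ((k : ℂ) + 1)) * powDiff y (k + 1) x) l (nhds 0) := by
      intro l hl
      simpa using (tendsto_powDiff hy (k + 1) hl).const_mul (-(1 / ((k : ℂ) + 1)))
    have hbot : Filter.Tendsto (fun x : ℝ => x ^ 2) Filter.atBot Filter.atTop :=
      ((Filter.tendsto_pow_atTop two_ne_zero).comp Filter.tendsto_abs_atBot_atTop).congr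
        fun x => by simp
    rw [integral_of_hasDerivAt_of_tendsto hd (integrable_powDiff hy _) (h0 _ hbot)
      (h0 _ (Filter.tendsto_pow_atTop (by norm_num)))]
    simp

/-- The integral of `exp (κ / z) - exp (κ / conj z)` along a horizontal line. -/
theorem integral_exp_inv_sub (hy : 0 < y) (κ : ℂ) :
    ∫ x : ℝ, (Complex.exp (κ * ((x : ℂ) + y * Complex.I)⁻¹) -
      Complex.exp (κ * ((x : ℂ) - y * Complex.I)⁻¹)) = -(2 * Real.pi * Complex.I) * κ := by
  -- Both exponentials are expanded in powers of κ and integrated termwise; only k = 1 contributes.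
  set F : ℕ → ℝ → ℂ := fun k x => κ ^ k / k.factorial * powDiff y k x with hF
  have hint : ∀ k, Integrable (F k) := fun k => (integrable_powDiff hy k).const_mul _
  have hbd : ∀ k, ∫ x, ‖F k x‖ ≤
      2 * y ^ 2 * (Real.pi / y) * ((‖κ‖ / y) ^ k / k.factorial) := by
    intro k
    calc ∫ x, ‖F k x‖ ≤ ∫ x, ‖κ‖ ^ k / k.factorial * (2 * y ^ 2 * (1 / y) ^ k) *
          (x ^ 2 + y ^ 2)⁻¹ := by
          refine integral_mono (hint k).norm ((integrable_inv_sq_add_sq hy).const_mul _) fun x => ?_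
          simp only [hF, norm_mul, norm_div, norm_pow]
          rw [mul_assoc]
          gcongr
          · simp
          · exact norm_powDiff_le hy k x
      _ = _ := by
          rw [integral_const_mul, integral_inv_sq_add_sq hy, div_pow, div_pow, one_pow]; ring
  have hsum : Summable fun k => ∫ x, ‖F k x‖ :=
    Summable.of_nonneg_of_le (fun k => integral_nonneg fun _ => norm_nonneg _) hbd
      ((Real.summable_pow_div_factorial _).mul_left _)
  have hmain := hasSum_integral_of_summable_integral_norm hint hsum
  have hE : ∀ w : ℂ, HasSum (fun k : ℕ => κ ^ k / k.factorial * w ^ k) (Complex.exp (κ * w)) := by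
    intro w
    have := NormedSpace.expSeries_div_hasSum_exp (𝔸 := ℂ) (κ * w)
    rw [← Complex.exp_eq_exp_ℂ] at this
    refine this.congr_fun fun k => ?_
    rw [mul_pow]; ring
  have hpt : (fun x : ℝ => ∑' k, F k x) = fun x : ℝ =>
      Complex.exp (κ * ((x : ℂ) + y * Complex.I)⁻¹) -
      Complex.exp (κ * ((x : ℂ) - y * Complex.I)⁻¹) := by
    funext x
    refine HasSum.tsum_eq ?_
    refine ((hE _).sub (hE _)).congr_fun fun k => ?_
    simp only [hF, powDiff]; ring
  rw [hpt] at hmain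
  refine hmain.unique ?_
  have hval : ∀ k, ∫ x, F k x = if k = 1 then -(2 * Real.pi * Complex.I) * κ else 0 := by
    intro k
    simp only [hF]
    rw [integral_const_mul, integral_powDiff hy]
    split_ifs with h
    · rw [h]; simp; ring
    · simp
  simp_rw [hval]
  exact hasSum_ite_eq 1 _

end LineIntegral

theorem integrable_invSeed {m : ℕ} (hm : 0 < m) {q y : ℝ} (hq : 1 ≤ q) (hy : 0 < y) :
    Integrable (invSeed m 1 q y) := by
  obtain ⟨K, hK, h⟩ := exists_bound_invSeed hm hy 1
  refine ((integrable_sq_add_sq_rpow hy).const_mul (K * q ^ (-(1 : ℂ).re))).mono' ?_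
    (Filter.Eventually.of_forall fun x => (h 1 (by norm_num) (by simp) q hq x).1)
  have hq0 : 0 < q := by linarith
  have hm' : (0 : ℝ) < m := by exact_mod_cast hm
  have hc : (2 * Real.pi * ((√(m : ℝ) : ℝ) : ℂ)) ≠ 0 := by
    have : 0 < 2 * Real.pi * √(m : ℝ) := by positivity
    exact_mod_cast this.ne'
  have he : invSeed m 1 q y = fun x : ℝ => (2 * Real.pi * ((√(m : ℝ) : ℝ) : ℂ))⁻¹ *
      (Complex.exp (2 * Real.pi * Complex.I * m / q * ((x : ℂ) + y * Complex.I)⁻¹) -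
      Complex.exp (2 * Real.pi * Complex.I * m / q * ((x : ℂ) - y * Complex.I)⁻¹)) := by
    funext x
    rw [← invSeed_one hm hq0 hy, inv_mul_cancel_left₀ hc]
  rw [he]
  refine Measurable.aestronglyMeasurable ?_
  fun_prop

theorem integral_invSeed {m : ℕ} (hm : 0 < m) {q y : ℝ} (hq : 0 < q) (hy : 0 < y) :
    2 * Real.pi * ((√(m : ℝ) : ℝ) : ℂ) * ∫ x, invSeed m 1 q y x = 4 * Real.pi ^ 2 * m / q := by
  rw [← integral_const_mul]
  simp_rw [invSeed_one hm hq hy]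
  rw [integral_exp_inv_sub hy]
  linear_combination (-4 * (Real.pi : ℂ) ^ 2 * m / q) * Complex.I_sq

end NieburPoincare
end

/-! ### The constant term by unfolding. -/

noncomputable section
namespace NieburPoincare

open MeasureTheory

theorem aestronglyMeasurable_of_hasSum {ι : Type*} [Countable ι] {F : ι → ℝ → ℂ} {f : ℝ → ℂ}
    {μ : Measure ℝ} (hF : ∀ i, AEStronglyMeasurable (F i) μ) (h : ∀ x, HasSum (fun i => F i x) (f x)) :
    AEStronglyMeasurable f μ :=
  aestronglyMeasurable_of_tendsto_ae Filter.atTop (f := fun (s : Finset ι) x => ∑ i ∈ s, F i x)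
    (fun s => Finset.aestronglyMeasurable_fun_sum s fun i _ => hF i)
    (Filter.Eventually.of_forall fun x => h x)

theorem intervalIntegrable_of_bounded {f : ℝ → ℂ} {B : ℝ} (hf : AEStronglyMeasurable f volume)
    (hB : ∀ x, ‖f x‖ ≤ B) (a b : ℝ) : IntervalIntegrable f volume a b := by
  refine (intervalIntegrable_const (c := B)).mono_fun' hf.restrict ?_
  exact Filter.Eventually.of_forall hB

/-- Unfolding the integral of a periodization. -/
theorem integral_tsum_add_int {f : ℝ → ℂ} (hf : Integrable f) :
    ∫ x in (0 : ℝ)..1, ∑' n : ℤ, f (x + n) = ∫ x, f x := by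
  have h1 := hf.hasSum_intervalIntegral_comp_add_int
  have h2 := hf.norm.hasSum_intervalIntegral_comp_add_int.summable
  simp_rw [intervalIntegral.integral_of_le zero_le_one] at h1 h2 ⊢
  have h3 := hasSum_integral_of_summable_integral_norm
    (F := fun (n : ℤ) (x : ℝ) => f (x + n)) (μ := volume.restrict (Set.Ioc 0 1))
    (fun n => (hf.comp_add_right (n : ℝ)).integrableOn) h2
  exact h3.unique h1

theorem aestronglyMeasurable_tsum_invSeed {m : ℕ} (hm : 0 < m) {q y : ℝ} (hq : 1 ≤ q) (hy : 0 < y)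
    (t : ℝ) : AEStronglyMeasurable (fun x : ℝ => ∑' n : ℤ, invSeed m 1 q y (x + t + n)) volume := by
  obtain ⟨K, hK, h⟩ := exists_bound_tsum_invSeed hm hy 1
  refine aestronglyMeasurable_of_hasSum (F := fun (n : ℤ) x => invSeed m 1 q y (x + t + n))
    (fun n => ?_) fun x =>
      (h 1 (by norm_num) (by simp) q hq (x + t)).1.of_norm.hasSum
  have := ((integrable_invSeed hm hq hy).comp_add_right (t + n)).aestronglyMeasurable
  simpa only [← add_assoc] using this

theorem integral_tsum_invSeed {m : ℕ} (hm : 0 < m) {q y : ℝ} (hq : 1 ≤ q) (hy : 0 < y) (t : ℝ) :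
    ∫ x in (0 : ℝ)..1, ∑' n : ℤ, invSeed m 1 q y (x + t + n) = ∫ x, invSeed m 1 q y x := by
  rw [← integral_add_right_eq_self (invSeed m 1 q y) t,
    ← integral_tsum_add_int ((integrable_invSeed hm hq hy).comp_add_right t)]
  simp_rw [add_right_comm _ t]

namespace LevelPair

variable {N : ℕ} (p : LevelPair N) {m : ℕ} {y : ℝ}

theorem aestronglyMeasurable_levelSum (hm : 0 < m) (hy : 0 < y) :
    AEStronglyMeasurable (fun x => p.levelSum m 1 y x) volume :=
  Finset.aestronglyMeasurable_fun_sum _ fun _ _ =>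
    (aestronglyMeasurable_tsum_invSeed hm p.one_le_conductor hy _).const_mul _

/-- After unfolding, the shift by u/C does not affect the line integral, so the character weights
factor out. -/
theorem integral_levelSum (hm : 0 < m) (hy : 0 < y) :
    ∫ x in (0 : ℝ)..1, p.levelSum m 1 y x =
      (∑ u, p.weight m u) * ∫ x, invSeed m 1 p.conductor y x := by
  obtain ⟨K, hK, h⟩ := exists_bound_tsum_invSeed hm hy 1
  have hi : ∀ t : ℝ, IntervalIntegrable
      (fun x : ℝ => ∑' n : ℤ, invSeed m 1 p.conductor y (x + t + n)) volume 0 1 := fun t =>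
    intervalIntegrable_of_bounded (aestronglyMeasurable_tsum_invSeed hm p.one_le_conductor hy t)
      (fun x => (norm_tsum_le_tsum_norm
        (h 1 (by norm_num) (by simp) _ p.one_le_conductor (x + t)).1).trans
        (h 1 (by norm_num) (by simp) _ p.one_le_conductor (x + t)).2) 0 1
  simp only [levelSum]
  rw [intervalIntegral.integral_finsetSum fun u _ => (hi _).const_mul _, Finset.sum_mul]
  refine Finset.sum_congr rfl fun u _ => ?_
  rw [intervalIntegral.integral_const_mul, integral_tsum_invSeed hm p.one_le_conductor hy]

end LevelPair

theorem seed_mk (m : ℕ) (s : ℂ) (x y : ℝ) (hy : 0 < y) :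
    seed m s ⟨⟨x, y⟩, hy⟩ = Complex.exp (-(2 * Real.pi * Complex.I * m) * x) *
      (((√y : ℝ) : ℂ) * besselI (s - 1 / 2) (2 * Real.pi * m * y)) := by
  have h1 : (⟨⟨x, y⟩, hy⟩ : ℍ).re = x := rfl
  have h2 : (⟨⟨x, y⟩, hy⟩ : ℍ).im = y := rfl
  rw [seed, h1, h2, mul_assoc]
  congr 2
  ring

theorem integral_seed {m : ℕ} (hm : 0 < m) (s : ℂ) (y : ℝ) (hy : 0 < y) :
    ∫ x in (0 : ℝ)..1, seed m s ⟨⟨x, y⟩, hy⟩ = 0 := by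
  simp_rw [seed_mk]
  have hm' : (m : ℂ) ≠ 0 := by exact_mod_cast hm.ne'
  have hc : -(2 * Real.pi * Complex.I * m) ≠ 0 := by
    simp [Complex.I_ne_zero, Real.pi_ne_zero, hm']
  rw [intervalIntegral.integral_mul_const, integral_exp_mul_complex hc]
  have : Complex.exp (-(2 * Real.pi * Complex.I * m)) = 1 := by
    rw [Complex.exp_eq_one_iff]
    exact ⟨-m, by push_cast; ring⟩
  simp [this]

/-- Integral and sum over (e, C) are exchanged by dominated convergence; at s = 1 this needs the
Kloosterman majorant, the trivial one being of order 1/C. -/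
theorem hasConstantTerm_continuation (N : ℕ) {m : ℕ} (hm : 0 < m) :
    HasConstantTerm (fun z => 2 * Real.pi * ((√(m : ℝ) : ℝ) : ℂ) * continuation N m z 1)
      (∑' p : LevelPair N, (∑ u, p.weight m u) * (4 * Real.pi ^ 2 * m / p.conductor)) := by
  intro y hy
  obtain ⟨K, hK, hb⟩ := exists_bound_levelSum (N := N) hm hy 1
  have hb1 : ∀ (p : LevelPair N) (x : ℝ), ‖p.levelSum m 1 y x‖ ≤
      K * (p.1.2 : ℝ) ^ (-(33 / 32) : ℝ) := hb 1 (by norm_num) (by simp)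
  have hS := (summable_levelPair N (r := 33 / 32) (by norm_num)).mul_left K
  have hlim : ∀ x : ℝ, HasSum (fun p : LevelPair N => p.levelSum m 1 y x)
      (∑' p : LevelPair N, p.levelSum m 1 y x) := fun x =>
    (Summable.of_norm_bounded hS fun p => hb1 p x).hasSum
  have hmeas := aestronglyMeasurable_of_hasSum (μ := volume)
    (fun p : LevelPair N => p.aestronglyMeasurable_levelSum hm hy) hlim
  have hint : IntervalIntegrable (fun x => ∑' p : LevelPair N, p.levelSum m 1 y x) volume 0 1 :=
    intervalIntegrable_of_bounded hmeas
      (fun x => tsum_of_norm_bounded hS.hasSum fun p => hb1 p x) 0 1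
  have hseed : IntervalIntegrable (fun x : ℝ => seed m 1 ⟨⟨x, y⟩, hy⟩) volume 0 1 := by
    simp_rw [seed_mk]
    exact Continuous.intervalIntegrable (by fun_prop) _ _
  have hsum : HasSum (fun p : LevelPair N => ∫ x in (0 : ℝ)..1, p.levelSum m 1 y x)
      (∫ x in (0 : ℝ)..1, ∑' p : LevelPair N, p.levelSum m 1 y x) :=
    intervalIntegral.hasSum_integral_of_dominated_convergence
      (fun (p : LevelPair N) _ => K * (p.1.2 : ℝ) ^ (-(33 / 32) : ℝ))
      (fun p => (p.aestronglyMeasurable_levelSum hm hy).restrict)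
      (fun p => Filter.Eventually.of_forall fun x _ => hb1 p x)
      (Filter.Eventually.of_forall fun x _ => hS)
      intervalIntegrable_const
      (Filter.Eventually.of_forall fun x _ => hlim x)
  have hcont : ∀ x : ℝ, continuation N m ⟨⟨x, y⟩, hy⟩ 1 =
      seed m 1 ⟨⟨x, y⟩, hy⟩ + ∑' p : LevelPair N, p.levelSum m 1 y x := fun _ => rfl
  simp only [hcont]
  refine ⟨(hseed.add hint).const_mul _, ?_⟩
  rw [intervalIntegral.integral_const_mul, intervalIntegral.integral_add hseed hint,
    integral_seed hm, zero_add, ← hsum.tsum_eq, ← tsum_mul_left]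
  refine tsum_congr fun p => ?_
  rw [p.integral_levelSum hm hy, mul_left_comm,
    integral_invSeed hm (by linarith [p.one_le_conductor]) hy]

end NieburPoincare
end

/-! ### Ramanujan sums. -/

noncomputable section
namespace NieburPoincare

open ArithmeticFunction Finset

/-- The function `d ↦ d` on the divisors of `m`, extended by zero. -/
def divisorId (m : ℕ) : ArithmeticFunction ℝ := ⟨fun d => if d ∣ m then (d : ℝ) else 0, by simp⟩

theorem divisorId_apply (m d : ℕ) : divisorId m d = if d ∣ m then (d : ℝ) else 0 := rfl

theorem isMultiplicative_divisorId (m : ℕ) : (divisorId m).IsMultiplicative := by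
  refine ⟨by simp [divisorId_apply], fun {a b} hab => ?_⟩
  have h : a * b ∣ m ↔ a ∣ m ∧ b ∣ m :=
    ⟨fun h => ⟨dvd_of_mul_right_dvd h, dvd_of_mul_left_dvd h⟩, fun h => hab.mul_dvd_of_dvd_of_dvd h.1 h.2⟩
  simp only [divisorId_apply, h]
  split_ifs <;> simp_all

/-- The Ramanujan sum `n ↦ ∑ e(m v / n)`, the sum being over the units `v` modulo `n`. -/
def ramanujan (m : ℕ) : ArithmeticFunction ℝ := (moebius : ArithmeticFunction ℝ) * divisorId m

theorem isMultiplicative_ramanujan (m : ℕ) : (ramanujan m).IsMultiplicative :=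
  isMultiplicative_moebius.intCast.mul (isMultiplicative_divisorId m)

theorem sum_exp_range (m n : ℕ) (hn : n ≠ 0) :
    ∑ x ∈ range n, Complex.exp (2 * Real.pi * Complex.I * (m * x : ℕ) / n) = divisorId m n := by
  have : NeZero n := ⟨hn⟩
  have h := AddChar.sum_mulShift (m : ZMod n) (ZMod.isPrimitive_stdAddChar n)
  simp only [ZMod.card, ZMod.natCast_eq_zero_iff] at h
  rw [divisorId_apply]
  push_cast at h ⊢
  have h' : ∑ x ∈ range n, Complex.exp (2 * Real.pi * Complex.I * (m * x : ℕ) / n) =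
      ∑ x : ZMod n, (ZMod.stdAddChar (x * (m : ZMod n)) : ℂ) := by
    refine sum_nbij' (fun x => (x : ZMod n)) (fun a => a.val) (by simp)
      (fun a _ => mem_range.2 a.val_lt) (fun x hx => ZMod.val_cast_of_lt (mem_range.1 hx))
      (fun a _ => by simp) (fun x _ => ?_)
    have := ZMod.stdAddChar_coe (N := n) ((m * x : ℕ) : ℤ)
    rw [Int.cast_natCast] at this
    rw [mul_comm (x : ZMod n), ← Nat.cast_mul, this]
    simp
  push_cast at h'
  rw [h', h]
  split_ifs <;> simp

theorem sum_moebius_filter_dvd (n x : ℕ) (hn : n ≠ 0) :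
    ∑ d ∈ n.divisors with d ∣ x, (moebius d : ℂ) = if n.Coprime x then 1 else 0 := by
  have h := congrArg (fun f : ArithmeticFunction ℤ => f (n.gcd x)) moebius_mul_coe_zeta
  simp only [coe_mul_zeta_apply, one_apply] at h
  have h' : (if n.Coprime x then 1 else 0 : ℂ) = ((if n.gcd x = 1 then 1 else 0 : ℤ) : ℂ) := by
    simp [Nat.coprime_iff_gcd_eq_one]
  rw [h', ← h, ← Int.cast_sum]
  congr 1
  refine sum_congr ?_ fun _ _ => rfl
  ext d
  simp [Nat.dvd_gcd_iff, hn]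

theorem sum_filter_dvd_range (n d : ℕ) (hd : d ∈ n.divisors) (f : ℕ → ℂ) :
    ∑ x ∈ range n with d ∣ x, f x = ∑ y ∈ range (n / d), f (d * y) := by
  obtain ⟨⟨k, rfl⟩, h0⟩ := Nat.mem_divisors.1 hd
  have hd0 : 0 < d := Nat.pos_of_ne_zero (left_ne_zero_of_mul h0)
  rw [Nat.mul_div_cancel_left _ hd0]
  refine sum_nbij' (fun x => x / d) (fun y => d * y) ?_ ?_ ?_ ?_ ?_
  · intro x hx
    simp only [mem_filter, mem_range] at hx ⊢
    exact Nat.div_lt_of_lt_mul hx.1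
  · intro y hy
    simp only [mem_filter, mem_range] at hy ⊢
    exact ⟨by gcongr, dvd_mul_right _ _⟩
  · intro x hx
    exact Nat.mul_div_cancel' (mem_filter.1 hx).2
  · intro y _
    exact Nat.mul_div_cancel_left _ hd0
  · intro x hx
    rw [Nat.mul_div_cancel' (mem_filter.1 hx).2]

/-- The Möbius function detects coprimality to n, and the complete sums over the multiples of each d
∣ n are evaluated by orthogonality. -/
theorem sum_units_stdAddChar (m n : ℕ) [NeZero n] :
    ∑ v : (ZMod n)ˣ, (ZMod.stdAddChar ((m : ZMod n) * (v : ZMod n)) : ℂ) = ramanujan m n := by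
  have hn := NeZero.ne n
  set E : ℕ → ℂ := fun x => Complex.exp (2 * Real.pi * Complex.I * (m * x : ℕ) / n) with hE
  have h1 : ∑ v : (ZMod n)ˣ, (ZMod.stdAddChar ((m : ZMod n) * (v : ZMod n)) : ℂ) =
      ∑ x ∈ range n with n.Coprime x, E x := by
    refine sum_bij (fun v _ => (v : ZMod n).val) ?_ ?_ ?_ ?_
    · intro v _
      exact mem_filter.2 ⟨mem_range.2 (ZMod.val_lt _), (ZMod.val_coe_unit_coprime v).symm⟩
    · intro v _ w _ h
      exact Units.ext (ZMod.val_injective n h)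
    · intro x hx
      obtain ⟨h, h'⟩ := mem_filter.1 hx
      refine ⟨ZMod.unitOfCoprime x h'.symm, mem_univ _, ?_⟩
      rw [ZMod.coe_unitOfCoprime, ZMod.val_cast_of_lt (mem_range.1 h)]
    · intro v _
      have := ZMod.stdAddChar_coe (N := n) ((m * (v : ZMod n).val : ℕ) : ℤ)
      rw [Int.cast_natCast, Nat.cast_mul, ZMod.natCast_zmod_val] at this
      rw [this, hE]
      simp
  have h2 : ∀ x, (if n.Coprime x then E x else 0) =
      ∑ d ∈ n.divisors, if d ∣ x then (moebius d : ℂ) * E x else 0 := by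
    intro x
    rw [← sum_filter, ← sum_mul, sum_moebius_filter_dvd n x hn, ite_mul, one_mul, zero_mul]
  rw [h1, sum_filter, sum_congr rfl fun x _ => h2 x, sum_comm, ramanujan, mul_apply,
    Nat.sum_divisorsAntidiagonal fun i j => (moebius : ArithmeticFunction ℝ) i * divisorId m j]
  rw [Complex.ofReal_sum]
  refine sum_congr rfl fun d hd => ?_
  rw [Complex.ofReal_mul, intCoe_apply, Complex.ofReal_intCast, ← sum_filter, sum_filter_dvd_range n d hd, ← mul_sum]
  have hdn := Nat.dvd_of_mem_divisors hd
  have hd0 : (d : ℂ) ≠ 0 := by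
    exact_mod_cast (Nat.pos_of_mem_divisors hd).ne'
  have hq : n / d ≠ 0 := (Nat.div_pos (Nat.divisor_le hd) (Nat.pos_of_mem_divisors hd)).ne'
  rw [← sum_exp_range m (n / d) hq]
  refine congrArg _ ?_
  refine sum_congr rfl fun y _ => ?_
  rw [hE]
  rw [Nat.cast_div hdn hd0]
  push_cast
  field_simp

/-- The substitution v = -(eu)⁻¹ makes the sum independent of e. -/
theorem sum_weight {N : ℕ} (p : LevelPair N) (m : ℕ) :
    ∑ u, p.weight m u = ramanujan m p.1.2 := by
  rw [← sum_units_stdAddChar]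
  refine Fintype.sum_equiv ((Equiv.inv _).trans (Equiv.mulLeft (-p.unit⁻¹))) _ _ fun u => ?_
  rw [LevelPair.weight, LevelPair.twist]
  refine congrArg (fun t => (ZMod.stdAddChar t : ℂ)) ?_
  simp only [Equiv.trans_apply, Equiv.inv_apply, Equiv.coe_mulLeft, Units.val_mul, Units.val_neg]
  ring

/-- Only the common divisors of m and n enter. A bound uniform in n gives absolute convergence of
the Dirichlet series at 2. -/
theorem abs_ramanujan_le (m n : ℕ) (hm : 0 < m) :
    |ramanujan m n| ≤ ∑ d ∈ m.divisors, (d : ℝ) := by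
  rw [ramanujan, mul_apply,
    Nat.sum_divisorsAntidiagonal' fun i j => (moebius : ArithmeticFunction ℝ) i * divisorId m j]
  refine (abs_sum_le_sum_abs _ _).trans ?_
  have h1 : ∀ d ∈ n.divisors, |(moebius : ArithmeticFunction ℝ) (n / d) * divisorId m d| ≤
      if d ∣ m then (d : ℝ) else 0 := by
    intro d _
    rw [abs_mul, divisorId_apply, abs_of_nonneg (a := ite _ _ _) (by positivity)]
    refine mul_le_of_le_one_left (by positivity) ?_
    rw [intCoe_apply]
    exact_mod_cast abs_moebius_le_one
  refine (sum_le_sum h1).trans ?_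
  rw [← sum_filter]
  refine sum_le_sum_of_subset_of_nonneg (fun d hd => ?_) fun _ _ _ => by positivity
  exact Nat.mem_divisors.2 ⟨(mem_filter.1 hd).2, hm.ne'⟩

/-- By Möbius inversion `divisorId m` is the divisor sum of `ramanujan m`; at consecutive prime
powers these sums differ by one term. -/
theorem ramanujan_prime_pow (m : ℕ) {p : ℕ} (hp : p.Prime) (k : ℕ) :
    ramanujan m (p ^ (k + 1)) = divisorId m (p ^ (k + 1)) - divisorId m (p ^ k) := by
  have h : divisorId m = ramanujan m * (zeta : ArithmeticFunction ℝ) := by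
    rw [ramanujan, mul_comm, ← mul_assoc, coe_zeta_mul_coe_moebius, one_mul]
  have h' : ∀ k, divisorId m (p ^ k) = ∑ j ∈ range (k + 1), ramanujan m (p ^ j) := fun k => by
    rw [h, coe_mul_zeta_apply, Nat.sum_divisors_prime_pow hp]
  rw [h' (k + 1), h' k, sum_range_succ _ (k + 1), add_sub_cancel_left]

theorem divisorId_prime_pow {m p : ℕ} (hm : 0 < m) (hp : p.Prime) (k : ℕ) :
    divisorId m (p ^ k) = if k ≤ alpha m p then (p : ℝ) ^ k else 0 := by
  have h := hp.pow_dvd_iff_le_factorization (k := k) hm.ne'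
  rw [divisorId_apply, alpha, Nat.cast_pow]
  split_ifs <;> tauto

end NieburPoincare
end

/-! ### Local factors of the Dirichlet series. -/

noncomputable section
namespace NieburPoincare

open ArithmeticFunction Finset

section Local

variable {m p : ℕ}

/-- The Ramanujan sum modulo `n`, divided by `n ^ 2`. -/
def ramanujanDivSq (m : ℕ) : ArithmeticFunction ℝ := ⟨fun n => ramanujan m n / (n : ℝ) ^ 2, by simp⟩

theorem ramanujanDivSq_apply (m n : ℕ) : ramanujanDivSq m n = ramanujan m n / (n : ℝ) ^ 2 := rfl

theorem isMultiplicative_ramanujanDivSq (m : ℕ) : (ramanujanDivSq m).IsMultiplicative := by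
  refine ⟨by simp [ramanujanDivSq_apply, (isMultiplicative_ramanujan m).map_one], fun {a b} h => ?_⟩
  simp only [ramanujanDivSq_apply, (isMultiplicative_ramanujan m).map_mul_of_coprime h]
  push_cast
  ring

theorem summable_norm_ramanujanDivSq (hm : 0 < m) : Summable fun n => ‖ramanujanDivSq m n‖ := by
  refine Summable.of_nonneg_of_le (fun _ => norm_nonneg _) (fun n => ?_)
    ((Real.summable_one_div_nat_pow.2 one_lt_two).mul_left (∑ d ∈ m.divisors, (d : ℝ)))
  rw [ramanujanDivSq_apply, norm_div, Real.norm_eq_abs, norm_pow, Real.norm_natCast, mul_one_div]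
  gcongr
  exact abs_ramanujan_le m n hm

/-- The sum of the values of `ramanujanDivSq m` at `p ^ j`, `j ≥ k`, for `k > 0`. -/
def localTail (m p k : ℕ) : ℝ :=
  if k ≤ alpha m p + 1 then
    (p : ℝ)⁻¹ ^ k - (p : ℝ)⁻¹ ^ (alpha m p + 1) - (p : ℝ)⁻¹ ^ (alpha m p + 2) else 0

/-- The Ramanujan sum at p^(k+1) is p^(k+1) - p^k for k < α, -p^k for k = α and 0 beyond; in each
case its quotient by p^(2k+2) is a difference of tails. -/
theorem ramanujanDivSq_prime_pow (hm : 0 < m) (hp : p.Prime) (k : ℕ) :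
    ramanujanDivSq m (p ^ (k + 1)) = localTail m p (k + 1) - localTail m p (k + 2) := by
  have h0 : (p : ℝ) ≠ 0 := by exact_mod_cast hp.ne_zero
  rw [ramanujanDivSq_apply, ramanujan_prime_pow m hp, divisorId_prime_pow hm hp,
    divisorId_prime_pow hm hp, localTail, localTail]
  push_cast
  rcases lt_trichotomy k (alpha m p) with h | h | h
  · rw [if_pos (by omega), if_pos (by omega), if_pos (by omega), if_pos (by omega)]
    simp only [inv_pow]
    field_simp
    ring
  · rw [if_neg (by omega), if_pos (by omega), if_pos (by omega), if_neg (by omega), ← h]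
    simp only [inv_pow]
    field_simp
    ring
  · rw [if_neg (by omega), if_neg (by omega), if_neg (by omega), if_neg (by omega)]
    simp

theorem ramanujanDivSq_prime_pow_eq_zero (hm : 0 < m) (hp : p.Prime) {k : ℕ}
    (hk : alpha m p + 1 < k) : ramanujanDivSq m (p ^ k) = 0 := by
  obtain ⟨k, rfl⟩ : ∃ j, k = j + 1 := ⟨k - 1, by omega⟩
  rw [ramanujanDivSq_prime_pow hm hp, localTail, localTail, if_neg (by omega), if_neg (by omega),
    sub_zero]

theorem ramanujanDivSq_prime_pow_ne_zero (hm : 0 < m) (hp : p.Prime) {k : ℕ}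
    (hk : k ≤ alpha m p + 1) : ramanujanDivSq m (p ^ k) ≠ 0 := by
  have h0 : (p : ℝ) ≠ 0 := by exact_mod_cast hp.ne_zero
  have h1 : (p : ℝ) ≠ 1 := by exact_mod_cast hp.ne_one
  rcases k with _ | k
  · simp [(isMultiplicative_ramanujanDivSq m).map_one]
  rw [ramanujanDivSq_apply, ramanujan_prime_pow m hp, divisorId_prime_pow hm hp,
    divisorId_prime_pow hm hp, if_pos (show k ≤ alpha m p by omega)]
  refine div_ne_zero ?_ (pow_ne_zero _ (by exact_mod_cast pow_ne_zero _ hp.ne_zero))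
  split_ifs
  · rw [pow_succ, ← mul_sub_one]
    exact mul_ne_zero (pow_ne_zero _ h0) (sub_ne_zero.2 h1)
  · rw [zero_sub]
    exact neg_ne_zero.2 (pow_ne_zero _ h0)

theorem hasSum_ramanujanDivSq_prime_pow (hm : 0 < m) (hp : p.Prime) {k : ℕ} (hk : 0 < k) :
    HasSum (fun j => ramanujanDivSq m (p ^ (k + j))) (localTail m p k) := by
  -- The length α + 2 suffices, as k + α + 2 > α + 1 puts the end of the telescoping sum past the
  -- last nonzero term.
  have h : ∑ j ∈ range (alpha m p + 2), ramanujanDivSq m (p ^ (k + j)) = localTail m p k := by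
    have h1 : ∀ j, ramanujanDivSq m (p ^ (k + j)) =
        localTail m p (k + j) - localTail m p (k + (j + 1)) := by
      intro j
      obtain ⟨i, rfl⟩ : ∃ i, k = i + 1 := ⟨k - 1, by omega⟩
      rw [show i + 1 + j = i + j + 1 by ring, ramanujanDivSq_prime_pow hm hp]
      congr 2
      ring
    simp only [h1]
    rw [sum_range_sub' fun j => localTail m p (k + j)]
    simp only [add_zero, sub_eq_self]
    rw [localTail, if_neg (by omega)]
  rw [← h]
  refine hasSum_sum_of_ne_finset_zero fun j hj => ?_
  rw [mem_range] at hj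
  exact ramanujanDivSq_prime_pow_eq_zero hm hp (by omega)

/-- Adding the term 1 at j = 0 to the tail from p on gives (1 + p⁻¹)(1 - p^(-α-1)); the factor 1 -
p⁻¹ of 1 - p⁻² turns the geometric sum into 1 - p^(-α-1). -/
theorem hasSum_ramanujanDivSq_prime_pow_zero (hm : 0 < m) (hp : p.Prime) :
    HasSum (fun j => ramanujanDivSq m (p ^ j))
      ((1 - ((p : ℝ) ^ 2)⁻¹) * ∑ j ∈ range (alpha m p + 1), (p : ℝ)⁻¹ ^ j) := by
  have h0 : (p : ℝ) ≠ 0 := by exact_mod_cast hp.ne_zero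
  have h1 : (p : ℝ)⁻¹ ≠ 1 := inv_ne_one.2 (by exact_mod_cast hp.ne_one)
  have h := hasSum_ramanujanDivSq_prime_pow hm hp one_pos
  simp only [add_comm 1] at h
  have h2 := (hasSum_nat_add_iff (f := fun j => ramanujanDivSq m (p ^ j)) 1).1 h
  have h3 : localTail m p 1 + ∑ j ∈ range 1, ramanujanDivSq m (p ^ j) =
      (1 - ((p : ℝ) ^ 2)⁻¹) * ∑ j ∈ range (alpha m p + 1), (p : ℝ)⁻¹ ^ j := by
    have := mul_geom_sum (p : ℝ)⁻¹ (alpha m p + 1)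
    rw [localTail, if_pos (by omega), sum_range_one, pow_zero,
      (isMultiplicative_ramanujanDivSq m).map_one, ← inv_pow]
    generalize ∑ j ∈ range (alpha m p + 1), (p : ℝ)⁻¹ ^ j = S at this ⊢
    linear_combination (1 + (p : ℝ)⁻¹) * this
  rwa [h3] at h2

end Local

/-- The terms of the Dirichlet series over the multiples of `M` that are coprime to `e`. -/
def levelTerm (m M e k : ℕ) : ℝ := if M ∣ k ∧ k.Coprime e then ramanujanDivSq m k else 0

theorem summable_norm_levelTerm {m : ℕ} (hm : 0 < m) (M e : ℕ) :
    Summable fun k => ‖levelTerm m M e k‖ := by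
  refine Summable.of_nonneg_of_le (fun _ => norm_nonneg _) (fun k => ?_)
    (summable_norm_ramanujanDivSq hm)
  rw [levelTerm]
  split_ifs
  · rfl
  · simp

/-! ### Euler products over the multiples of a fixed integer. -/

section Multiplicative

variable {h : ArithmeticFunction ℝ} {M : ℕ}

/-- For coprime a and b, Mab and M are the lcm and gcd of Ma and Mb. Hence k ↦ h(Mk)/h(M) is
multiplicative, although M and k may share factors. -/
theorem apply_mul_mul_apply (hh : h.IsMultiplicative) {a b : ℕ} (hab : a.Coprime b) :
    h (M * (a * b)) * h M = h (M * a) * h (M * b) := by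
  rw [← hh.lcm_apply_mul_gcd_apply (x := M * a), Nat.lcm_mul_left, Nat.gcd_mul_left,
    hab.lcm_eq_mul, hab.gcd_eq_one, mul_one]

theorem apply_mul_prime_pow (hh : h.IsMultiplicative) {p : ℕ} (hp : p.Prime) (hM : M ≠ 0) (j : ℕ) :
    h (M * p ^ j) * h (p ^ M.factorization p) = h (p ^ (M.factorization p + j)) * h M := by
  have h1 := Nat.ordProj_mul_ordCompl_eq_self M p
  have h2 : ∀ i, h (p ^ i * (M / p ^ M.factorization p)) =
      h (p ^ i) * h (M / p ^ M.factorization p) := fun i =>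
    hh.map_mul_of_coprime ((Nat.coprime_ordCompl hp hM).pow_left i)
  have h3 : h (M * p ^ j) = h (p ^ (M.factorization p + j) * (M / p ^ M.factorization p)) := by
    conv_lhs => rw [← h1]
    congr 1
    rw [pow_add]
    ring
  have h4 : h M = h (p ^ (M.factorization p) * (M / p ^ M.factorization p)) := by rw [h1]
  rw [h3, h4, h2, h2]
  ring

theorem apply_ne_zero_of_prime_pow (hh : h.IsMultiplicative) (hM : M ≠ 0)
    (hne : ∀ p ∈ M.primeFactors, h (p ^ M.factorization p) ≠ 0) : h M ≠ 0 := by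
  rw [hh.multiplicative_factorization _ hM]
  exact prod_ne_zero_iff.2 hne

theorem apply_eq_zero_of_prime_pow (hh : h.IsMultiplicative) {p : ℕ} (hp : p.Prime) (hM : M ≠ 0)
    (h0 : h (p ^ M.factorization p) = 0) : h M = 0 := by
  have h1 := Nat.ordProj_mul_ordCompl_eq_self M p
  rw [← h1, hh.map_mul_of_coprime ((Nat.coprime_ordCompl hp hM).pow_left _), h0, zero_mul]

/-- The Euler product of the sum of `h (M k) / h M` over the `k` coprime to `e`. -/
theorem hasProd_apply_mul_div (hh : h.IsMultiplicative)
    (hsum : Summable fun n => ‖h n‖) (hM : M ≠ 0) (hM' : h M ≠ 0) (e : ℕ) :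
    HasProd (fun p : Nat.Primes =>
        ∑' j, if j = 0 ∨ ¬ (p : ℕ) ∣ e then
          h (p ^ (M.factorization p + j)) / h (p ^ M.factorization p) else 0)
      (∑' k, if k.Coprime e then h (M * k) / h M else 0) := by
  set g : ℕ → ℝ := fun k => if k.Coprime e then h (M * k) / h M else 0 with hg
  have hg1 : g 1 = 1 := by simp [hg, hM']
  have hg0 : g 0 = 0 := by simp [hg]
  have hmul : ∀ {a b : ℕ}, a.Coprime b → g (a * b) = g a * g b := by
    intro a b hab
    have := apply_mul_mul_apply hh (M := M) hab
    simp only [hg, Nat.coprime_mul_iff_left]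
    by_cases ha : a.Coprime e
    · by_cases hb : b.Coprime e
      · rw [if_pos ⟨ha, hb⟩, if_pos ha, if_pos hb]
        field_simp
        exact this
      · rw [if_neg (by tauto), if_neg hb, mul_zero]
    · rw [if_neg (by tauto), if_neg ha, zero_mul]
  have hs : Summable fun k => ‖g k‖ := by
    have h1 : Summable fun k => ‖h (M * k)‖ / ‖h M‖ :=
      (hsum.comp_injective (mul_right_injective₀ hM)).div_const _
    refine Summable.of_nonneg_of_le (fun _ => norm_nonneg _) (fun k => ?_) h1
    simp only [hg]
    split_ifs
    · rw [norm_div]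
    · rw [norm_zero]; positivity
  have hfun : (fun p : Nat.Primes => ∑' j, if j = 0 ∨ ¬ (p : ℕ) ∣ e then
      h (p ^ (M.factorization p + j)) / h (p ^ M.factorization p) else 0) =
      fun p : Nat.Primes => ∑' j, g (p ^ j) := by
    refine funext fun p => tsum_congr fun j => ?_
    have h0 : h (p ^ M.factorization p) ≠ 0 := fun h0 =>
      hM' (apply_eq_zero_of_prime_pow hh p.2 hM h0)
    have hiff : ((p : ℕ) ^ j).Coprime e ↔ j = 0 ∨ ¬ (p : ℕ) ∣ e := by
      rcases Nat.eq_zero_or_pos j with rfl | hj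
      · simp
      · rw [Nat.coprime_pow_left_iff hj, p.2.coprime_iff_not_dvd]
        simp [hj.ne']
    simp only [hg, hiff]
    refine if_congr Iff.rfl ?_ rfl
    rw [div_eq_div_iff h0 hM', apply_mul_prime_pow hh p.2 hM]
  rw [hfun]
  exact EulerProduct.eulerProduct_hasProd hg1 hmul hs hg0

end Multiplicative

end NieburPoincare
end

/-! ### Evaluation of the Dirichlet series and the coprime part of m. -/

noncomputable section
namespace NieburPoincare

open ArithmeticFunction Finset

theorem hasProd_zeta_two :
    HasProd (fun p : Nat.Primes => (1 - (((p : ℕ) : ℝ) ^ 2)⁻¹)⁻¹) (Real.pi ^ 2 / 6) := by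
  let f : ℕ →*₀ ℝ :=
    { toFun := fun n => ((n : ℝ) ^ 2)⁻¹
      map_zero' := by simp
      map_one' := by simp
      map_mul' := fun a b => by push_cast; rw [mul_pow, mul_inv] }
  have h : HasSum (fun n => f n) (Real.pi ^ 2 / 6) := by
    simpa [f] using hasSum_zeta_two
  have := EulerProduct.eulerProduct_completely_multiplicative_hasProd (f := f) h.summable.norm
  rwa [h.tsum_eq] at this

theorem tsum_levelTerm_eq_mul {m M e : ℕ} (hM : M ≠ 0) (hMe : M.Coprime e)
    (h0 : ramanujanDivSq m M ≠ 0) :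
    ∑' k, levelTerm m M e k = ramanujanDivSq m M *
      ∑' k, if k.Coprime e then ramanujanDivSq m (M * k) / ramanujanDivSq m M else 0 := by
  rw [← tsum_mul_left, ← (mul_right_injective₀ hM).tsum_eq]
  · refine tsum_congr fun k => ?_
    have : (M * k).Coprime e ↔ k.Coprime e := by
      rw [Nat.coprime_mul_iff_left]; exact and_iff_right hMe
    simp only [levelTerm, dvd_mul_right, true_and, this]
    split_ifs
    · field_simp
    · simp
  · intro k hk
    rw [Function.mem_support, levelTerm] at hk
    obtain ⟨⟨j, hj⟩, -⟩ := (ite_ne_right_iff.1 hk).1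
    exact ⟨j, hj.symm⟩

/-- Every nonzero multiple of M has order at p above α + 1, where the local value vanishes; this is
the origin of δ_e(p). -/
theorem levelTerm_eq_zero {m M e p : ℕ} (hm : 0 < m) (hp : p.Prime)
    (h : alpha m p + 1 < M.factorization p) (k : ℕ) : levelTerm m M e k = 0 := by
  rw [levelTerm]
  split_ifs with hk
  · rcases eq_or_ne k 0 with rfl | hk0
    · simp
    · exact apply_eq_zero_of_prime_pow (isMultiplicative_ramanujanDivSq m) hp hk0
        (ramanujanDivSq_prime_pow_eq_zero hm hp
          (h.trans_le ((Nat.factorization_le_iff_dvd (ne_zero_of_dvd_ne_zero hk0 hk.1) hk0).2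
            hk.1 p)))
  · rfl

/-- The Euler factor at `p` of the sum of the `levelTerm m M e`. -/
theorem tsum_local {m M e p : ℕ} (hm : 0 < m) (hp : p.Prime) (hM : M ≠ 0) (hMe : M.Coprime e) :
    (∑' j, if j = 0 ∨ ¬ p ∣ e then ramanujanDivSq m (p ^ (M.factorization p + j)) /
      ramanujanDivSq m (p ^ M.factorization p) else 0) * (1 - ((p : ℝ) ^ 2)⁻¹)⁻¹ =
      if p ∣ M then localTail m p (M.factorization p) /
        ramanujanDivSq m (p ^ M.factorization p) * (1 - ((p : ℝ) ^ 2)⁻¹)⁻¹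
      else if p ∣ e then (1 - ((p : ℝ) ^ 2)⁻¹)⁻¹
      else ∑ j ∈ range (alpha m p + 1), (p : ℝ)⁻¹ ^ j := by
  have h1 := (isMultiplicative_ramanujanDivSq m).map_one
  split_ifs with hpM hpe
  · have hpe : ¬ p ∣ e := fun hpe => hp.not_dvd_one (hMe ▸ Nat.dvd_gcd hpM hpe)
    simp only [hpe, not_false_eq_true, or_true, if_true]
    rw [tsum_div_const, (hasSum_ramanujanDivSq_prime_pow hm hp
      (hp.factorization_pos_of_dvd hM hpM)).tsum_eq]
  · rw [tsum_eq_single 0 fun j hj => by simp [hj, hpe]]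
    simp [Nat.factorization_eq_zero_of_not_dvd hpM, h1]
  · simp only [hpe, not_false_eq_true, or_true, if_true,
      Nat.factorization_eq_zero_of_not_dvd hpM, zero_add, pow_zero, h1, div_one]
    rw [(hasSum_ramanujanDivSq_prime_pow_zero hm hp).tsum_eq]
    have h2 : (1 - ((p : ℝ) ^ 2)⁻¹) ≠ 0 := by
      refine sub_ne_zero.2 (ne_of_gt (inv_lt_one_of_one_lt₀ ?_))
      exact one_lt_pow₀ (by exact_mod_cast hp.one_lt) two_ne_zero
    rw [mul_comm, inv_mul_cancel_left₀ h2]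

/-- Multiplying by the Euler product of ζ(2) turns the factor at every prime outside M, e and m into
1, so that a finite product remains. -/
theorem tsum_levelTerm {m M e : ℕ} (hm : 0 < m) (hM : M ≠ 0) (he : e ≠ 0) (hMe : M.Coprime e) :
    (∑' k, levelTerm m M e k) * (Real.pi ^ 2 / 6) =
      (∏ p ∈ M.primeFactors, localTail m p (M.factorization p)) *
        (∏ p ∈ (M * e).primeFactors, (1 - ((p : ℝ) ^ 2)⁻¹)⁻¹) *
        ∏ p ∈ m.primeFactors \ (M * e).primeFactors,
          ∑ j ∈ range (alpha m p + 1), (p : ℝ)⁻¹ ^ j := by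
  -- If some order in M is too large, both sides vanish. Otherwise the value at M is nonzero, and
  -- the series can be normalised by it.
  by_cases hbig : ∃ p ∈ M.primeFactors, alpha m p + 1 < M.factorization p
  · obtain ⟨p, hp, hlt⟩ := hbig
    have hp' := Nat.prime_of_mem_primeFactors hp
    rw [tsum_congr fun k => levelTerm_eq_zero hm hp' hlt k, tsum_zero, zero_mul,
      prod_eq_zero hp (by rw [localTail, if_neg (by omega)]), zero_mul, zero_mul]
  push Not at hbig
  have hmul := isMultiplicative_ramanujanDivSq m
  have hloc : ∀ p ∈ M.primeFactors, ramanujanDivSq m (p ^ M.factorization p) ≠ 0 := fun p hp =>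
    ramanujanDivSq_prime_pow_ne_zero hm (Nat.prime_of_mem_primeFactors hp) (hbig p hp)
  have h0 := apply_ne_zero_of_prime_pow hmul hM hloc
  have hprod := (hasProd_apply_mul_div hmul (summable_norm_ramanujanDivSq hm) hM h0 e).mul
    hasProd_zeta_two
  set L : ℕ → ℝ := fun p => if p ∣ M then localTail m p (M.factorization p) /
        ramanujanDivSq m (p ^ M.factorization p) * (1 - ((p : ℝ) ^ 2)⁻¹)⁻¹
      else if p ∣ e then (1 - ((p : ℝ) ^ 2)⁻¹)⁻¹
      else ∑ j ∈ range (alpha m p + 1), (p : ℝ)⁻¹ ^ j with hL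
  have hfun : (fun p : Nat.Primes => (∑' j, if j = 0 ∨ ¬ (p : ℕ) ∣ e then
      ramanujanDivSq m (p ^ (M.factorization p + j)) /
        ramanujanDivSq m (p ^ M.factorization p) else 0) * (1 - (((p : ℕ) : ℝ) ^ 2)⁻¹)⁻¹) =
      fun p : Nat.Primes => L p := funext fun p => tsum_local hm p.2 hM hMe
  rw [hfun] at hprod
  set S : Finset ℕ := (M * e).primeFactors ∪ (m.primeFactors \ (M * e).primeFactors) with hS
  have hSp : ∀ p ∈ S, p.Prime := by
    intro p hp
    rw [hS, mem_union, mem_sdiff] at hp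
    rcases hp with hp | ⟨hp, -⟩ <;> exact Nat.prime_of_mem_primeFactors hp
  have hfin : HasProd (fun p : Nat.Primes => L p) (∏ p ∈ S, L p) := by
    rw [← prod_subtype_of_mem L hSp]
    refine hasProd_prod_of_ne_finset_one fun p hp => ?_
    have hp' : (p : ℕ) ∉ S := fun h => hp (mem_subtype.2 h)
    simp only [hS, mem_union, mem_sdiff, Nat.mem_primeFactors, not_or, not_and, not_not] at hp'
    have h1 : ¬ (p : ℕ) ∣ M * e := fun h => mul_ne_zero hM he (hp'.1 p.2 h)
    have h2 : ¬ (p : ℕ) ∣ m := fun h =>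
      hp'.2 ⟨p.2, h, hm.ne'⟩ fun _ h' => absurd h' h1
    simp only [hL]
    rw [if_neg fun h => h1 (h.mul_right _), if_neg fun h => h1 (h.mul_left _), alpha,
      Nat.factorization_eq_zero_of_not_dvd h2]
    simp
  have hval := hprod.unique hfin
  rw [tsum_levelTerm_eq_mul hM hMe h0, mul_assoc, hval, hS, prod_union disjoint_sdiff, ← mul_assoc]
  congr 1
  · rw [hMe.primeFactors_mul, prod_union hMe.disjoint_primeFactors,
      prod_union hMe.disjoint_primeFactors, hmul.multiplicative_factorization _ hM, Finsupp.prod,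
      Nat.support_factorization, ← mul_assoc, ← mul_assoc, ← prod_mul_distrib, ← prod_mul_distrib]
    congr 1
    · refine prod_congr rfl fun p hp => ?_
      have := hloc p hp
      simp only [hL]
      rw [if_pos (Nat.dvd_of_mem_primeFactors hp)]
      field_simp
    · refine prod_congr rfl fun p hp => ?_
      simp only [hL]
      rw [if_neg, if_pos (Nat.dvd_of_mem_primeFactors hp)]
      exact fun h => disjoint_left.1 hMe.disjoint_primeFactors
        (Nat.mem_primeFactors.2 ⟨Nat.prime_of_mem_primeFactors hp, h, hM⟩) hp
  · refine prod_congr rfl fun p hp => ?_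
    obtain ⟨hpm, hp'⟩ := mem_sdiff.1 hp
    have hpr := Nat.prime_of_mem_primeFactors hpm
    have h1 : ¬ p ∣ M * e := fun h => hp' (Nat.mem_primeFactors.2 ⟨hpr, h, mul_ne_zero hM he⟩)
    simp only [hL]
    rw [if_neg fun h => h1 (h.mul_right _), if_neg fun h => h1 (h.mul_left _)]

/-- The product of the prime powers of `m` at the primes not dividing `N`. -/
theorem coprimePart_eq {m : ℕ} (hm : 0 < m) (N : ℕ) (hN : 0 < N) :
    coprimePart m N = ∏ p ∈ m.primeFactors \ N.primeFactors, p ^ alpha m p := by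
  set D := ∏ p ∈ m.primeFactors \ N.primeFactors, p ^ alpha m p with hD
  set D' := ∏ p ∈ m.primeFactors ∩ N.primeFactors, p ^ alpha m p with hD'
  have hmD : D * D' = m := by
    rw [hD, hD', mul_comm, prod_inter_mul_prod_sdiff]
    exact Nat.prod_factorization_pow_eq_self hm.ne'
  have hDN : D.Coprime N := by
    refine Nat.Coprime.prod_left fun p hp => Nat.Coprime.pow_left _ ?_
    obtain ⟨hpm, hp'⟩ := mem_sdiff.1 hp
    have hpr := Nat.prime_of_mem_primeFactors hpm
    exact (hpr.coprime_iff_not_dvd).2 fun h => hp' (Nat.mem_primeFactors.2 ⟨hpr, h, hN.ne'⟩)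
  have hD'N : ∀ d : ℕ, d.Coprime N → d.Coprime D' := by
    intro d hd
    refine Nat.Coprime.prod_right fun p hp => Nat.Coprime.pow_right _ ?_
    exact hd.coprime_dvd_right (Nat.dvd_of_mem_primeFactors (mem_inter.1 hp).2)
  have hD0 : 0 < D := Nat.pos_of_ne_zero fun h => hm.ne' (by rw [← hmD, h, zero_mul])
  -- A divisor of m = D D' that is coprime to N is coprime to D', hence divides D; and D itself is
  -- admissible.
  refine le_antisymm (Finset.sup_le fun d hd => ?_) (Finset.le_sup (f := id) ?_)
  · obtain ⟨hd1, hd2⟩ := mem_filter.1 hd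
    refine Nat.le_of_dvd hD0 ((hD'N d hd2).dvd_of_dvd_mul_right ?_)
    rw [hmD]
    exact dvd_of_mem_exactDivisors hd1
  · rw [mem_filter, exactDivisors, mem_filter, Nat.mem_divisors]
    refine ⟨⟨⟨⟨D', hmD.symm⟩, hm.ne'⟩, ?_⟩, hDN⟩
    rw [← Nat.div_eq_of_eq_mul_right hD0 hmD.symm] at hD'N
    exact hD'N D hDN

/-- By multiplicativity it suffices that σ(p^α)/p^α is the sum of p^(-j) over j ≤ α, by reversing
the order of summation. -/
theorem sigma_coprimePart_div {m : ℕ} (hm : 0 < m) (N : ℕ) (hN : 0 < N) :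
    (sigma 1 (coprimePart m N) : ℝ) / coprimePart m N =
      ∏ p ∈ m.primeFactors \ N.primeFactors, ∑ j ∈ range (alpha m p + 1), (p : ℝ)⁻¹ ^ j := by
  have hpr : ∀ p ∈ m.primeFactors \ N.primeFactors, p.Prime := fun p hp =>
    Nat.prime_of_mem_primeFactors (mem_sdiff.1 hp).1
  rw [coprimePart_eq hm N hN, isMultiplicative_sigma.map_prod]
  · rw [Nat.cast_prod, Nat.cast_prod, ← prod_div_distrib]
    refine prod_congr rfl fun p hp => ?_
    have h0 : (p : ℝ) ≠ 0 := by exact_mod_cast (hpr p hp).ne_zero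
    rw [sigma_one_apply_prime_pow (hpr p hp), ← sum_range_reflect]
    push_cast
    rw [sum_div]
    refine sum_congr rfl fun j hj => ?_
    have hj' : alpha m p + 1 - 1 - j + j = alpha m p := by
      have := mem_range.1 hj
      omega
    rw [div_eq_iff (pow_ne_zero _ h0)]
    conv_rhs => rw [← hj', pow_add]
    rw [inv_pow, mul_comm (_ ^ _) (_ ^ j), inv_mul_cancel_left₀ (pow_ne_zero _ h0),
      Nat.add_sub_cancel]
  · intro p hp q hq hpq
    exact Nat.Coprime.pow _ _ ((Nat.coprime_primes (hpr p hp) (hpr q hq)).2 hpq)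

end NieburPoincare
end

/-! ### Assembly of the formula. -/

noncomputable section
namespace NieburPoincare

open ArithmeticFunction Finset

/-- Expanding the product gives p^(-β) - p^(-α-1) - p^(-α-2), and δ is the case distinction in
`localTail`. -/
theorem localTail_beta {N m e p : ℕ} (hp : p.Prime) :
    localTail m p (beta N e p) = delta N m e p * (p : ℝ) ^ (1 - (beta N e p : ℤ)) *
      ((1 - (p : ℝ) ^ ((beta N e p : ℤ) - (alpha m p : ℤ) - 2)) * (1 + (p : ℝ) ^ (-1 : ℤ)) - 1) := by
  have h0 : (p : ℝ) ≠ 0 := by exact_mod_cast hp.ne_zero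
  rw [localTail, delta]
  split_ifs
  · simp only [zpow_sub₀ h0, zpow_neg, zpow_natCast, inv_pow, pow_add, zpow_ofNat]
    field_simp
    ring
  · simp

/-- The series over the pairs `(e, C)` as a sum of Dirichlet series over `C`. -/
theorem tsum_levelPair (N : ℕ) {m : ℕ} (hm : 0 < m) :
    ∑' p : LevelPair N, (∑ u, p.weight m u) * (4 * Real.pi ^ 2 * m / p.conductor) =
      ((∑ e ∈ exactDivisors N, 4 * Real.pi ^ 2 * m / e * ∑' k, levelTerm m (N / e) e k : ℝ) : ℂ) := by
  -- Extension by zero to all pairs. No pair with C = 0 enters, since arithmetic functions vanish at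
  -- 0.
  set G : ℕ × ℕ → ℝ := fun q => if q.1 ∈ exactDivisors N then
    4 * Real.pi ^ 2 * m / q.1 * levelTerm m (N / q.1) q.1 q.2 else 0 with hG
  have h1 : ∀ p : LevelPair N,
      (∑ u, p.weight m u) * (4 * Real.pi ^ 2 * m / p.conductor) = ((G p.1 : ℝ) : ℂ) := by
    intro p
    simp only [hG]
    rw [sum_weight, if_pos p.2.1, levelTerm, if_pos p.2.2.2, ramanujanDivSq_apply,
      LevelPair.conductor]
    push_cast
    have : (p.1.2 : ℂ) ≠ 0 := by exact_mod_cast p.2.2.1.ne'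
    have : (p.1.1 : ℂ) ≠ 0 := by exact_mod_cast p.e_pos.ne'
    field_simp
  have h2 : ∀ e, HasSum (fun q : ℕ × ℕ => if q.1 = e then
      4 * Real.pi ^ 2 * m / e * levelTerm m (N / e) e q.2 else 0)
      (4 * Real.pi ^ 2 * m / e * ∑' k, levelTerm m (N / e) e k) := by
    intro e
    rw [← (Prod.mk_right_injective e).hasSum_iff]
    · simpa [Function.comp_def] using
        (summable_norm_levelTerm hm (N / e) e).of_norm.hasSum.mul_left (4 * Real.pi ^ 2 * m / e : ℝ)
    · rintro ⟨a, b⟩ hq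
      refine if_neg fun h => hq ⟨b, ?_⟩
      simp only at h
      rw [h]
  have h3 : HasSum G (∑ e ∈ exactDivisors N,
      4 * Real.pi ^ 2 * m / e * ∑' k, levelTerm m (N / e) e k) := by
    convert hasSum_sum (s := exactDivisors N) fun e _ => h2 e using 2 with q
    rw [sum_ite_eq]
  have h4 : Function.support G ⊆
      {p : ℕ × ℕ | p.1 ∈ exactDivisors N ∧ 0 < p.2 ∧ N / p.1 ∣ p.2 ∧ p.2.Coprime p.1} := by
    intro q hq
    rw [Function.mem_support] at hq
    obtain ⟨hq1, hq2⟩ := ite_ne_right_iff.1 hq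
    have hq3 := right_ne_zero_of_mul hq2
    obtain ⟨hq4, hq5⟩ := ite_ne_right_iff.1 hq3
    refine ⟨hq1, Nat.pos_of_ne_zero fun h => hq5 ?_, hq4⟩
    rw [h, ArithmeticFunction.map_zero]
  rw [tsum_congr h1, ← Complex.ofReal_tsum, ← h3.tsum_eq, ← tsum_subtype_eq_of_support_subset h4]
  rfl

/-- The constant term of the Niebur-Poincaré series at `s = 1`. -/
def constantTerm (N m : ℕ) : ℝ :=
  24 * ((m : ℝ) / (coprimePart m N : ℝ)) * (ArithmeticFunction.sigma 1 (coprimePart m N) : ℝ) *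
    (∏ p ∈ N.primeFactors, (1 - (p : ℝ) ^ (-2 : ℤ))⁻¹) *
    ∑ e ∈ exactDivisors N, 1 / (e : ℝ) *
      ∏ p ∈ (N / e).primeFactors,
        delta N m e p * (p : ℝ) ^ (1 - (beta N e p : ℤ)) *
          ((1 - (p : ℝ) ^ ((beta N e p : ℤ) - (alpha m p : ℤ) - 2)) *
            (1 + (p : ℝ) ^ (-1 : ℤ)) - 1)

theorem sum_tsum_levelTerm {N m : ℕ} (hN : 0 < N) (hm : 0 < m) :
    ∑ e ∈ exactDivisors N, 4 * Real.pi ^ 2 * m / e * ∑' k, levelTerm m (N / e) e k =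
      constantTerm N m := by
  rw [constantTerm, mul_sum]
  refine sum_congr rfl fun e he => ?_
  have hdvd := dvd_of_mem_exactDivisors he
  have he0 : 0 < e := pos_of_mem_exactDivisors he
  have hMe : (N / e).Coprime e := ((mem_filter.1 he).2).symm
  have hM0 : N / e ≠ 0 := (Nat.div_pos (Nat.le_of_dvd hN hdvd) he0).ne'
  have h := tsum_levelTerm hm hM0 he0.ne' hMe
  rw [Nat.div_mul_cancel hdvd, ← sigma_coprimePart_div hm N hN] at h
  have h1 : ∏ p ∈ (N / e).primeFactors, localTail m p ((N / e).factorization p) =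
      ∏ p ∈ (N / e).primeFactors, delta N m e p * (p : ℝ) ^ (1 - (beta N e p : ℤ)) *
        ((1 - (p : ℝ) ^ ((beta N e p : ℤ) - (alpha m p : ℤ) - 2)) *
          (1 + (p : ℝ) ^ (-1 : ℤ)) - 1) :=
    prod_congr rfl fun p hp => localTail_beta (Nat.prime_of_mem_primeFactors hp)
  have h2 : ∏ p ∈ N.primeFactors, (1 - ((p : ℝ) ^ 2)⁻¹)⁻¹ =
      ∏ p ∈ N.primeFactors, (1 - (p : ℝ) ^ (-2 : ℤ))⁻¹ :=
    prod_congr rfl fun p _ => by rw [zpow_neg]; norm_cast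
  rw [h1, h2] at h
  -- Here 4π² = 24 · π²/6 accounts for the constant 24.
  linear_combination (24 * m / e) * h

theorem hasConstantTerm {N m : ℕ} (hN : 0 < N) (hm : 0 < m) {F : ℍ → ℂ → ℂ}
    (hF : IsNieburPoincare N m F) :
    HasConstantTerm (fun z => 2 * Real.pi * ((√(m : ℝ) : ℝ) : ℂ) * F z 1) (constantTerm N m) := by
  have h := hasConstantTerm_continuation N hm
  rw [tsum_levelPair N hm, sum_tsum_levelTerm hN hm] at h
  convert h using 3 with z
  exact hF.apply_one_eq (isNieburPoincare_continuation hN hm) z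

theorem coprimePart_of_coprime {m N : ℕ} (hm : 0 < m) (hN : 0 < N) (h : m.Coprime N) :
    coprimePart m N = m := by
  rw [coprimePart_eq hm N hN, sdiff_eq_self_of_disjoint h.disjoint_primeFactors]
  exact Nat.prod_factorization_pow_eq_self hm.ne'

/-- At the primes of N/e the order of m is 0, as for m = 1, so the sum over e is unchanged; moreover
m_N = m, and only σ(m) differs. -/
theorem constantTerm_of_coprime {m N : ℕ} (hm : 0 < m) (hN : 0 < N) (h : m.Coprime N) :
    constantTerm N m = sigma 1 m * constantTerm N 1 := by
  have hα : ∀ e ∈ exactDivisors N, ∀ p ∈ (N / e).primeFactors, alpha m p = alpha 1 p := by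
    intro e he p hp
    have hpN : p ∣ N := (Nat.dvd_of_mem_primeFactors hp).trans
      (Nat.div_dvd_of_dvd (dvd_of_mem_exactDivisors he))
    rw [alpha, alpha, Nat.factorization_one, Nat.factorization_eq_zero_of_not_dvd]
    · rfl
    · exact fun hpm => (Nat.prime_of_mem_primeFactors hp).not_dvd_one
        (h ▸ Nat.dvd_gcd hpm hpN)
  have hm0 : (m : ℝ) ≠ 0 := by exact_mod_cast hm.ne'
  rw [constantTerm, constantTerm, coprimePart_of_coprime hm hN h,
    coprimePart_of_coprime one_pos hN (Nat.coprime_one_left N), div_self hm0, sigma_one]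
  have hsum : ∀ e ∈ exactDivisors N, 1 / (e : ℝ) * ∏ p ∈ (N / e).primeFactors,
        delta N m e p * (p : ℝ) ^ (1 - (beta N e p : ℤ)) *
          ((1 - (p : ℝ) ^ ((beta N e p : ℤ) - (alpha m p : ℤ) - 2)) *
            (1 + (p : ℝ) ^ (-1 : ℤ)) - 1) = 1 / (e : ℝ) * ∏ p ∈ (N / e).primeFactors,
        delta N 1 e p * (p : ℝ) ^ (1 - (beta N e p : ℤ)) *
          ((1 - (p : ℝ) ^ ((beta N e p : ℤ) - (alpha 1 p : ℤ) - 2)) *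
            (1 + (p : ℝ) ^ (-1 : ℤ)) - 1) := fun e he => by
    congr 1
    refine prod_congr rfl fun p hp => ?_
    rw [delta, delta, hα e he p hp]
  rw [sum_congr rfl hsum]
  push_cast
  ring

end NieburPoincare
end

open NieburPoincare in
theorem theorem2p3 (N : ℕ) (hN : 0 < N) :
    ∃ c : ℕ → ℝ,
      (∀ m : ℕ, 0 < m →
        (∃ F : ℍ → ℂ → ℂ, IsNieburPoincare N m F) ∧
        (∀ F : ℍ → ℂ → ℂ, IsNieburPoincare N m F →
          HasConstantTerm (fun z => 2 * Real.pi * ((√(m : ℝ) : ℝ) : ℂ) * F z 1)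
            ((-c m : ℝ) : ℂ)) ∧
        -c m =
          24 * ((m : ℝ) / (coprimePart m N : ℝ)) * (ArithmeticFunction.sigma 1 (coprimePart m N) : ℝ) *
            (∏ p ∈ N.primeFactors, (1 - (p : ℝ) ^ (-2 : ℤ))⁻¹) *
            ∑ e ∈ exactDivisors N, 1 / (e : ℝ) *
              ∏ p ∈ (N / e).primeFactors,
                delta N m e p * (p : ℝ) ^ (1 - (beta N e p : ℤ)) *
                  ((1 - (p : ℝ) ^ ((beta N e p : ℤ) - (alpha m p : ℤ) - 2)) *
                    (1 + (p : ℝ) ^ (-1 : ℤ)) - 1)) ∧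
      (∀ m : ℕ, 0 < m → Nat.Coprime m N → c m = (ArithmeticFunction.sigma 1 m : ℝ) * c 1) := by
  refine ⟨fun m => -constantTerm N m, fun m hm =>
    ⟨⟨_, isNieburPoincare_continuation hN hm⟩, fun F hF => ?_, ?_⟩, fun m hm h => ?_⟩
  · rw [neg_neg]
    exact hasConstantTerm hN hm hF
  · rw [neg_neg, constantTerm]
  · simp only [constantTerm_of_coprime hm hN h]
    ring
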